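/- **Theorem 3.5.** Let $(M,g)$ be a smooth pseudo-Riemannian manifold of dimension $n$ with Levi-Civita connection $\nabla$, let $\hbar\neq 0$ be a real constant, and write $\mathbf{i}$ for the imaginary unit. Let $\mathcal{M}=T^*M\times_M\Pi TM$ be the supercotangent bundle: a chart $(x^i)$ of $M$ gives natural coordinates $(x^i,p_i,\xi^i)$ on $\mathcal M$ ($x^i,p_i$ even, $\xi^i$ odd), which transform by $p'_i=\frac{\partial x^j}{\partial x'^i}p_j$ and $\xi'^i=\frac{\partial x'^i}{\partial x^j}\xi^j$, and (super)functions on $\mathcal M$ are locally the smooth complex functions of $(x,p)$ with values in the Grassmann algebra generated by the $\xi^i$. With $\Gamma^k_{ij}$ the Christoffel symbols and $d^\nabla\xi^i=d\xi^i+\Gamma^i_{jk}\xi^j dx^k$, consider the $1$-forms $$\alpha=p_i\,dx^i+\frac{\hbar}{2\mathbf{i}}\,g_{ij}\,\xi^i d^\nabla\xi^j,\qquad \beta=g_{ij}\,\xi^i dx^j .$$ A lift of a smooth vector field $X$ on $M$ is an even vector field $\tilde X$ on $\mathcal M$ that projects onto $X$, i.e. $\tilde X(x^i)=X^i$. It preserves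 $\alpha$ if $L_{\tilde X}\alpha=0$, and it preserves the direction of $\beta$ if $L_{\tilde X}\beta=f\beta$ for some $f\in C^\infty(M)$. Let $\mathrm{conf}(M,g)$ be the set of smooth vector fields $X$ on $M$ with $L_Xg=\lambda g$ for some $\lambda\in C^\infty(M)$. 1. A smooth vector field $X$ on $M$ has a lift that preserves $\alpha$ and the direction of $\beta$ if and only if $X\in\mathrm{conf}(M,g)$. 2. If $X\in\mathrm{conf}(M,g)$, this lift $\tilde X$ is unique, and in all natural coordinates $$\tilde X=X^i\partial^\nabla_i+\partial_{[j}X_{i]}\,\xi^j\partial_{\xi_i}-p_j\nabla_iX^j\,\partial_{p_i}+\frac{\hbar}{2\mathbf{i}}\Big(R^k_{lij}\,\xi_k\xi^lX^j-(\nabla_i\partial_{[l}X_{k]})\,\xi^k\xi^l\Big)\partial_{p_i},$$ where $\partial^\nabla_i=\partial_i+\Gamma^k_{ij}p_k\partial_{p_j}-\Gamma^k_{ij}\xi^j\partial_{\xi^k}$, $X_i=g_{ij}X^j$, $\xi_i=g_{ij}\xi^j$, $\partial_{\xi_i}=g^{ij}\partial_{\xi^j}$, $\partial_{[j}X_{i]}=\frac12(\partial_jX_i-\partial_iX_j)$,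 and $R^c_{aij}=\partial_i\Gamma^c_{aj}-\partial_j\Gamma^c_{ai}+\Gamma^c_{ik}\Gamma^k_{aj}-\Gamma^c_{jk}\Gamma^k_{ai}$ is the Riemann tensor. 3. $\mathrm{conf}(M,g)$ is a Lie algebra under the bracket of vector fields, and $X\mapsto\tilde X$ is a morphism of real Lie algebras $\mathrm{conf}(M,g)\to\mathrm{Vect}(\mathcal M)$: it is $\mathbb R$-linear and $\widetilde{[X,Y]}=[\tilde X,\tilde Y]$. -/

import Mathlib

open scoped Manifold ContDiff

noncomputable section

namespace Supercotangent

/-! ### The Grassmann algebra and superfunctions on a chart -/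

/-- The model of the coordinate charts of `M`. -/
abbrev Coord (n : ℕ) : Type := EuclideanSpace ℝ (Fin n)

/-- The complex Grassmann algebra on the `n` odd generators `ξ¹, …, ξⁿ`. -/
def Grassmann (n : ℕ) : Type := ExteriorAlgebra ℂ (Fin n → ℂ)

instance (n : ℕ) : Ring (Grassmann n) := inferInstanceAs (Ring (ExteriorAlgebra ℂ (Fin n → ℂ)))

instance (n : ℕ) : Algebra ℂ (Grassmann n) :=
  inferInstanceAs (Algebra ℂ (ExteriorAlgebra ℂ (Fin n → ℂ)))

/-- The odd generator `ξⁱ`. -/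
def xi {n : ℕ} (i : Fin n) : Grassmann n := ExteriorAlgebra.ι ℂ (Pi.single i 1)

/-- A real number, seen as an element of degree zero of the Grassmann algebra. -/
def real {n : ℕ} (r : ℝ) : Grassmann n := algebraMap ℂ (Grassmann n) (r : ℂ)

/-- The coefficients of an element of the Grassmann algebra on the monomials
`ξ^{i₁} ⋯ ξ^{i_k}`, `i₁ < ⋯ < i_k`. -/
def coeffs (n : ℕ) : Grassmann n ≃ₗ[ℂ] (Finset (Fin n) → ℂ) :=
  (Pi.basisFun ℂ (Fin n)).ExteriorAlgebra.equivFun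

/-- The (finite dimensional) Grassmann algebra is normed by the maximum of the coefficients, so
that a Grassmann valued map is smooth, or is differentiated, coefficient by coefficient. -/
instance (n : ℕ) : NormedAddCommGroup (Grassmann n) :=
  NormedAddCommGroup.induced (Grassmann n) (Finset (Fin n) → ℂ) (coeffs n) (coeffs n).injective

instance (n : ℕ) : NormedSpace ℂ (Grassmann n) :=
  NormedSpace.induced ℂ (Grassmann n) (Finset (Fin n) → ℂ) (coeffs n).toLinearMap

/-- The elements of parity `a` (`0` is even, `1` is odd) of the Grassmann algebra. -/
def parity (n : ℕ) (a : ZMod 2) : Submodule ℂ (Grassmann n) :=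
  CliffordAlgebra.evenOdd (0 : QuadraticForm ℂ (Fin n → ℂ)) a

/-- Superfunctions in natural coordinates `(x, p, ξ)`: maps `(x, p) ↦ F(x, p)` with values in the
Grassmann algebra in the `ξⁱ`. Only the values over the domain of a chart matter. -/
abbrev SFun (n : ℕ) : Type := Coord n × Coord n → Grassmann n

variable {n : ℕ}

/-- `∂F/∂xⁱ`. -/
def dX (i : Fin n) (F : SFun n) : SFun n :=
  fun z ↦ fderiv ℝ F z (EuclideanSpace.single i 1, 0)

/-- `∂F/∂pᵢ`. -/
def dP (i : Fin n) (F : SFun n) : SFun n :=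
  fun z ↦ fderiv ℝ F z (0, EuclideanSpace.single i 1)

/-- The left derivative `∂F/∂ξⁱ`: contraction with the linear form dual to `ξⁱ`. -/
def dXi (i : Fin n) (F : SFun n) : SFun n :=
  fun z ↦ CliffordAlgebra.contractLeft (Q := (0 : QuadraticForm ℂ (Fin n → ℂ)))
    (LinearMap.proj i) (F z)

/-- The coordinate superfunction `xⁱ`. -/
def coordX (i : Fin n) : SFun n := fun z ↦ real (z.1 i)

/-- The coordinate superfunction `pᵢ`. -/
def coordP (i : Fin n) : SFun n := fun z ↦ real (z.2 i)

/-- The coordinate superfunction `ξⁱ`. -/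
def coordXi (i : Fin n) : SFun n := fun _ ↦ xi i

/-- The vector field `∑ Xⁱ ∂/∂xⁱ + Pᵢ ∂/∂pᵢ + Ξⁱ ∂/∂ξⁱ` in natural coordinates, given by its
components. -/
@[ext]
structure LocalField (n : ℕ) where
  x : Fin n → SFun n
  p : Fin n → SFun n
  xi : Fin n → SFun n

/-- The action of a vector field on superfunctions. -/
def LocalField.apply (V : LocalField n) (F : SFun n) : SFun n := fun z ↦
  ∑ i, (V.x i z * dX i F z + V.p i z * dP i F z + V.xi i z * dXi i F z)

/-- The `1`-form `∑ aᵢ dxⁱ + bⁱ dpᵢ + cᵢ dξⁱ` in natural coordinates, given by its coefficients,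
written on the left of the differentials. -/
@[ext]
structure LocalForm (n : ℕ) where
  x : Fin n → SFun n
  p : Fin n → SFun n
  xi : Fin n → SFun n

/-- The Lie derivative of a `1`-form along an *even* vector field `V`. The operator `L_V` is the even
derivation of differential forms that extends `V` and commutes with `d`, so that
`L_V (a dz) = V(a) dz + a d(V(z))` for each of the coordinates `z`.
Here `d h = ∑ dxʲ ∂h/∂xʲ + dpⱼ ∂h/∂pⱼ + dξʲ ∂h/∂ξʲ`, and moving the coefficient `∂h/∂ξʲ` to the left
of the odd symbol `dξʲ` costs a sign exactly when `∂h/∂ξʲ` is odd, that is, when `h` is even: this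
is the case for `h = V(xⁱ)` and `h = V(pᵢ)`, but not for `h = V(ξⁱ)`. -/
def LocalField.lieDeriv (V : LocalField n) (a : LocalForm n) : LocalForm n where
  x j := fun z ↦ V.apply (a.x j) z +
    ∑ i, (a.x i z * dX j (V.x i) z + a.p i z * dX j (V.p i) z + a.xi i z * dX j (V.xi i) z)
  p j := fun z ↦ V.apply (a.p j) z +
    ∑ i, (a.x i z * dP j (V.x i) z + a.p i z * dP j (V.p i) z + a.xi i z * dP j (V.xi i) z)
  xi j := fun z ↦ V.apply (a.xi j) z +
    ∑ i, (-(a.x i z * dXi j (V.x i) z) - a.p i z * dXi j (V.p i) z + a.xi i z * dXi j (V.xi i) z)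

/-! ### The supercotangent bundle of a manifold -/

section Manifold

variable (n) (M : Type*) [TopologicalSpace M] [ChartedSpace (Coord n) M]

/-- The charts of the smooth manifold `M`. -/
abbrev Chart : Type _ :=
  {φ : OpenPartialHomeomorph M (Coord n) // φ ∈ IsManifold.maximalAtlas (𝓡 n) ∞ M}

variable {n M}

/-- The domain, in natural coordinates `(x, p)`, of the part of `T*M` over a chart. -/
def Chart.domain (φ : Chart n M) : Set (Coord n × Coord n) := φ.1.target ×ˢ Set.univ

/-- The change of coordinates `ψ ∘ φ⁻¹` of `M`. -/
def Chart.transition (φ ψ : Chart n M) : Coord n → Coord n := fun y ↦ ψ.1 (φ.1.symm y)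

/-- The Jacobian matrix `∂x'ⁱ/∂xʲ` (row `i`, column `j`) of the change of coordinates `x' = ψ ∘ φ⁻¹`
at a point of coordinates `y` in the chart `φ`. -/
def Chart.jacobian (φ ψ : Chart n M) (y : Coord n) : Matrix (Fin n) (Fin n) ℝ :=
  fun i j ↦ fderiv ℝ (φ.transition ψ) y (EuclideanSpace.single j 1) i

/-- A superfunction written in the natural coordinates `(x', p', ξ')` of the chart `ψ` is rewritten in
the natural coordinates `(x, p, ξ)` of the chart `φ`, by the substitutions `x' = (ψ ∘ φ⁻¹)(x)`,
`p'ᵢ = ∑ⱼ pⱼ ∂xʲ/∂x'ⁱ` and `ξ'ⁱ = ∑ⱼ (∂x'ⁱ/∂xʲ) ξʲ`. These are the transition maps that define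
`T*M ×_M ΠTM`. -/
def Chart.pullback (φ ψ : Chart n M) (F : SFun n) : SFun n := fun z ↦
  ExteriorAlgebra.map
    (Matrix.vecMulLinear ((φ.jacobian ψ z.1).map ((↑) : ℝ → ℂ)))
    (F (φ.transition ψ z.1,
      WithLp.toLp 2 (Matrix.vecMul z.2.ofLp (ψ.jacobian φ (φ.transition ψ z.1)))))

variable (n M)

/-- Even vector fields on the supercotangent bundle `T*M ×_M ΠTM`: smooth components in each system
of natural coordinates, even along `∂/∂x` and `∂/∂p` and odd along `∂/∂ξ`, which are related by
the transformation law `V(z') = V'(z')` for the coordinates `z'` of another chart. The components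
are defined over the domain of the chart only; they are set to `0` elsewhere, so that two vector
fields are equal when their components are equal over the domains of all charts. -/
@[ext]
structure SuperVectorField where
  comp : Chart n M → LocalField n
  smooth_x : ∀ φ i, ContDiffOn ℝ ∞ ((comp φ).x i) φ.domain
  smooth_p : ∀ φ i, ContDiffOn ℝ ∞ ((comp φ).p i) φ.domain
  smooth_xi : ∀ φ i, ContDiffOn ℝ ∞ ((comp φ).xi i) φ.domain
  even_x : ∀ φ i z, (comp φ).x i z ∈ parity n 0
  even_p : ∀ φ i z, (comp φ).p i z ∈ parity n 0
  odd_xi : ∀ φ i z, (comp φ).xi i z ∈ parity n 1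
  transform_x : ∀ (φ ψ : Chart n M) (i : Fin n), ∀ z ∈ φ.domain, φ.1.symm z.1 ∈ ψ.1.source →
    (comp φ).apply (φ.pullback ψ (coordX i)) z = φ.pullback ψ ((comp ψ).x i) z
  transform_p : ∀ (φ ψ : Chart n M) (i : Fin n), ∀ z ∈ φ.domain, φ.1.symm z.1 ∈ ψ.1.source →
    (comp φ).apply (φ.pullback ψ (coordP i)) z = φ.pullback ψ ((comp ψ).p i) z
  transform_xi : ∀ (φ ψ : Chart n M) (i : Fin n), ∀ z ∈ φ.domain, φ.1.symm z.1 ∈ ψ.1.source →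
    (comp φ).apply (φ.pullback ψ (coordXi i)) z = φ.pullback ψ ((comp ψ).xi i) z
  off_x : ∀ φ i, ∀ z ∉ φ.domain, (comp φ).x i z = 0
  off_p : ∀ φ i, ∀ z ∉ φ.domain, (comp φ).p i z = 0
  off_xi : ∀ φ i, ∀ z ∉ φ.domain, (comp φ).xi i z = 0

/-! ### Pseudo-Riemannian geometry in coordinates -/

/-- A vector field on `M`, without any smoothness requirement. -/
abbrev VField : Type _ := ∀ q : M, TangentSpace (𝓡 n) q

variable {n M}

/-- Smoothness of a vector field on `M`. -/
def IsSmooth [IsManifold (𝓡 n) ∞ M] (X : VField n M) : Prop :=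
  ContMDiff (𝓡 n) (𝓡 n).tangent ∞ (fun q ↦ (⟨q, X q⟩ : TangentBundle (𝓡 n) M))

variable (n M)

/-- A smooth pseudo-Riemannian metric. -/
structure PseudoRiemannianMetric [IsManifold (𝓡 n) ∞ M] where
  inner (q : M) : TangentSpace (𝓡 n) q →L[ℝ] TangentSpace (𝓡 n) q →L[ℝ] ℝ
  symm (q : M) (v w : TangentSpace (𝓡 n) q) : inner q v w = inner q w v
  nondegenerate (q : M) (v : TangentSpace (𝓡 n) q) : (∀ w, inner q v w = 0) → v = 0
  contMDiff : ContMDiff (𝓡 n) ((𝓡 n).prod 𝓘(ℝ, Coord n →L[ℝ] Coord n →L[ℝ] ℝ)) ∞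
    (fun q ↦ Bundle.TotalSpace.mk' (Coord n →L[ℝ] Coord n →L[ℝ] ℝ)
      (E := fun q : M ↦ TangentSpace (𝓡 n) q →L[ℝ] TangentSpace (𝓡 n) q →L[ℝ] ℝ) q (inner q))

variable {n M}

/-- The partial derivative `∂ᵢ f` of a function of the coordinates on `M`. -/
def pd (i : Fin n) (f : Coord n → ℝ) : Coord n → ℝ :=
  fun y ↦ fderiv ℝ f y (EuclideanSpace.single i 1)

/-- The component `Xⁱ` of a vector field on `M` in a chart. -/
def vcomp (X : VField n M) (φ : Chart n M) (i : Fin n) : Coord n → ℝ :=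
  fun y ↦ EuclideanSpace.proj (𝕜 := ℝ) i (mfderiv (𝓡 n) (𝓡 n) φ.1 (φ.1.symm y) (X (φ.1.symm y)))

namespace PseudoRiemannianMetric

variable [IsManifold (𝓡 n) ∞ M] (g : PseudoRiemannianMetric n M) (φ : Chart n M)

/-- The coefficient `g_{ij}` of the metric in a chart. -/
def coef (i j : Fin n) : Coord n → ℝ := fun y ↦
  g.inner (φ.1.symm y)
    (mfderiv (𝓡 n) (𝓡 n) φ.1.symm y (EuclideanSpace.single i 1 : Coord n))
    (mfderiv (𝓡 n) (𝓡 n) φ.1.symm y (EuclideanSpace.single j 1 : Coord n))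

/-- The coefficient `g^{ij}` of the inverse metric. -/
def inv (i j : Fin n) : Coord n → ℝ := fun y ↦
  ((Matrix.of fun a b ↦ g.coef φ a b y)⁻¹ : Matrix (Fin n) (Fin n) ℝ) i j

/-- The Christoffel symbol `Γᵏ_{ij}` of the Levi-Civita connection. -/
def christoffel (k i j : Fin n) : Coord n → ℝ := fun y ↦
  (1 / 2) * ∑ l, g.inv φ k l y *
    (pd i (g.coef φ j l) y + pd j (g.coef φ i l) y - pd l (g.coef φ i j) y)

/-- The Riemann tensor
`Rᶜ_{aij} = ∂ᵢΓᶜ_{aj} - ∂ⱼΓᶜ_{ai} + Γᶜ_{ik}Γᵏ_{aj} - Γᶜ_{jk}Γᵏ_{ai}`. -/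
def riemann (c a i j : Fin n) : Coord n → ℝ := fun y ↦
  pd i (g.christoffel φ c a j) y - pd j (g.christoffel φ c a i) y +
    ∑ k, (g.christoffel φ c i k y * g.christoffel φ k a j y
      - g.christoffel φ c j k y * g.christoffel φ k a i y)

variable (X : VField n M)

/-- `X_i = g_{ik} Xᵏ`. -/
def lower (i : Fin n) : Coord n → ℝ := fun y ↦ ∑ k, g.coef φ i k y * vcomp X φ k y

/-- `∂_{[j} X_{i]} = (∂_j X_i - ∂_i X_j) / 2`, the entry `Y_{ij}` of a skew-symmetric tensor. -/
def rot (i j : Fin n) : Coord n → ℝ := fun y ↦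
  (1 / 2) * (pd j (g.lower φ X i) y - pd i (g.lower φ X j) y)

/-- `∇_i Xʲ`. -/
def nablaX (i j : Fin n) : Coord n → ℝ := fun y ↦
  pd i (vcomp X φ j) y + ∑ k, g.christoffel φ j i k y * vcomp X φ k y

/-- `∇_i Y_{kl}` for `Y_{kl} = ∂_{[l} X_{k]}`. -/
def nablaRot (i k l : Fin n) : Coord n → ℝ := fun y ↦
  pd i (g.rot φ X k l) y
    - ∑ m, (g.christoffel φ m i k y * g.rot φ X m l y + g.christoffel φ m i l y * g.rot φ X k m y)

/-- The coefficient `(L_X g)_{ij} = Xᵏ ∂ₖ g_{ij} + g_{kj} ∂ᵢ Xᵏ + g_{ik} ∂ⱼ Xᵏ`. -/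
def lieCoef (i j : Fin n) : Coord n → ℝ := fun y ↦
  ∑ k, (vcomp X φ k y * pd k (g.coef φ i j) y + g.coef φ k j y * pd i (vcomp X φ k) y
    + g.coef φ i k y * pd j (vcomp X φ k) y)

/-- The smooth conformal vector fields: `L_X g = lam g` for a smooth function `lam` on `M`. -/
def conf : Set (VField n M) :=
  {X | IsSmooth X ∧ ∃ lam : M → ℝ, ContMDiff (𝓡 n) 𝓘(ℝ, ℝ) ∞ lam ∧
    ∀ (φ : Chart n M) (i j : Fin n), ∀ y ∈ φ.1.target,
      g.lieCoef φ X i j y = lam (φ.1.symm y) * g.coef φ i j y}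

/-! ### The forms `α` and `β`, and lifts of vector fields -/

/-- `ξ_i = g_{ij} ξʲ` at the point of coordinates `y`. -/
def xiLower (i : Fin n) (y : Coord n) : Grassmann n := ∑ j, real (g.coef φ i j y) * xi j

/-- The constant `ħ / (2 i)`. -/
def planck (hbar : ℝ) : ℂ := (hbar : ℂ) / (2 * Complex.I)

/-- `α = pᵢ dxⁱ + (ħ/2i) g_{ij} ξⁱ d^∇ξʲ`, where `d^∇ξʲ = dξʲ + Γʲ_{kl} ξᵏ dxˡ`. -/
def alpha (hbar : ℝ) : LocalForm n where
  x l := fun z ↦ real (z.2 l) + planck hbar • ∑ i, ∑ j, ∑ k,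
    real (g.coef φ i j z.1) * xi i * (real (g.christoffel φ j k l z.1) * xi k)
  p _ := fun _ ↦ 0
  xi j := fun z ↦ planck hbar • ∑ i, real (g.coef φ i j z.1) * xi i

/-- `β = g_{ij} ξⁱ dxʲ`. -/
def beta : LocalForm n where
  x j := fun z ↦ ∑ i, real (g.coef φ i j z.1) * xi i
  p _ := fun _ ↦ 0
  xi _ := fun _ ↦ 0

/-- `L_V α = 0`. -/
def PreservesAlpha (hbar : ℝ) (V : SuperVectorField n M) : Prop :=
  ∀ (φ : Chart n M) (j : Fin n), ∀ z ∈ φ.domain,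
    ((V.comp φ).lieDeriv (g.alpha φ hbar)).x j z = 0 ∧
    ((V.comp φ).lieDeriv (g.alpha φ hbar)).p j z = 0 ∧
    ((V.comp φ).lieDeriv (g.alpha φ hbar)).xi j z = 0

/-- `L_V β = f β` for some smooth function `f` on `M`. -/
def PreservesDirectionBeta (V : SuperVectorField n M) : Prop :=
  ∃ f : M → ℂ, ContMDiff (𝓡 n) 𝓘(ℝ, ℂ) ∞ f ∧
    ∀ (φ : Chart n M) (j : Fin n), ∀ z ∈ φ.domain,
      ((V.comp φ).lieDeriv (g.beta φ)).x j z = f (φ.1.symm z.1) • (g.beta φ).x j z ∧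
      ((V.comp φ).lieDeriv (g.beta φ)).p j z = f (φ.1.symm z.1) • (g.beta φ).p j z ∧
      ((V.comp φ).lieDeriv (g.beta φ)).xi j z = f (φ.1.symm z.1) • (g.beta φ).xi j z

/-- The vector field `V` projects onto the vector field `X` of `M`: `V(xⁱ) = Xⁱ(x)`. -/
def IsLift (X : VField n M) (V : SuperVectorField n M) : Prop :=
  ∀ (φ : Chart n M) (i : Fin n), ∀ z ∈ φ.domain, (V.comp φ).x i z = real (vcomp X φ i z.1)

/-- The lifts of `X` that preserve `α` and the direction of `β`. -/
def IsConformalLift (hbar : ℝ) (X : VField n M) (V : SuperVectorField n M) : Prop :=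
  IsLift X V ∧ g.PreservesAlpha hbar V ∧ g.PreservesDirectionBeta V

/-- The components in natural coordinates of
`Xⁱ ∂^∇_i + ∂_{[j} X_{i]} ξʲ ∂_{ξ_i} - pⱼ ∇_i Xʲ ∂_{p_i}
  + (ħ/2i) (Rᵏ_{lij} ξ_k ξˡ Xʲ - (∇_i ∂_{[l} X_{k]}) ξᵏ ξˡ) ∂_{p_i}`,
where `∂^∇_i = ∂_i + Γᵏ_{ij} p_k ∂_{p_j} - Γᵏ_{ij} ξʲ ∂_{ξᵏ}` and `∂_{ξ_i} = g^{ij} ∂_{ξʲ}`. -/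
def explicitLift (hbar : ℝ) : LocalField n where
  x i := fun z ↦ real (vcomp X φ i z.1)
  p i := fun z ↦
    (∑ j, ∑ k, real (vcomp X φ j z.1 * g.christoffel φ k j i z.1 * z.2 k))
    - (∑ j, real (z.2 j * g.nablaX φ X i j z.1))
    + planck hbar • ((∑ k, ∑ l, ∑ j,
        real (g.riemann φ k l i j z.1) * g.xiLower φ k z.1 * xi l * real (vcomp X φ j z.1))
      - ∑ k, ∑ l, real (g.nablaRot φ X i k l z.1) * xi k * xi l)
  xi k := fun z ↦
    (∑ i, ∑ j, real (g.inv φ i k z.1 * g.rot φ X i j z.1) * xi j)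
    - ∑ i, ∑ j, real (vcomp X φ i z.1 * g.christoffel φ k i j z.1) * xi j

/-- The vector field `V` is given by the explicit formula in all natural coordinates. -/
def IsExplicitLift (hbar : ℝ) (X : VField n M) (V : SuperVectorField n M) : Prop :=
  ∀ (φ : Chart n M) (i : Fin n), ∀ z ∈ φ.domain,
    (V.comp φ).x i z = (g.explicitLift φ X hbar).x i z ∧
    (V.comp φ).p i z = (g.explicitLift φ X hbar).p i z ∧
    (V.comp φ).xi i z = (g.explicitLift φ X hbar).xi i z

end PseudoRiemannianMetric

end Manifold

end Supercotangent

end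

/-! Compare coefficients in natural coordinates. The `dx` part of `L_X̃ β = f β` is linear in the
components `X̃ξᵏ` and, `g` being nondegenerate, determines them in terms of `X` and `f`; inserted
into the `dξ` part of `L_X̃ α = 0`, it gives `L_X g = 2 f g`. So `X` is conformal, its factor `lam`
determines `f = lam / 2` and `X̃ξᵏ`, and the `dx` part of `L_X̃ α = 0`, solved for `X̃pᵢ`, leaves
exactly one candidate for the lift.

The spin term of this candidate is at first the quadratic form in `ξ` given by the Lie derivative of
the Christoffel symbols. Two identities evaluate it: differentiating the conformal Killing equation
turns it into `ξᵢ ξᵐ ∂ₘ lam`, for which the change of charts is easily checked, so that the local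
candidates glue; commuting covariant derivatives turns it into the curvature term of the explicit
formula.

As `L_[V, W] = [L_V, L_W]`, sums, multiples and brackets of lifts are lifts again. This makes the
conformal vector fields a Lie algebra, and by uniqueness the lift is a morphism. -/

noncomputable section

namespace Supercotangent

open Filter Topology

variable {n : ℕ} {M : Type*} [TopologicalSpace M] [ChartedSpace (Coord n) M]

/-! ### The Grassmann algebra -/

section Grassmann

/-- The odd linear element `∑ mᵢ ξⁱ`, for complex `mᵢ`. -/
def iota : (Fin n → ℂ) →ₗ[ℂ] Grassmann n := ExteriorAlgebra.ι ℂ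

/-- The grading automorphism: the identity on even elements, and a change of sign on odd ones. -/
def grade : Grassmann n →ₐ[ℂ] Grassmann n :=
  CliffordAlgebra.involute (Q := (0 : QuadraticForm ℂ (Fin n → ℂ)))

/-- The left derivative along `ξⁱ` on the Grassmann algebra. -/
def leftDeriv (i : Fin n) : Grassmann n →ₗ[ℂ] Grassmann n :=
  CliffordAlgebra.contractLeft (Q := (0 : QuadraticForm ℂ (Fin n → ℂ))) (LinearMap.proj i)

lemma xi_eq_iota (i : Fin n) : (xi i : Grassmann n) = iota (Pi.single i 1) := rfl

lemma dXi_apply (i : Fin n) (F : SFun n) (z : Coord n × Coord n) :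
    dXi i F z = leftDeriv i (F z) := rfl

lemma grassmann_induction {P : Grassmann n → Prop}
    (scalar : ∀ r : ℂ, P (algebraMap ℂ (Grassmann n) r))
    (add : ∀ a b, P a → P b → P (a + b))
    (mul : ∀ (m : Fin n → ℂ) (a : Grassmann n), P a → P (iota m * a))
    (a : Grassmann n) : P a :=
  CliffordAlgebra.left_induction (Q := (0 : QuadraticForm ℂ (Fin n → ℂ)))
    (P := P) scalar add (fun x m h ↦ mul m x h) a

lemma leftDeriv_iota_mul (i : Fin n) (m : Fin n → ℂ) (a : Grassmann n) :
    leftDeriv i (iota m * a) = m i • a - iota m * leftDeriv i a :=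
  CliffordAlgebra.contractLeft_ι_mul (Q := (0 : QuadraticForm ℂ (Fin n → ℂ))) _ _ _

lemma leftDeriv_algebraMap_mul (i : Fin n) (r : ℂ) (a : Grassmann n) :
    leftDeriv i (algebraMap ℂ (Grassmann n) r * a) = algebraMap ℂ (Grassmann n) r * leftDeriv i a :=
  CliffordAlgebra.contractLeft_algebraMap_mul (Q := (0 : QuadraticForm ℂ (Fin n → ℂ))) _ _ _

lemma leftDeriv_algebraMap (i : Fin n) (r : ℂ) :
    leftDeriv i (algebraMap ℂ (Grassmann n) r) = 0 :=
  CliffordAlgebra.contractLeft_algebraMap (Q := (0 : QuadraticForm ℂ (Fin n → ℂ))) _ _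

lemma leftDeriv_comm (i j : Fin n) (a : Grassmann n) :
    leftDeriv i (leftDeriv j a) = -leftDeriv j (leftDeriv i a) :=
  CliffordAlgebra.contractLeft_comm (Q := (0 : QuadraticForm ℂ (Fin n → ℂ))) _ _ _

lemma grade_iota (m : Fin n → ℂ) : grade (iota m) = -iota m :=
  CliffordAlgebra.involute_ι (Q := (0 : QuadraticForm ℂ (Fin n → ℂ))) _

lemma grade_grade (a : Grassmann n) : grade (grade a) = a :=
  CliffordAlgebra.involute_involute (Q := (0 : QuadraticForm ℂ (Fin n → ℂ))) a

lemma grade_even {a : Grassmann n} (h : a ∈ parity n 0) : grade a = a :=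
  CliffordAlgebra.involute_eq_of_mem_even (Q := (0 : QuadraticForm ℂ (Fin n → ℂ))) h

lemma grade_odd {a : Grassmann n} (h : a ∈ parity n 1) : grade a = -a :=
  CliffordAlgebra.involute_eq_of_mem_odd (Q := (0 : QuadraticForm ℂ (Fin n → ℂ))) h

lemma exists_even_add_odd (a : Grassmann n) :
    ∃ b ∈ parity n 0, ∃ c ∈ parity n 1, b + c = a :=
  have ⟨b, c, hb, hc, h⟩ := Submodule.codisjoint_iff_exists_add_eq.1
    (CliffordAlgebra.evenOdd_isCompl (0 : QuadraticForm ℂ (Fin n → ℂ))).codisjoint a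
  ⟨b, hb, c, hc, h⟩

lemma mem_even_of_grade {a : Grassmann n} (h : grade a = a) : a ∈ parity n 0 := by
  obtain ⟨b, hb, c, hc, rfl⟩ := exists_even_add_odd a
  rw [map_add, grade_even hb, grade_odd hc, add_right_inj, neg_eq_iff_add_eq_zero, ← two_smul ℂ,
    smul_eq_zero_iff_right two_ne_zero] at h
  rwa [h, add_zero]

lemma mem_odd_of_grade {a : Grassmann n} (h : grade a = -a) : a ∈ parity n 1 := by
  obtain ⟨b, hb, c, hc, rfl⟩ := exists_even_add_odd a
  rw [map_add, grade_even hb, grade_odd hc, neg_add, add_left_inj, eq_neg_iff_add_eq_zero,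
    ← two_smul ℂ, smul_eq_zero_iff_right two_ne_zero] at h
  rwa [h, zero_add]

lemma iota_mul_iota (m m' : Fin n → ℂ) : iota m * iota m' = -(iota m' * iota m) :=
  eq_neg_of_add_eq_zero_left (ExteriorAlgebra.ι_add_mul_swap (R := ℂ) m m')

lemma leftDeriv_mul (i : Fin n) (a b : Grassmann n) :
    leftDeriv i (a * b) = leftDeriv i a * b + grade a * leftDeriv i b := by
  induction a using grassmann_induction with
  | scalar r => simp [leftDeriv_algebraMap_mul, leftDeriv_algebraMap]
  | add a a' h h' => simp only [add_mul, map_add, h, h']; abel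
  | mul m a h =>
    rw [mul_assoc, leftDeriv_iota_mul, leftDeriv_iota_mul, h, map_mul, grade_iota]
    simp only [mul_add, sub_mul, smul_mul_assoc, neg_mul, mul_assoc]
    abel

lemma leftDeriv_grade (i : Fin n) (a : Grassmann n) :
    leftDeriv i (grade a) = -grade (leftDeriv i a) := by
  induction a using grassmann_induction with
  | scalar r => simp [leftDeriv_algebraMap]
  | add a a' h h' => simp only [map_add, h, h', neg_add]
  | mul m a h =>
    rw [map_mul, grade_iota, neg_mul, map_neg, leftDeriv_iota_mul, leftDeriv_iota_mul, h, map_sub,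
      map_mul, grade_iota, map_smul]
    simp

lemma iota_mul (m : Fin n → ℂ) (a : Grassmann n) : iota m * a = grade a * iota m := by
  induction a using grassmann_induction with
  | scalar r => simp [Algebra.commutes]
  | add a a' h h' => simp only [add_mul, mul_add, map_add, h, h']
  | mul m' a h =>
    rw [← mul_assoc, iota_mul_iota, map_mul, grade_iota, neg_mul, mul_assoc, h]
    simp [mul_assoc]

lemma even_mul_comm {a : Grassmann n} (h : a ∈ parity n 0) (b : Grassmann n) : a * b = b * a := by
  induction b using grassmann_induction with
  | scalar r => exact (Algebra.commutes r a).symm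
  | add b b' h h' => simp only [add_mul, mul_add, h, h']
  | mul m b hb =>
    rw [mul_assoc, ← hb, ← mul_assoc, ← mul_assoc, iota_mul, grade_even h]

lemma odd_mul {a : Grassmann n} (h : a ∈ parity n 1) (b : Grassmann n) :
    a * b = grade b * a := by
  induction b using grassmann_induction with
  | scalar r => simpa using (Algebra.commutes r a).symm
  | add b b' h h' => simp only [add_mul, mul_add, map_add, h, h']
  | mul m b hb =>
    rw [map_mul, mul_assoc, ← hb, ← mul_assoc, ← mul_assoc, grade_iota, neg_mul, iota_mul,
      grade_odd h]
    simp

lemma xi_mem_parity (i : Fin n) : (xi i : Grassmann n) ∈ parity n 1 :=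
  CliffordAlgebra.ι_mem_evenOdd_one (0 : QuadraticForm ℂ (Fin n → ℂ)) _

lemma algebraMap_mem_parity (r : ℂ) : algebraMap ℂ (Grassmann n) r ∈ parity n 0 :=
  SetLike.algebraMap_mem_graded (CliffordAlgebra.evenOdd (0 : QuadraticForm ℂ (Fin n → ℂ))) r

lemma mul_mem_parity {a b : Grassmann n} {s t : ZMod 2} (ha : a ∈ parity n s)
    (hb : b ∈ parity n t) : a * b ∈ parity n (s + t) :=
  SetLike.mul_mem_graded (A := CliffordAlgebra.evenOdd (0 : QuadraticForm ℂ (Fin n → ℂ))) ha hb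

/-- The sign rule for moving an element of degree `a` from the left to the right of another
element: `koszul a` is the identity for `a = 0`, and the grading automorphism for `a = 1`. -/
def koszul (a : ZMod 2) : Grassmann n →ₐ[ℂ] Grassmann n :=
  if a = 0 then AlgHom.id ℂ (Grassmann n) else grade

@[simp]
lemma koszul_zero (b : Grassmann n) : koszul 0 b = b := rfl

@[simp]
lemma koszul_one (b : Grassmann n) : koszul 1 b = grade b := rfl

lemma zmod_two_cases (a : ZMod 2) : a = 0 ∨ a = 1 := by
  revert a; decide

lemma koszul_add (a b : ZMod 2) (c : Grassmann n) : koszul (a + b) c = koszul a (koszul b c) := by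
  obtain rfl | rfl := zmod_two_cases a <;> obtain rfl | rfl := zmod_two_cases b <;>
    simp [CharTwo.add_self_eq_zero, grade_grade]

lemma koszul_koszul (a : ZMod 2) (c : Grassmann n) : koszul a (koszul a c) = c := by
  rw [← koszul_add, CharTwo.add_self_eq_zero, koszul_zero]

lemma mul_eq_koszul_mul {a : ZMod 2} {b : Grassmann n} (hb : b ∈ parity n a) (c : Grassmann n) :
    b * c = koszul a c * b := by
  obtain rfl | rfl := zmod_two_cases a
  · exact even_mul_comm hb c
  · exact odd_mul hb c

lemma koszul_mem_parity (a : ZMod 2) {t : ZMod 2} {b : Grassmann n} (hb : b ∈ parity n t) :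
    koszul a b ∈ parity n t := by
  obtain rfl | rfl := zmod_two_cases a
  · exact hb
  · obtain rfl | rfl := zmod_two_cases t
    · rwa [koszul_one, grade_even hb]
    · rw [koszul_one, grade_odd hb]
      exact neg_mem hb

end Grassmann

section Superfunctions

section Real

/-- `real` as a morphism of rings. -/
def realHom : ℝ →+* Grassmann n := (algebraMap ℂ (Grassmann n)).comp Complex.ofRealHom

lemma real_eq (r : ℝ) : (real r : Grassmann n) = realHom r := rfl

lemma real_add (r s : ℝ) : (real (r + s) : Grassmann n) = real r + real s := by simp [real_eq]

lemma real_sub (r s : ℝ) : (real (r - s) : Grassmann n) = real r - real s := by simp [real_eq]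

lemma real_neg (r : ℝ) : (real (-r) : Grassmann n) = -real r := by simp [real_eq]

lemma real_mul (r s : ℝ) : (real (r * s) : Grassmann n) = real r * real s := by simp [real_eq]

lemma real_zero : (real 0 : Grassmann n) = 0 := by simp [real_eq]

lemma real_one : (real 1 : Grassmann n) = 1 := by simp [real_eq]

lemma real_sum {ι : Type*} (s : Finset ι) (f : ι → ℝ) :
    (real (∑ i ∈ s, f i) : Grassmann n) = ∑ i ∈ s, real (f i) := by simp [real_eq]

lemma real_mem_parity (r : ℝ) : (real r : Grassmann n) ∈ parity n 0 := algebraMap_mem_parity _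

lemma real_comm (r : ℝ) (a : Grassmann n) : a * real r = real r * a :=
  (Algebra.commutes (r : ℂ) a).symm

lemma real_mul_eq_smul (r : ℝ) (a : Grassmann n) : real r * a = (r : ℂ) • a :=
  (Algebra.smul_def (r : ℂ) a).symm

lemma real_smul_eq (r : ℝ) (a : Grassmann n) : r • a = real r * a := by
  rw [real_mul_eq_smul]; rfl

lemma smul_real_mul (c : ℂ) (r : ℝ) (a : Grassmann n) : c • (real r * a) = (c * r) • a := by
  rw [real_mul_eq_smul, smul_smul]

lemma leftDeriv_real (i : Fin n) (r : ℝ) : leftDeriv i (real r : Grassmann n) = 0 :=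
  leftDeriv_algebraMap _ _

lemma leftDeriv_real_mul (i : Fin n) (r : ℝ) (a : Grassmann n) :
    leftDeriv i (real r * a) = real r * leftDeriv i a :=
  leftDeriv_algebraMap_mul _ _ _

lemma leftDeriv_xi (i j : Fin n) :
    leftDeriv i (xi j : Grassmann n) = if i = j then 1 else 0 := by
  have hone : leftDeriv i (1 : Grassmann n) = 0 := by simpa using leftDeriv_algebraMap i (1 : ℂ)
  have hiota := leftDeriv_iota_mul i (Pi.single j 1) 1
  rw [mul_one, hone, mul_zero, sub_zero] at hiota
  rw [xi_eq_iota, hiota, Pi.single_apply]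
  split_ifs <;> simp

lemma sum_smul_xi_injective {a b : Fin n → ℂ}
    (h : ∑ i, a i • (xi i : Grassmann n) = ∑ i, b i • xi i) (i : Fin n) : a i = b i := by
  have hcoeff := congrArg (leftDeriv i) h
  simp only [map_sum, map_smul, leftDeriv_xi, smul_ite, smul_zero, Finset.sum_ite_eq,
    Finset.mem_univ, if_true] at hcoeff
  rw [← Algebra.algebraMap_eq_smul_one, ← Algebra.algebraMap_eq_smul_one] at hcoeff
  exact (ExteriorAlgebra.algebraMap_leftInverse (R := ℂ) (Fin n → ℂ)).injective hcoeff

end Real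

/-! ### Calculus of superfunctions -/

section Calculus

variable {E : Type*} [NormedAddCommGroup E] [NormedSpace ℝ E]

lemma fderiv_fderiv_comm {A : Type*} [NormedAddCommGroup A] [NormedSpace ℝ A] {f : E → A} {z : E}
    (hf : ContDiffAt ℝ ∞ f z) (v w : E) :
    fderiv ℝ (fun z ↦ fderiv ℝ f z v) z w = fderiv ℝ (fun z ↦ fderiv ℝ f z w) z v := by
  have hd : DifferentiableAt ℝ (fderiv ℝ f) z :=
    (hf.fderiv_right (m := 1) (by norm_cast)).differentiableAt (by simp)
  have hs : IsSymmSndFDerivAt ℝ f z := hf.isSymmSndFDerivAt (by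
    rw [minSmoothness_of_isRCLikeNormedField]
    exact WithTop.coe_le_coe.2 (le_top : (2 : ℕ∞) ≤ ⊤))
  have key (v w : E) : fderiv ℝ (fun z ↦ fderiv ℝ f z v) z w = fderiv ℝ (fderiv ℝ f) z w v := by
    rw [fderiv_clm_apply hd (differentiableAt_const v)]
    simp
  rw [key, key, hs.eq]

instance : FiniteDimensional ℂ (Grassmann n) := Module.Finite.equiv (coeffs n).symm

lemma isBoundedBilinearMap_mul :
    IsBoundedBilinearMap ℝ (fun p : Grassmann n × Grassmann n ↦ p.1 * p.2) := by
  have : FiniteDimensional ℝ (Grassmann n) := FiniteDimensional.complexToReal _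
  let f : Grassmann n →ₗ[ℝ] (Grassmann n →L[ℝ] Grassmann n) :=
    LinearMap.toContinuousLinearMap.toLinearMap ∘ₗ LinearMap.mul ℝ (Grassmann n)
  exact (LinearMap.toContinuousLinearMap f).isBoundedBilinearMap

/-- `real` as a continuous linear map. -/
def realCLM : ℝ →L[ℝ] Grassmann n :=
  LinearMap.toContinuousLinearMap
    { toFun := real
      map_add' := real_add
      map_smul' := fun r s ↦ by simp [real_smul_eq, real_mul] }

/-- A complex linear endomorphism of the Grassmann algebra, as a continuous real linear map. -/
def realLinear (f : Grassmann n →ₗ[ℂ] Grassmann n) : Grassmann n →L[ℝ] Grassmann n :=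
  (LinearMap.toContinuousLinearMap f).restrictScalars ℝ

variable {F G : E → Grassmann n} {f : E → ℝ} {s : Set E} {z : E}

lemma fderiv_grassmann_mul (hF : DifferentiableAt ℝ F z) (hG : DifferentiableAt ℝ G z) (v : E) :
    fderiv ℝ (fun z ↦ F z * G z) z v = fderiv ℝ F z v * G z + F z * fderiv ℝ G z v := by
  have h := (isBoundedBilinearMap_mul.hasFDerivAt (F z, G z)).comp z
    (hF.hasFDerivAt.prodMk hG.hasFDerivAt)
  have h' : HasFDerivAt (fun z ↦ F z * G z) _ z := h
  rw [h'.fderiv]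
  simp [add_comm]

lemma differentiableAt_grassmann_mul (hF : DifferentiableAt ℝ F z) (hG : DifferentiableAt ℝ G z) :
    DifferentiableAt ℝ (fun z ↦ F z * G z) z :=
  DifferentiableAt.comp (g := fun p : Grassmann n × Grassmann n ↦ p.1 * p.2) z
    (isBoundedBilinearMap_mul.differentiableAt (F z, G z)) (hF.prodMk hG)

lemma contDiffAt_grassmann_mul (hF : ContDiffAt ℝ ∞ F z) (hG : ContDiffAt ℝ ∞ G z) :
    ContDiffAt ℝ ∞ (fun z ↦ F z * G z) z :=
  isBoundedBilinearMap_mul.contDiff.contDiffAt.comp z (hF.prodMk hG)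

lemma contDiffOn_grassmann_mul (hF : ContDiffOn ℝ ∞ F s) (hG : ContDiffOn ℝ ∞ G s) :
    ContDiffOn ℝ ∞ (fun z ↦ F z * G z) s :=
  isBoundedBilinearMap_mul.contDiff.comp_contDiffOn (hF.prodMk hG)

lemma contDiffOn_real (hf : ContDiffOn ℝ ∞ f s) :
    ContDiffOn ℝ ∞ (fun z ↦ (real (f z) : Grassmann n)) s :=
  realCLM.contDiff.comp_contDiffOn hf

lemma differentiableAt_real (hf : DifferentiableAt ℝ f z) :
    DifferentiableAt ℝ (fun z ↦ (real (f z) : Grassmann n)) z :=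
  realCLM.differentiableAt.comp z hf

lemma fderiv_real (hf : DifferentiableAt ℝ f z) (v : E) :
    fderiv ℝ (fun z ↦ (real (f z) : Grassmann n)) z v = real (fderiv ℝ f z v) := by
  have h : HasFDerivAt (fun z ↦ (real (f z) : Grassmann n)) _ z :=
    realCLM.hasFDerivAt.comp z hf.hasFDerivAt
  rw [h.fderiv]
  rfl

lemma fderiv_linearMap_comp (hF : DifferentiableAt ℝ F z) (L : Grassmann n →ₗ[ℂ] Grassmann n)
    (v : E) : fderiv ℝ (fun z ↦ L (F z)) z v = L (fderiv ℝ F z v) := by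
  have h : HasFDerivAt (fun z ↦ L (F z)) _ z := (realLinear L).hasFDerivAt.comp z hF.hasFDerivAt
  rw [h.fderiv]
  rfl

lemma contDiffAt_linearMap_comp (hF : ContDiffAt ℝ ∞ F z) (L : Grassmann n →ₗ[ℂ] Grassmann n) :
    ContDiffAt ℝ ∞ (fun z ↦ L (F z)) z :=
  (realLinear L).contDiff.contDiffAt.comp z hF

lemma fderiv_mem_parity {a : ZMod 2} (hF : ∀ z, F z ∈ parity n a) (z v : E) :
    fderiv ℝ F z v ∈ parity n a := by
  by_cases hd : DifferentiableAt ℝ F z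
  · have h := fderiv_linearMap_comp hd grade.toLinearMap v
    obtain rfl | rfl := zmod_two_cases a
    · refine mem_even_of_grade (h.symm.trans ?_)
      simp only [AlgHom.toLinearMap_apply, grade_even (hF _)]
    · refine mem_odd_of_grade (h.symm.trans ?_)
      simp only [AlgHom.toLinearMap_apply, grade_odd (hF _), fderiv_fun_neg, neg_apply]
  · rw [fderiv_zero_of_not_differentiableAt hd]
    exact zero_mem _

end Calculus

lemma leftDeriv_mem_parity {a : ZMod 2} {b : Grassmann n} (hb : b ∈ parity n a) (i : Fin n) :
    leftDeriv i b ∈ parity n (1 + a) := by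
  have h := (neg_eq_iff_eq_neg.2 (leftDeriv_grade i b)).symm
  obtain rfl | rfl := zmod_two_cases a
  · rw [grade_even hb] at h
    exact mem_odd_of_grade h
  · rw [grade_odd hb, map_neg, neg_neg] at h
    exact mem_even_of_grade h

/-- The indices of the natural coordinates: `inl i` for `xⁱ`, `inr (inl i)` for `pᵢ` and
`inr (inr i)` for `ξⁱ`. -/
abbrev Index (n : ℕ) : Type := Fin n ⊕ Fin n ⊕ Fin n

/-- The parity of a natural coordinate. -/
def degree : Index n → ZMod 2 := Sum.elim 0 (Sum.elim 0 1)

/-- The (left) partial derivative along a natural coordinate. -/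
def partialDeriv (s : Index n) (F : SFun n) : SFun n :=
  Sum.elim (fun i ↦ dX i F) (Sum.elim (fun i ↦ dP i F) fun i ↦ dXi i F) s

section PartialDeriv

variable {F G : SFun n} {z : Coord n × Coord n}

lemma partialDeriv_congr (h : F =ᶠ[𝓝 z] G) (s : Index n) :
    partialDeriv s F z = partialDeriv s G z := by
  rcases s with i | i | i
  · exact DFunLike.congr_fun (h.fderiv_eq (𝕜 := ℝ)) _
  · exact DFunLike.congr_fun (h.fderiv_eq (𝕜 := ℝ)) _
  · exact congrArg (leftDeriv i) h.eq_of_nhds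

lemma partialDeriv_add (hF : DifferentiableAt ℝ F z) (hG : DifferentiableAt ℝ G z) (s : Index n) :
    partialDeriv s (fun z ↦ F z + G z) z = partialDeriv s F z + partialDeriv s G z := by
  rcases s with i | i | i
  · exact DFunLike.congr_fun (fderiv_fun_add hF hG) _
  · exact DFunLike.congr_fun (fderiv_fun_add hF hG) _
  · exact map_add (leftDeriv i) _ _

lemma partialDeriv_sum {ι : Type*} (t : Finset ι) {F : ι → SFun n}
    (hF : ∀ i ∈ t, DifferentiableAt ℝ (F i) z) (s : Index n) :
    partialDeriv s (fun z ↦ ∑ i ∈ t, F i z) z = ∑ i ∈ t, partialDeriv s (F i) z := by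
  rcases s with j | j | j
  · exact (DFunLike.congr_fun (fderiv_fun_sum hF) _).trans (sum_apply ..)
  · exact (DFunLike.congr_fun (fderiv_fun_sum hF) _).trans (sum_apply ..)
  · exact map_sum (leftDeriv j) _ _

lemma partialDeriv_const_smul (c : ℂ) (hF : DifferentiableAt ℝ F z) (s : Index n) :
    partialDeriv s (fun z ↦ c • F z) z = c • partialDeriv s F z := by
  rcases s with i | i | i
  · exact DFunLike.congr_fun (fderiv_fun_const_smul hF c) _
  · exact DFunLike.congr_fun (fderiv_fun_const_smul hF c) _
  · exact map_smul (leftDeriv i) _ _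

lemma partialDeriv_neg (s : Index n) :
    partialDeriv s (fun z ↦ -F z) z = -partialDeriv s F z := by
  rcases s with i | i | i
  · exact DFunLike.congr_fun fderiv_fun_neg _
  · exact DFunLike.congr_fun fderiv_fun_neg _
  · exact map_neg (leftDeriv i) _

lemma partialDeriv_sub (hF : DifferentiableAt ℝ F z) (hG : DifferentiableAt ℝ G z) (s : Index n) :
    partialDeriv s (fun z ↦ F z - G z) z = partialDeriv s F z - partialDeriv s G z := by
  simp only [sub_eq_add_neg]
  rw [partialDeriv_add hF hG.fun_neg, partialDeriv_neg]

lemma partialDeriv_mul (hF : DifferentiableAt ℝ F z) (hG : DifferentiableAt ℝ G z) (s : Index n) :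
    partialDeriv s (fun z ↦ F z * G z) z
      = partialDeriv s F z * G z + koszul (degree s) (F z) * partialDeriv s G z := by
  rcases s with i | i | i
  · exact fderiv_grassmann_mul hF hG _
  · exact fderiv_grassmann_mul hF hG _
  · exact leftDeriv_mul i _ _

lemma contDiffAt_partialDeriv (hF : ContDiffAt ℝ ∞ F z) (s : Index n) :
    ContDiffAt ℝ ∞ (partialDeriv s F) z := by
  have h : ContDiffAt ℝ ∞ (fderiv ℝ F) z := hF.fderiv_right (by norm_cast)
  rcases s with i | i | i
  · exact h.clm_apply contDiffAt_const
  · exact h.clm_apply contDiffAt_const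
  · exact contDiffAt_linearMap_comp hF _

lemma partialDeriv_mem_parity {a : ZMod 2} (hF : ∀ z, F z ∈ parity n a) (s : Index n)
    (z : Coord n × Coord n) : partialDeriv s F z ∈ parity n (degree s + a) := by
  rcases s with i | i | i
  · exact (zero_add a).symm ▸ fderiv_mem_parity hF z _
  · exact (zero_add a).symm ▸ fderiv_mem_parity hF z _
  · exact leftDeriv_mem_parity (hF z) i

lemma koszul_mul_partialDeriv {s : Index n} {b : Grassmann n} (hb : b ∈ parity n (degree s))
    (hF : DifferentiableAt ℝ F z) (a : ZMod 2) :
    koszul a (b * partialDeriv s F z) = b * partialDeriv s (fun z ↦ koszul a (F z)) z := by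
  obtain rfl | rfl := zmod_two_cases a
  · rfl
  have h (v) := fderiv_linearMap_comp hF grade.toLinearMap v
  rw [koszul_one, map_mul]
  rcases s with i | i | i
  · rw [grade_even hb]
    exact congrArg (b * ·) (h _).symm
  · rw [grade_even hb]
    exact congrArg (b * ·) (h _).symm
  · rw [grade_odd hb, neg_mul, ← mul_neg]
    exact congrArg (b * ·) (leftDeriv_grade i (F z)).symm

/-- The supercommutation of the partial derivatives: `∂ₛ∂ᵣ = ∂ᵣ∂ₛ`, up to a sign if both are odd,
which is the sign between `b` and `koszul (degree s) b`. -/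
lemma koszul_mul_partialDeriv_partialDeriv {r : Index n} {b : Grassmann n}
    (hb : b ∈ parity n (degree r)) (hF : ContDiffAt ℝ ∞ F z) (s : Index n) :
    koszul (degree s) b * partialDeriv s (partialDeriv r F) z
      = b * partialDeriv r (partialDeriv s F) z := by
  have hd : DifferentiableAt ℝ F z := hF.differentiableAt (by simp)
  have hfderiv (v w) := fderiv_fderiv_comm hF v w
  have hleft (i : Fin n) (v) := fderiv_linearMap_comp hd (leftDeriv i) v
  rcases s with i | i | i <;> rcases r with j | j | j
  · exact congrArg (b * ·) (hfderiv _ _)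
  · exact congrArg (b * ·) (hfderiv _ _)
  · exact congrArg (b * ·) (hleft j _)
  · exact congrArg (b * ·) (hfderiv _ _)
  · exact congrArg (b * ·) (hfderiv _ _)
  · exact congrArg (b * ·) (hleft j _)
  · exact congrArg₂ (· * ·) (grade_even hb) (hleft i _).symm
  · exact congrArg₂ (· * ·) (grade_even hb) (hleft i _).symm
  · exact (congrArg₂ (· * ·) (grade_odd hb) (leftDeriv_comm i j _)).trans (neg_mul_neg b _)

end PartialDeriv

end Superfunctions

section LocalFields

/-- The coefficients of a `1`-form, indexed by all the natural coordinates. -/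
def LocalForm.coeff (a : LocalForm n) : Index n → SFun n :=
  Sum.elim a.x (Sum.elim a.p a.xi)

namespace LocalField

/-- The components of a vector field, indexed by all the natural coordinates. -/
def coeff (V : LocalField n) : Index n → SFun n :=
  Sum.elim V.x (Sum.elim V.p V.xi)

/-- The vector field of given components. -/
def ofCoeff (f : Index n → SFun n) : LocalField n where
  x i := f (.inl i)
  p i := f (.inr (.inl i))
  xi i := f (.inr (.inr i))

lemma coeff_ofCoeff (f : Index n → SFun n) (s : Index n) : (ofCoeff f).coeff s = f s := by
  rcases s with i | i | i <;> rfl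

/-- The evenness of a vector field: its components have the parity of the coordinates. -/
def IsEven (V : LocalField n) : Prop :=
  ∀ s z, V.coeff s z ∈ parity n (degree s)

/-- The smoothness of the components of a vector field at a point. -/
def SmoothAt (V : LocalField n) (z : Coord n × Coord n) : Prop :=
  ∀ s, ContDiffAt ℝ ∞ (V.coeff s) z

/-- The derivative `∂ₛVᵗ`, with the sign for moving it to the left of `dzˢ`. -/
def signedDeriv (V : LocalField n) (s t : Index n) : SFun n :=
  fun z ↦ koszul (degree s) (partialDeriv s (V.coeff t) z)

instance : Add (LocalField n) := ⟨fun V W ↦ ofCoeff fun s z ↦ V.coeff s z + W.coeff s z⟩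

instance : SMul ℂ (LocalField n) := ⟨fun c V ↦ ofCoeff fun s z ↦ c • V.coeff s z⟩

/-- The bracket of vector fields, which is their commutator if they are even. -/
instance : Bracket (LocalField n) (LocalField n) :=
  ⟨fun V W ↦ ofCoeff fun s z ↦ V.apply (W.coeff s) z - W.apply (V.coeff s) z⟩

lemma coeff_add (V W : LocalField n) (s : Index n) :
    (V + W).coeff s = fun z ↦ V.coeff s z + W.coeff s z :=
  coeff_ofCoeff _ s

lemma coeff_smul (c : ℂ) (V : LocalField n) (s : Index n) :
    (c • V).coeff s = fun z ↦ c • V.coeff s z :=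
  coeff_ofCoeff _ s

lemma coeff_bracket (V W : LocalField n) (s : Index n) :
    ⁅V, W⁆.coeff s = fun z ↦ V.apply (W.coeff s) z - W.apply (V.coeff s) z :=
  coeff_ofCoeff _ s

variable {V W : LocalField n} {F G : SFun n} {z : Coord n × Coord n}

lemma apply_eq_sum (V : LocalField n) (F : SFun n) (z : Coord n × Coord n) :
    V.apply F z = ∑ s, V.coeff s z * partialDeriv s F z := by
  simp only [Fintype.sum_sum_type, apply, Finset.sum_add_distrib, add_assoc]
  rfl

lemma apply_of_eventuallyEq (h : F =ᶠ[𝓝 z] G) : V.apply F z = V.apply G z := by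
  simp only [apply_eq_sum, partialDeriv_congr h]

lemma apply_add (hF : DifferentiableAt ℝ F z) (hG : DifferentiableAt ℝ G z) :
    V.apply (fun z ↦ F z + G z) z = V.apply F z + V.apply G z := by
  simp only [apply_eq_sum, partialDeriv_add hF hG, mul_add, Finset.sum_add_distrib]

lemma apply_sum {ι : Type*} (t : Finset ι) {F : ι → SFun n}
    (hF : ∀ i ∈ t, DifferentiableAt ℝ (F i) z) :
    V.apply (fun z ↦ ∑ i ∈ t, F i z) z = ∑ i ∈ t, V.apply (F i) z := by
  simp only [apply_eq_sum, partialDeriv_sum t hF, Finset.mul_sum]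
  exact Finset.sum_comm

lemma apply_const_smul (c : ℂ) (hF : DifferentiableAt ℝ F z) :
    V.apply (fun z ↦ c • F z) z = c • V.apply F z := by
  simp only [apply_eq_sum, partialDeriv_const_smul c hF, mul_smul_comm, Finset.smul_sum]

lemma add_apply (V W : LocalField n) (F : SFun n) (z : Coord n × Coord n) :
    (V + W).apply F z = V.apply F z + W.apply F z := by
  simp only [apply_eq_sum, coeff_add, add_mul, Finset.sum_add_distrib]

lemma smul_apply (c : ℂ) (V : LocalField n) (F : SFun n) (z : Coord n × Coord n) :
    (c • V).apply F z = c • V.apply F z := by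
  simp only [apply_eq_sum, coeff_smul, smul_mul_assoc, Finset.smul_sum]

lemma contDiffAt_apply (hV : V.SmoothAt z) (hF : ContDiffAt ℝ ∞ F z) :
    ContDiffAt ℝ ∞ (V.apply F) z := by
  have h : V.apply F = fun z ↦ ∑ s, V.coeff s z * partialDeriv s F z :=
    funext fun z ↦ apply_eq_sum V F z
  rw [h]
  exact ContDiffAt.sum fun s _ ↦ contDiffAt_grassmann_mul (hV s) (contDiffAt_partialDeriv hF s)

lemma IsEven.apply_mul (hV : V.IsEven) (hF : DifferentiableAt ℝ F z)
    (hG : DifferentiableAt ℝ G z) :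
    V.apply (fun z ↦ F z * G z) z = V.apply F z * G z + F z * V.apply G z := by
  have hcomm (s : Index n) : V.coeff s z * koszul (degree s) (F z) = F z * V.coeff s z := by
    rw [mul_eq_koszul_mul (hV s z), koszul_koszul]
  simp only [apply_eq_sum, Finset.sum_mul, Finset.mul_sum, ← Finset.sum_add_distrib]
  refine Finset.sum_congr rfl fun s _ ↦ ?_
  rw [partialDeriv_mul hF hG, mul_add, ← mul_assoc, ← mul_assoc, hcomm, mul_assoc (F z)]

lemma IsEven.koszul_apply (hV : V.IsEven) (hF : DifferentiableAt ℝ F z) (a : ZMod 2) :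
    koszul a (V.apply F z) = V.apply (fun z ↦ koszul a (F z)) z := by
  simp only [apply_eq_sum, map_sum, koszul_mul_partialDeriv (hV _ z) hF]

lemma IsEven.apply_mem_parity (hV : V.IsEven) {a : ZMod 2} (hF : ∀ z, F z ∈ parity n a)
    (z : Coord n × Coord n) : V.apply F z ∈ parity n a := by
  rw [apply_eq_sum]
  refine sum_mem fun s _ ↦ ?_
  have h := mul_mem_parity (hV s z) (partialDeriv_mem_parity hF s z)
  rwa [← add_assoc, CharTwo.add_self_eq_zero, zero_add] at h

lemma IsEven.partialDeriv_apply (hV : V.IsEven) (hVz : V.SmoothAt z) (hF : ContDiffAt ℝ ∞ F z)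
    (s : Index n) :
    partialDeriv s (V.apply F) z
      = ∑ r, partialDeriv s (V.coeff r) z * partialDeriv r F z + V.apply (partialDeriv s F) z := by
  have hd {H : SFun n} (hH : ContDiffAt ℝ ∞ H z) : DifferentiableAt ℝ H z :=
    hH.differentiableAt (by simp)
  have h : V.apply F = fun z ↦ ∑ r, V.coeff r z * partialDeriv r F z :=
    funext fun z ↦ apply_eq_sum V F z
  rw [h, partialDeriv_sum _ fun r _ ↦
    hd (contDiffAt_grassmann_mul (hVz r) (contDiffAt_partialDeriv hF r)), apply_eq_sum,
    ← Finset.sum_add_distrib]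
  refine Finset.sum_congr rfl fun r _ ↦ ?_
  rw [partialDeriv_mul (hd (hVz r)) (hd (contDiffAt_partialDeriv hF r)),
    koszul_mul_partialDeriv_partialDeriv (hV r z) hF]

lemma contDiffAt_signedDeriv (hV : V.SmoothAt z) (s t : Index n) :
    ContDiffAt ℝ ∞ (V.signedDeriv s t) z :=
  contDiffAt_linearMap_comp (contDiffAt_partialDeriv (hV t) s) (koszul (degree s)).toLinearMap

lemma IsEven.signedDeriv_mem_parity (hV : V.IsEven) (s t : Index n) (z : Coord n × Coord n) :
    V.signedDeriv s t z ∈ parity n (degree s + degree t) :=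
  koszul_mem_parity _ (partialDeriv_mem_parity (hV t) s z)

lemma IsEven.sum_coeff_mul_apply_partialDeriv (hV : V.IsEven) (hW : W.IsEven)
    (hF : ContDiffAt ℝ ∞ F z) :
    ∑ t, W.coeff t z * V.apply (partialDeriv t F) z
      = ∑ s, V.coeff s z * W.apply (partialDeriv s F) z := by
  simp only [apply_eq_sum, Finset.mul_sum]
  rw [Finset.sum_comm]
  refine Finset.sum_congr rfl fun s _ ↦ Finset.sum_congr rfl fun t _ ↦ ?_
  rw [← koszul_mul_partialDeriv_partialDeriv (hW t z) hF s, ← mul_assoc, ← mul_assoc,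
    mul_eq_koszul_mul (hV s z), koszul_koszul]

lemma IsEven.apply_apply (hV : V.IsEven) (hWz : W.SmoothAt z) (hF : ContDiffAt ℝ ∞ F z) :
    V.apply (W.apply F) z
      = ∑ t, V.apply (W.coeff t) z * partialDeriv t F z
        + ∑ t, W.coeff t z * V.apply (partialDeriv t F) z := by
  have hd {H : SFun n} (hH : ContDiffAt ℝ ∞ H z) : DifferentiableAt ℝ H z :=
    hH.differentiableAt (by simp)
  have h : W.apply F = fun z ↦ ∑ t, W.coeff t z * partialDeriv t F z :=
    funext fun z ↦ apply_eq_sum W F z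
  rw [h, apply_sum _ fun t _ ↦
    hd (contDiffAt_grassmann_mul (hWz t) (contDiffAt_partialDeriv hF t)),
    ← Finset.sum_add_distrib]
  exact Finset.sum_congr rfl fun t _ ↦ hV.apply_mul (hd (hWz t)) (hd (contDiffAt_partialDeriv hF t))

lemma bracket_apply (hV : V.IsEven) (hW : W.IsEven) (hVz : V.SmoothAt z) (hWz : W.SmoothAt z)
    (hF : ContDiffAt ℝ ∞ F z) :
    ⁅V, W⁆.apply F z = V.apply (W.apply F) z - W.apply (V.apply F) z := by
  rw [hV.apply_apply hWz hF, hW.apply_apply hVz hF, hV.sum_coeff_mul_apply_partialDeriv hW hF,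
    add_sub_add_right_eq_sub, apply_eq_sum]
  simp only [coeff_bracket, sub_mul, Finset.sum_sub_distrib]

lemma IsEven.signedDeriv_apply (hV : V.IsEven) (hVz : V.SmoothAt z) (hWz : W.SmoothAt z)
    (s t : Index n) :
    koszul (degree s) (partialDeriv s (V.apply (W.coeff t)) z)
      = ∑ r, W.signedDeriv r t z * V.signedDeriv s r z + V.apply (W.signedDeriv s t) z := by
  rw [hV.partialDeriv_apply hVz (hWz t), map_add, map_sum,
    hV.koszul_apply ((contDiffAt_partialDeriv (hWz t) s).differentiableAt (by simp))]
  congr 1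
  refine Finset.sum_congr rfl fun r _ ↦ ?_
  rw [map_mul]
  refine (mul_eq_koszul_mul (hV.signedDeriv_mem_parity s r z) _).trans (congrArg (· * _) ?_)
  rw [add_comm, koszul_add, koszul_koszul]
  rfl

lemma signedDeriv_add (hV : V.SmoothAt z) (hW : W.SmoothAt z) (s t : Index n) :
    (V + W).signedDeriv s t z = V.signedDeriv s t z + W.signedDeriv s t z := by
  rw [signedDeriv, coeff_add, partialDeriv_add ((hV t).differentiableAt (by simp))
    ((hW t).differentiableAt (by simp)), map_add]
  rfl

lemma signedDeriv_smul (c : ℂ) (hV : V.SmoothAt z) (s t : Index n) :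
    (c • V).signedDeriv s t z = c • V.signedDeriv s t z := by
  rw [signedDeriv, coeff_smul, partialDeriv_const_smul c ((hV t).differentiableAt (by simp)),
    map_smul]
  rfl

lemma signedDeriv_bracket (hV : V.IsEven) (hW : W.IsEven) (hVz : V.SmoothAt z)
    (hWz : W.SmoothAt z) (s t : Index n) :
    ⁅V, W⁆.signedDeriv s t z
      = V.apply (W.signedDeriv s t) z - W.apply (V.signedDeriv s t) z
        + ∑ r, (W.signedDeriv r t z * V.signedDeriv s r z
          - V.signedDeriv r t z * W.signedDeriv s r z) := by
  rw [signedDeriv, coeff_bracket,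
    partialDeriv_sub ((contDiffAt_apply hVz (hWz t)).differentiableAt (by simp))
      ((contDiffAt_apply hWz (hVz t)).differentiableAt (by simp)),
    map_sub, hV.signedDeriv_apply hVz hWz, hW.signedDeriv_apply hWz hVz, Finset.sum_sub_distrib]
  abel

lemma IsEven.add (hV : V.IsEven) (hW : W.IsEven) : (V + W).IsEven := fun s z ↦ by
  rw [coeff_add]
  exact add_mem (hV s z) (hW s z)

lemma IsEven.smul (c : ℂ) (hV : V.IsEven) : (c • V).IsEven := fun s z ↦ by
  rw [coeff_smul]
  exact Submodule.smul_mem _ c (hV s z)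

lemma IsEven.bracket (hV : V.IsEven) (hW : W.IsEven) : ⁅V, W⁆.IsEven := fun s z ↦ by
  rw [coeff_bracket]
  exact sub_mem (hV.apply_mem_parity (hW s) z) (hW.apply_mem_parity (hV s) z)

lemma SmoothAt.add (hV : V.SmoothAt z) (hW : W.SmoothAt z) : (V + W).SmoothAt z := fun s ↦ by
  rw [coeff_add]
  exact (hV s).add (hW s)

lemma SmoothAt.smul (c : ℂ) (hV : V.SmoothAt z) : (c • V).SmoothAt z := fun s ↦ by
  rw [coeff_smul]
  exact (hV s).const_smul c

lemma SmoothAt.bracket (hV : V.SmoothAt z) (hW : W.SmoothAt z) : ⁅V, W⁆.SmoothAt z := fun s ↦ by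
  rw [coeff_bracket]
  exact (contDiffAt_apply hV (hW s)).sub (contDiffAt_apply hW (hV s))

variable {a b : LocalForm n}

lemma IsEven.lieDeriv_coeff (hV : V.IsEven) (a : LocalForm n) (s : Index n)
    (z : Coord n × Coord n) :
    (V.lieDeriv a).coeff s z
      = V.apply (a.coeff s) z + ∑ t, a.coeff t z * V.signedDeriv s t z := by
  have hx (i j : Fin n) : grade (leftDeriv j (V.x i z)) = -leftDeriv j (V.x i z) :=
    grade_odd (leftDeriv_mem_parity (hV (.inl i) z) j)
  have hp (i j : Fin n) : grade (leftDeriv j (V.p i z)) = -leftDeriv j (V.p i z) :=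
    grade_odd (leftDeriv_mem_parity (hV (.inr (.inl i)) z) j)
  have hxi (i j : Fin n) : grade (leftDeriv j (V.xi i z)) = leftDeriv j (V.xi i z) :=
    grade_even (leftDeriv_mem_parity (hV (.inr (.inr i)) z) j)
  rw [Fintype.sum_sum_type, Fintype.sum_sum_type, ← Finset.sum_add_distrib,
    ← Finset.sum_add_distrib]
  rcases s with j | j | j
  · simp only [← add_assoc]; rfl
  · simp only [← add_assoc]; rfl
  · refine congrArg (V.apply (a.xi j) z + ·) (Finset.sum_congr rfl fun i _ ↦ ?_)
    simp only [signedDeriv, degree, Sum.elim_inr, Pi.one_apply, koszul_one]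
    change _ = a.x i z * grade (leftDeriv j (V.x i z)) + (a.p i z * grade (leftDeriv j (V.p i z))
      + a.xi i z * grade (leftDeriv j (V.xi i z)))
    rw [hx, hp, hxi, mul_neg, mul_neg, ← add_assoc, ← sub_eq_add_neg]
    rfl

lemma IsEven.lieDeriv_add (hV : V.IsEven) (hW : W.IsEven) (hVz : V.SmoothAt z)
    (hWz : W.SmoothAt z) (s : Index n) :
    ((V + W).lieDeriv a).coeff s z
      = (V.lieDeriv a).coeff s z + (W.lieDeriv a).coeff s z := by
  simp only [(hV.add hW).lieDeriv_coeff, hV.lieDeriv_coeff, hW.lieDeriv_coeff, add_apply,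
    signedDeriv_add hVz hWz, mul_add, Finset.sum_add_distrib]
  abel

lemma IsEven.lieDeriv_smul (c : ℂ) (hV : V.IsEven) (hVz : V.SmoothAt z) (s : Index n) :
    ((c • V).lieDeriv a).coeff s z = c • (V.lieDeriv a).coeff s z := by
  simp only [(hV.smul c).lieDeriv_coeff, hV.lieDeriv_coeff, smul_apply, signedDeriv_smul c hVz,
    mul_smul_comm, smul_add, Finset.smul_sum]

lemma IsEven.lieDeriv_of_eventuallyEq_mul (hV : V.IsEven) (hF : DifferentiableAt ℝ F z)
    (ha : ∀ s, DifferentiableAt ℝ (a.coeff s) z)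
    (h : ∀ s, b.coeff s =ᶠ[𝓝 z] fun z ↦ F z * a.coeff s z) (s : Index n) :
    (V.lieDeriv b).coeff s z
      = V.apply F z * a.coeff s z + F z * (V.lieDeriv a).coeff s z := by
  simp only [hV.lieDeriv_coeff, apply_of_eventuallyEq (h _), hV.apply_mul hF (ha _),
    (h _).eq_of_nhds, mul_add, Finset.mul_sum, add_assoc, mul_assoc]

lemma IsEven.lieDeriv_lieDeriv (hV : V.IsEven) (hW : W.IsEven) (hWz : W.SmoothAt z)
    (ha : ∀ s, ContDiffAt ℝ ∞ (a.coeff s) z) (s : Index n) :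
    (V.lieDeriv (W.lieDeriv a)).coeff s z
      = V.apply (W.apply (a.coeff s)) z
        + ∑ t, V.apply (a.coeff t) z * W.signedDeriv s t z
        + ∑ t, W.apply (a.coeff t) z * V.signedDeriv s t z
        + ∑ t, a.coeff t z * (V.apply (W.signedDeriv s t) z
          + ∑ r, W.signedDeriv r t z * V.signedDeriv s r z) := by
  have hd {H : SFun n} (hH : ContDiffAt ℝ ∞ H z) : DifferentiableAt ℝ H z :=
    hH.differentiableAt (by simp)
  have h : (W.lieDeriv a).coeff s
      = fun z ↦ W.apply (a.coeff s) z + ∑ t, a.coeff t z * W.signedDeriv s t z :=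
    funext (hW.lieDeriv_coeff a s)
  have hsmooth (t : Index n) := contDiffAt_grassmann_mul (ha t) (contDiffAt_signedDeriv hWz s t)
  have hV_coeff : V.apply ((W.lieDeriv a).coeff s) z = V.apply (W.apply (a.coeff s)) z
      + ∑ t, (V.apply (a.coeff t) z * W.signedDeriv s t z
        + a.coeff t z * V.apply (W.signedDeriv s t) z) := by
    rw [h, apply_add (hd (contDiffAt_apply hWz (ha s))) (hd (ContDiffAt.sum fun t _ ↦ hsmooth t)),
      apply_sum _ fun t _ ↦ hd (hsmooth t)]
    simp only [hV.apply_mul (hd (ha _)) (hd (contDiffAt_signedDeriv hWz s _))]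
  have hsum : ∑ t, (W.lieDeriv a).coeff t z * V.signedDeriv s t z
      = ∑ t, W.apply (a.coeff t) z * V.signedDeriv s t z
        + ∑ t, a.coeff t z * ∑ r, W.signedDeriv r t z * V.signedDeriv s r z := by
    simp only [hW.lieDeriv_coeff, add_mul, Finset.sum_add_distrib, Finset.sum_mul, Finset.mul_sum,
      mul_assoc]
    rw [Finset.sum_comm (γ := Index n)]
  rw [hV.lieDeriv_coeff, hV_coeff, hsum]
  simp only [mul_add, Finset.sum_add_distrib]
  abel

theorem lieDeriv_bracket (hV : V.IsEven) (hW : W.IsEven) (hVz : V.SmoothAt z)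
    (hWz : W.SmoothAt z) (ha : ∀ s, ContDiffAt ℝ ∞ (a.coeff s) z) (s : Index n) :
    (⁅V, W⁆.lieDeriv a).coeff s z
      = (V.lieDeriv (W.lieDeriv a)).coeff s z - (W.lieDeriv (V.lieDeriv a)).coeff s z := by
  rw [(hV.bracket hW).lieDeriv_coeff, bracket_apply hV hW hVz hWz (ha s),
    hV.lieDeriv_lieDeriv hW hWz ha, hW.lieDeriv_lieDeriv hV hVz ha]
  simp only [signedDeriv_bracket hV hW hVz hWz, mul_add, mul_sub, Finset.sum_add_distrib,
    Finset.sum_sub_distrib]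
  abel

end LocalField

end LocalFields

/-! ### Charts and vector fields in coordinates -/

section Charts

section PartialDerivatives

variable {f g : Coord n → ℝ} {y : Coord n}

lemma coord_eq_sum (v : Coord n) : v = ∑ i, v i • EuclideanSpace.single i (1 : ℝ) := by
  ext j
  simp [Finset.sum_apply, Pi.single_apply]

lemma differentiableAt_of_contDiffOn {E F : Type*} [NormedAddCommGroup E] [NormedSpace ℝ E]
    [NormedAddCommGroup F] [NormedSpace ℝ F] {f : E → F} {s : Set E} (hs : IsOpen s)
    (hf : ContDiffOn ℝ ∞ f s) {y : E} (hy : y ∈ s) : DifferentiableAt ℝ f y :=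
  (hf.contDiffAt (hs.mem_nhds hy)).differentiableAt (by simp)

lemma pd_congr (h : f =ᶠ[𝓝 y] g) (i : Fin n) : pd i f y = pd i g y := by
  rw [pd, pd, h.fderiv_eq]

lemma pd_const (c : ℝ) (i : Fin n) (y : Coord n) : pd i (fun _ ↦ c) y = 0 := by
  simp [pd]

lemma pd_add (hf : DifferentiableAt ℝ f y) (hg : DifferentiableAt ℝ g y) (i : Fin n) :
    pd i (fun y ↦ f y + g y) y = pd i f y + pd i g y := by
  simp [pd, fderiv_fun_add hf hg]

lemma pd_sub (hf : DifferentiableAt ℝ f y) (hg : DifferentiableAt ℝ g y) (i : Fin n) :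
    pd i (fun y ↦ f y - g y) y = pd i f y - pd i g y := by
  simp [pd, fderiv_fun_sub hf hg]

lemma pd_mul (hf : DifferentiableAt ℝ f y) (hg : DifferentiableAt ℝ g y) (i : Fin n) :
    pd i (fun y ↦ f y * g y) y = pd i f y * g y + f y * pd i g y := by
  simp only [pd, fderiv_fun_mul hf hg, add_apply, smul_apply, smul_eq_mul]
  ring

lemma pd_const_mul (c : ℝ) (hf : DifferentiableAt ℝ f y) (i : Fin n) :
    pd i (fun y ↦ c * f y) y = c * pd i f y := by
  simp [pd, fderiv_const_mul hf c]

lemma pd_sum {ι : Type*} (s : Finset ι) {f : ι → Coord n → ℝ}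
    (hf : ∀ k, DifferentiableAt ℝ (f k) y) (i : Fin n) :
    pd i (fun y ↦ ∑ k ∈ s, f k y) y = ∑ k ∈ s, pd i (f k) y := by
  simp [pd, fderiv_fun_sum (fun k _ ↦ hf k), _root_.sum_apply]

lemma contDiffOn_pd {s : Set (Coord n)} (hs : IsOpen s) (hf : ContDiffOn ℝ ∞ f s) (i : Fin n) :
    ContDiffOn ℝ ∞ (pd i f) s :=
  (hf.fderiv_of_isOpen (m := ∞) hs (by simp)).clm_apply contDiffOn_const

lemma pd_comm (hf : ContDiffAt ℝ ∞ f y) (i j : Fin n) : pd i (pd j f) y = pd j (pd i f) y :=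
  fderiv_fderiv_comm hf _ _

lemma fderiv_apply_eq_sum (f : Coord n → ℝ) (y v : Coord n) :
    fderiv ℝ f y v = ∑ k, v k * pd k f y := by
  conv_lhs => rw [coord_eq_sum v]
  simp [pd]

end PartialDerivatives

namespace Chart

variable {φ ψ : Chart n M} {y : Coord n}

lemma isOpen_domain (φ : Chart n M) : IsOpen φ.domain :=
  φ.1.open_target.prod isOpen_univ

/-- The part of the domain of the chart `φ` where the chart `ψ` is defined. -/
def overlap (φ ψ : Chart n M) : Set (Coord n) := (φ.1.symm.trans ψ.1).source

lemma mem_overlap :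
    y ∈ φ.overlap ψ ↔ y ∈ φ.1.target ∧ φ.1.symm y ∈ ψ.1.source := by
  simp [overlap]

lemma isOpen_overlap (φ ψ : Chart n M) : IsOpen (φ.overlap ψ) :=
  (φ.1.symm.trans ψ.1).open_source

lemma symm_transition (hy : y ∈ φ.overlap ψ) :
    ψ.1.symm (φ.transition ψ y) = φ.1.symm y :=
  ψ.1.left_inv (mem_overlap.1 hy).2

lemma transition_mem_target (hy : y ∈ φ.overlap ψ) :
    φ.transition ψ y ∈ ψ.1.target :=
  ψ.1.map_source (mem_overlap.1 hy).2

lemma transition_mem_overlap (hy : y ∈ φ.overlap ψ) :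
    φ.transition ψ y ∈ ψ.overlap φ := by
  rw [mem_overlap, symm_transition hy]
  exact ⟨transition_mem_target hy, φ.1.map_target (mem_overlap.1 hy).1⟩

lemma transition_transition (hy : y ∈ φ.overlap ψ) :
    ψ.transition φ (φ.transition ψ y) = y := by
  rw [transition, symm_transition hy]
  exact φ.1.right_inv (mem_overlap.1 hy).1

lemma contMDiffOn (φ : Chart n M) : ContMDiffOn (𝓡 n) (𝓡 n) ∞ φ.1 φ.1.source :=
  contMDiffOn_of_mem_maximalAtlas φ.2

lemma contMDiffOn_symm (φ : Chart n M) :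
    ContMDiffOn (𝓡 n) (𝓡 n) ∞ φ.1.symm φ.1.target :=
  contMDiffOn_symm_of_mem_maximalAtlas φ.2

lemma contMDiffAt_symm (φ : Chart n M) {y : Coord n} (hy : y ∈ φ.1.target) :
    ContMDiffAt (𝓡 n) (𝓡 n) ∞ φ.1.symm y :=
  φ.contMDiffOn_symm.contMDiffAt (φ.1.open_target.mem_nhds hy)

lemma mdifferentiable (φ : Chart n M) : φ.1.MDifferentiable (𝓡 n) (𝓡 n) :=
  ⟨φ.contMDiffOn.mdifferentiableOn (by simp), φ.contMDiffOn_symm.mdifferentiableOn (by simp)⟩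

lemma contDiffOn_transition (φ ψ : Chart n M) :
    ContDiffOn ℝ ∞ (φ.transition ψ) (φ.overlap ψ) := by
  rw [← contMDiffOn_iff_contDiffOn]
  refine ψ.contMDiffOn.comp (φ.contMDiffOn_symm.mono fun y hy ↦ (mem_overlap.1 hy).1) ?_
  exact fun y hy ↦ (mem_overlap.1 hy).2

lemma contDiffOn_scalar (φ : Chart n M) {f : M → ℝ} (hf : ContMDiff (𝓡 n) 𝓘(ℝ, ℝ) ∞ f) :
    ContDiffOn ℝ ∞ (fun y ↦ f (φ.1.symm y)) φ.1.target := by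
  rw [← contMDiffOn_iff_contDiffOn]
  exact hf.comp_contMDiffOn φ.contMDiffOn_symm

/-- The differential of the inverse of a chart, as a map from `Coord n`. -/
abbrev push (φ : Chart n M) (y : Coord n) : Coord n →L[ℝ] TangentSpace (𝓡 n) (φ.1.symm y) :=
  mfderiv (𝓡 n) (𝓡 n) φ.1.symm y

/-- The differential of a chart. -/
abbrev pull (φ : Chart n M) (q : M) : TangentSpace (𝓡 n) q →L[ℝ] Coord n :=
  mfderiv (𝓡 n) (𝓡 n) φ.1 q

lemma pull_push (φ : Chart n M) {y : Coord n} (hy : y ∈ φ.1.target) (v : Coord n) :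
    φ.pull (φ.1.symm y) (φ.push y v) = v :=
  congrArg (fun f : Coord n →L[ℝ] Coord n ↦ f v) (φ.mdifferentiable.comp_symm_deriv hy)

lemma push_pull (φ : Chart n M) {y : Coord n} (hy : y ∈ φ.1.target)
    (v : TangentSpace (𝓡 n) (φ.1.symm y)) : φ.push y (φ.pull (φ.1.symm y) v) = v := by
  let A : Coord n →ₗ[ℝ] Coord n := (φ.push y : Coord n →L[ℝ] Coord n).toLinearMap
  let B : Coord n →ₗ[ℝ] Coord n := (φ.pull (φ.1.symm y) : Coord n →L[ℝ] Coord n).toLinearMap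
  have h : B * A = 1 := LinearMap.ext fun v ↦ φ.pull_push hy v
  exact LinearMap.congr_fun (mul_eq_one_comm.1 h) v

lemma fderiv_transition (hy : y ∈ φ.overlap ψ) (v : Coord n) :
    fderiv ℝ (φ.transition ψ) y v = ψ.pull (φ.1.symm y) (φ.push y v) := by
  have h := mfderiv_comp y (ψ.mdifferentiable.mdifferentiableAt (mem_overlap.1 hy).2)
    (φ.mdifferentiable.mdifferentiableAt_symm (mem_overlap.1 hy).1)
  rw [mfderiv_eq_fderiv] at h
  exact congrArg (fun f : Coord n →L[ℝ] Coord n ↦ f v) h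

lemma push_transition (hy : y ∈ φ.overlap ψ) (v : Coord n) :
    (ψ.push (φ.transition ψ y) (fderiv ℝ (φ.transition ψ) y v) : Coord n) = φ.push y v := by
  have ht := differentiableAt_of_contDiffOn (φ.isOpen_overlap ψ) (φ.contDiffOn_transition ψ) hy
  have h := mfderiv_comp y (ψ.mdifferentiable.mdifferentiableAt_symm
    (transition_mem_target hy)) ht.mdifferentiableAt
  rw [mfderiv_eq_fderiv] at h
  have hsymm : ψ.1.symm ∘ φ.transition ψ =ᶠ[𝓝 y] φ.1.symm := by
    filter_upwards [(φ.isOpen_overlap ψ).mem_nhds hy] with w hw using symm_transition hw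
  have hderiv : (mfderiv (𝓡 n) (𝓡 n) (ψ.1.symm ∘ φ.transition ψ) y : Coord n →L[ℝ] Coord n)
      = mfderiv (𝓡 n) (𝓡 n) φ.1.symm y := hsymm.mfderiv_eq
  exact congrArg (fun f : Coord n →L[ℝ] Coord n ↦ f v) (h.symm.trans hderiv)

lemma jacobian_apply (φ ψ : Chart n M) (y v : Coord n) (i : Fin n) :
    fderiv ℝ (φ.transition ψ) y v i = ∑ j, φ.jacobian ψ y i j * v j := by
  conv_lhs => rw [coord_eq_sum v]
  simp [jacobian, mul_comm]

lemma pd_comp_transition (hy : y ∈ φ.overlap ψ) {f h : Coord n → ℝ}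
    (hf : DifferentiableAt ℝ f (φ.transition ψ y))
    (e : ∀ w ∈ φ.overlap ψ, f (φ.transition ψ w) = h w) (j : Fin n) :
    ∑ a, pd a f (φ.transition ψ y) * φ.jacobian ψ y a j = pd j h y := by
  have ht := differentiableAt_of_contDiffOn (φ.isOpen_overlap ψ) (φ.contDiffOn_transition ψ) hy
  have hcomp : HasFDerivAt (fun w ↦ f (φ.transition ψ w)) _ y :=
    hf.hasFDerivAt.comp y ht.hasFDerivAt
  have heq : (fun w ↦ f (φ.transition ψ w)) =ᶠ[𝓝 y] h := by
    filter_upwards [(φ.isOpen_overlap ψ).mem_nhds hy] with w hw using e w hw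
  rw [← pd_congr heq, pd, hcomp.fderiv, ContinuousLinearMap.comp_apply, fderiv_apply_eq_sum]
  exact Finset.sum_congr rfl fun a _ ↦ mul_comm _ _

lemma jacobian_eq_pd (hy : y ∈ φ.overlap ψ) (i j : Fin n) :
    φ.jacobian ψ y i j = pd j (fun w ↦ φ.transition ψ w i) y := by
  have ht := differentiableAt_of_contDiffOn (φ.isOpen_overlap ψ) (φ.contDiffOn_transition ψ) hy
  have h : HasFDerivAt (fun w ↦ φ.transition ψ w i) _ y :=
    (EuclideanSpace.proj (𝕜 := ℝ) i).hasFDerivAt.comp y ht.hasFDerivAt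
  rw [pd, h.fderiv]
  rfl

lemma contDiffOn_transition_apply (φ ψ : Chart n M) (i : Fin n) :
    ContDiffOn ℝ ∞ (fun w ↦ φ.transition ψ w i) (φ.overlap ψ) :=
  (EuclideanSpace.proj (𝕜 := ℝ) i).contDiff.comp_contDiffOn (φ.contDiffOn_transition ψ)

lemma contDiffOn_jacobian (φ ψ : Chart n M) (i j : Fin n) :
    ContDiffOn ℝ ∞ (fun y ↦ φ.jacobian ψ y i j) (φ.overlap ψ) :=
  (contDiffOn_pd (φ.isOpen_overlap ψ) (φ.contDiffOn_transition_apply ψ i) j).congr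
    fun _ hy ↦ jacobian_eq_pd hy i j

lemma pd_jacobian_comm (hy : y ∈ φ.overlap ψ) (i j k : Fin n) :
    pd j (fun w ↦ φ.jacobian ψ w i k) y = pd k (fun w ↦ φ.jacobian ψ w i j) y := by
  have h (j k : Fin n) : pd j (fun w ↦ φ.jacobian ψ w i k) y
      = pd j (pd k (fun w ↦ φ.transition ψ w i)) y := by
    refine pd_congr ?_ j
    filter_upwards [(φ.isOpen_overlap ψ).mem_nhds hy] with w hw
    exact jacobian_eq_pd hw i k
  rw [h, h, pd_comm]
  exact (φ.contDiffOn_transition_apply ψ i).contDiffAt ((φ.isOpen_overlap ψ).mem_nhds hy)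

lemma jacobian_mul_jacobian (hy : y ∈ φ.overlap ψ) (i j : Fin n) :
    ∑ a, ψ.jacobian φ (φ.transition ψ y) i a * φ.jacobian ψ y a j = if i = j then 1 else 0 := by
  have h := pd_comp_transition (f := fun w ↦ ψ.transition φ w i) (h := fun w ↦ w i) hy
    (differentiableAt_of_contDiffOn (ψ.isOpen_overlap φ) (ψ.contDiffOn_transition_apply φ i)
      (transition_mem_overlap hy))
    (fun w hw ↦ by rw [transition_transition hw]) j
  have hcoord : pd j (fun w : Coord n ↦ w i) y = if i = j then 1 else 0 := by
    rw [pd, show (fun w : Coord n ↦ w i) = EuclideanSpace.proj (𝕜 := ℝ) i from rfl,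
      ContinuousLinearMap.fderiv]
    simp
  rw [← hcoord, ← h]
  exact Finset.sum_congr rfl fun a _ ↦ by
    rw [jacobian_eq_pd (transition_mem_overlap hy)]

lemma jacobian_mul_jacobian' (hy : y ∈ φ.overlap ψ) (i j : Fin n) :
    ∑ a, φ.jacobian ψ y i a * ψ.jacobian φ (φ.transition ψ y) a j = if i = j then 1 else 0 := by
  have h := jacobian_mul_jacobian (transition_mem_overlap hy) i j
  rwa [transition_transition hy] at h

end Chart

lemma vcomp_eq (X : VField n M) (φ : Chart n M) (i : Fin n) (y : Coord n) :
    vcomp X φ i y =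
      EuclideanSpace.proj (𝕜 := ℝ) i (φ.pull (φ.1.symm y) (X (φ.1.symm y))) := rfl

lemma vcomp_add (X Y : VField n M) (φ : Chart n M) (i : Fin n) (y : Coord n) :
    vcomp (X + Y) φ i y = vcomp X φ i y + vcomp Y φ i y := by
  simp only [vcomp_eq, Pi.add_apply, map_add]

lemma vcomp_smul (a : ℝ) (X : VField n M) (φ : Chart n M) (i : Fin n) (y : Coord n) :
    vcomp (a • X) φ i y = a * vcomp X φ i y := by
  simp only [vcomp_eq, Pi.smul_apply, map_smul, smul_eq_mul]

lemma vcomp_transition (X : VField n M) {φ ψ : Chart n M} {y : Coord n} (hy : y ∈ φ.overlap ψ)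
    (i : Fin n) : vcomp X ψ i (φ.transition ψ y) = ∑ j, φ.jacobian ψ y i j * vcomp X φ j y := by
  have hψ : vcomp X ψ i (φ.transition ψ y) = ψ.pull (φ.1.symm y) (X (φ.1.symm y)) i := by
    unfold vcomp
    rw [Chart.symm_transition hy]
    rfl
  have hpull := Chart.fderiv_transition hy (φ.pull (φ.1.symm y) (X (φ.1.symm y)))
  rw [φ.push_pull (Chart.mem_overlap.1 hy).1] at hpull
  rw [hψ, ← hpull, Chart.jacobian_apply]
  rfl

/-- A vector field of `M` in the coordinates of the chart `φ`. -/
def vlocal (X : VField n M) (φ : Chart n M) (y : Coord n) : Coord n :=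
  φ.pull (φ.1.symm y) (X (φ.1.symm y))

lemma mpullback_symm_eq_vlocal (X : VField n M) (φ : Chart n M) {y : Coord n}
    (hy : y ∈ φ.1.target) :
    VectorField.mpullback (𝓡 n) (𝓡 n) φ.1.symm X y = vlocal X φ y := by
  have h : (φ.push y).inverse = φ.pull (φ.1.symm y) :=
    ContinuousLinearMap.inverse_eq (ContinuousLinearMap.ext fun v ↦ φ.push_pull hy v)
      (ContinuousLinearMap.ext fun v ↦ φ.pull_push hy v)
  exact congrArg (fun f : Coord n →L[ℝ] Coord n ↦ f (X (φ.1.symm y))) h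

lemma mlieBracket_eq_lieBracket (V W : ∀ y : Coord n, TangentSpace (𝓡 n) y) (y : Coord n) :
    VectorField.mlieBracket (𝓡 n) V W y = VectorField.lieBracket ℝ V W y := by
  rw [← VectorField.mlieBracketWithin_univ, VectorField.mlieBracketWithin_eq_lieBracketWithin]
  exact congrFun VectorField.lieBracketWithin_univ y

variable [IsManifold (𝓡 n) ∞ M]

lemma contDiffOn_vcomp {X : VField n M} (hX : IsSmooth X) (φ : Chart n M) (i : Fin n) :
    ContDiffOn ℝ ∞ (vcomp X φ i) φ.1.target := by
  have hφ : ContMDiffOn (𝓡 n).tangent (𝓡 n).tangent ∞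
      (tangentMapWithin (𝓡 n) (𝓡 n) φ.1 φ.1.source) _ :=
    φ.contMDiffOn.contMDiffOn_tangentMapWithin (m := ∞) (by simp) φ.1.open_source.uniqueMDiffOn
  have hXφ : ContMDiffOn (𝓡 n) (𝓡 n).tangent ∞
      (fun y ↦ (⟨φ.1.symm y, X (φ.1.symm y)⟩ : TangentBundle (𝓡 n) M)) φ.1.target :=
    ContMDiff.comp_contMDiffOn hX φ.contMDiffOn_symm
  have h : ContMDiffOn (𝓡 n) 𝓘(ℝ, Coord n) ∞
      (fun y ↦ (tangentMapWithin (𝓡 n) (𝓡 n) φ.1 φ.1.source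
        (⟨φ.1.symm y, X (φ.1.symm y)⟩ : TangentBundle (𝓡 n) M)).2) φ.1.target :=
    (contMDiff_snd_tangentBundle_modelSpace (Coord n) (𝓡 n)).comp_contMDiffOn
      (hφ.comp hXφ fun y hy ↦ φ.1.map_target hy)
  refine ((EuclideanSpace.proj (𝕜 := ℝ) i).contDiff.comp_contDiffOn
    (contMDiffOn_iff_contDiffOn.1 h)).congr fun y hy ↦ ?_
  simp only [vcomp, tangentMapWithin, Function.comp]
  rw [mfderivWithin_of_isOpen φ.1.open_source (φ.1.map_target hy)]

lemma contMDiffOn_push (φ : Chart n M) (v : Coord n) :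
    ContMDiffOn (𝓡 n) (𝓡 n).tangent ∞
      (fun y ↦ (⟨φ.1.symm y, φ.push y v⟩ : TangentBundle (𝓡 n) M)) φ.1.target := by
  have hφ := φ.contMDiffOn_symm.contMDiffOn_tangentMapWithin (m := ∞) (by simp)
    φ.1.open_target.uniqueMDiffOn
  have hv : ContMDiffOn (𝓡 n) (𝓡 n).tangent ∞
      (fun y ↦ (⟨y, v⟩ : TangentBundle (𝓡 n) (Coord n))) φ.1.target :=
    ((contMDiff_vectorSpace_iff_contDiff (V := fun _ : Coord n ↦ v)).2 contDiff_const).contMDiffOn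
  refine (hφ.comp hv fun y hy ↦ hy).congr fun y hy ↦ ?_
  simp only [tangentMapWithin, Function.comp]
  rw [mfderivWithin_of_isOpen φ.1.open_target hy]
  rfl

lemma isManifold_minSmoothness_two : IsManifold (𝓡 n) (minSmoothness ℝ 2) M := by
  rw [minSmoothness_of_isRCLikeNormedField]
  exact IsManifold.of_le (n := ∞) (WithTop.coe_le_coe.2 (le_top : (2 : ℕ∞) ≤ ⊤))

lemma IsSmooth.add {X Y : VField n M} (hX : IsSmooth X) (hY : IsSmooth Y) : IsSmooth (X + Y) :=
  ContMDiff.add_section hX hY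

lemma IsSmooth.smul {X : VField n M} (hX : IsSmooth X) (a : ℝ) : IsSmooth (a • X) :=
  ContMDiff.const_smul_section hX

lemma IsSmooth.mlieBracket {X Y : VField n M} (hX : IsSmooth X) (hY : IsSmooth Y) :
    IsSmooth (VectorField.mlieBracket (𝓡 n) X Y) := by
  have : IsManifold (𝓡 n) (∞ + 1) M := by simpa
  have : IsManifold (𝓡 n) (minSmoothness ℝ 2) M := isManifold_minSmoothness_two
  exact ContDiff.mlieBracket_vectorField (m := ⊤) (n := ⊤) hX hY (by simp)

lemma differentiableAt_vlocal {X : VField n M} (hX : IsSmooth X) (φ : Chart n M) {y : Coord n}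
    (hy : y ∈ φ.1.target) : DifferentiableAt ℝ (vlocal X φ) y :=
  differentiableAt_euclidean.2 fun i ↦
    differentiableAt_of_contDiffOn φ.1.open_target (contDiffOn_vcomp hX φ i) hy

lemma fderiv_vlocal_apply {X : VField n M} (hX : IsSmooth X) (φ : Chart n M) {y : Coord n}
    (hy : y ∈ φ.1.target) (v : Coord n) (i : Fin n) :
    fderiv ℝ (vlocal X φ) y v i = ∑ k, v k * pd k (vcomp X φ i) y := by
  have h : HasFDerivAt (vcomp X φ i) _ y :=
    (EuclideanSpace.proj (𝕜 := ℝ) i).hasFDerivAt.comp y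
      (differentiableAt_vlocal hX φ hy).hasFDerivAt
  rw [← fderiv_apply_eq_sum, h.fderiv]
  rfl

lemma vlocal_mlieBracket {X Y : VField n M} (hX : IsSmooth X) (hY : IsSmooth Y) (φ : Chart n M)
    {y : Coord n} (hy : y ∈ φ.1.target) :
    vlocal (VectorField.mlieBracket (𝓡 n) X Y) φ y
      = VectorField.lieBracket ℝ (vlocal X φ) (vlocal Y φ) y := by
  have : IsManifold (𝓡 n) (minSmoothness ℝ 2) M := isManifold_minSmoothness_two
  have : IsManifold (𝓡 n) 2 M := by simpa using this
  have hφ (X : VField n M) :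
      VectorField.mpullback (𝓡 n) (𝓡 n) φ.1.symm X =ᶠ[𝓝 y] vlocal X φ := by
    filter_upwards [φ.1.open_target.mem_nhds hy] with w hw using mpullback_symm_eq_vlocal X φ hw
  have h := VectorField.mpullback_mlieBracket (n := ∞) (x₀ := y) (f := φ.1.symm)
    ((hX (φ.1.symm y)).mdifferentiableAt (by simp)) ((hY (φ.1.symm y)).mdifferentiableAt (by simp))
    (φ.contMDiffAt_symm hy) (by
      rw [minSmoothness_of_isRCLikeNormedField]
      exact WithTop.coe_le_coe.2 (le_top : (2 : ℕ∞) ≤ ⊤))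
  exact (mpullback_symm_eq_vlocal _ φ hy).symm.trans
    (h.trans ((mlieBracket_eq_lieBracket _ _ y).trans
      ((hφ X).lieBracket_vectorField_eq (hφ Y))))

lemma vcomp_mlieBracket {X Y : VField n M} (hX : IsSmooth X) (hY : IsSmooth Y) (φ : Chart n M)
    (i : Fin n) {y : Coord n} (hy : y ∈ φ.1.target) :
    vcomp (VectorField.mlieBracket (𝓡 n) X Y) φ i y =
      ∑ k, (vcomp X φ k y * pd k (vcomp Y φ i) y - vcomp Y φ k y * pd k (vcomp X φ i) y) := by
  have h := congrArg (EuclideanSpace.proj (𝕜 := ℝ) i) (vlocal_mlieBracket hX hY φ hy)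
  rw [VectorField.lieBracket, map_sub] at h
  rw [Finset.sum_sub_distrib]
  exact h.trans (congrArg₂ _ (fderiv_vlocal_apply hY φ hy _ i) (fderiv_vlocal_apply hX φ hy _ i))

end Charts

/-! ### The metric in coordinates -/

lemma contDiffOn_det {E : Type*} [NormedAddCommGroup E] [NormedSpace ℝ E] {s : Set E}
    {A : E → Matrix (Fin n) (Fin n) ℝ} (hA : ∀ i j, ContDiffOn ℝ ∞ (fun y ↦ A y i j) s) :
    ContDiffOn ℝ ∞ (fun y ↦ (A y).det) s := by
  simp only [Matrix.det_apply']
  exact ContDiffOn.sum fun σ _ ↦ contDiffOn_const.mul (contDiffOn_prod fun i _ ↦ hA _ _)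

lemma contDiffOn_matrix_inv {E : Type*} [NormedAddCommGroup E] [NormedSpace ℝ E] {s : Set E}
    {A : E → Matrix (Fin n) (Fin n) ℝ} (hA : ∀ i j, ContDiffOn ℝ ∞ (fun y ↦ A y i j) s)
    (h0 : ∀ y ∈ s, (A y).det ≠ 0) (i j : Fin n) : ContDiffOn ℝ ∞ (fun y ↦ (A y)⁻¹ i j) s := by
  simp only [Matrix.inv_def, Ring.inverse_eq_inv', Matrix.smul_apply, smul_eq_mul,
    Matrix.adjugate_apply]
  refine ((contDiffOn_det hA).inv h0).mul (contDiffOn_det fun a b ↦ ?_)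
  simp only [Matrix.updateRow_apply]
  split_ifs
  · exact contDiffOn_const
  · exact hA a b

namespace PseudoRiemannianMetric

variable [IsManifold (𝓡 n) ∞ M] (g : PseudoRiemannianMetric n M) (φ : Chart n M)

lemma coef_symm (i j : Fin n) : g.coef φ i j = g.coef φ j i :=
  funext fun _ ↦ g.symm _ _ _

lemma inner_congr {q q' : M} (h : q = q') (v w : Coord n) :
    g.inner q v w = g.inner q' v w := by
  subst h
  rfl

lemma contDiffOn_coef (i j : Fin n) : ContDiffOn ℝ ∞ (g.coef φ i j) φ.1.target := by
  rw [← contMDiffOn_iff_contDiffOn]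
  have h : ContMDiffOn (𝓡 n) ((𝓡 n).prod 𝓘(ℝ)) ∞
      (fun y ↦ Bundle.TotalSpace.mk' ℝ (E := Bundle.Trivial M ℝ) (φ.1.symm y)
        (g.inner (φ.1.symm y) (φ.push y (EuclideanSpace.single i 1))
          (φ.push y (EuclideanSpace.single j 1)))) φ.1.target := by
    apply ContMDiffOn.clm_bundle_apply₂ (F₁ := Coord n) (F₂ := Coord n)
    · exact g.contMDiff.comp_contMDiffOn φ.contMDiffOn_symm
    · exact contMDiffOn_push φ _
    · exact contMDiffOn_push φ _
  intro y hy
  exact (Bundle.contMDiffWithinAt_totalSpace.1 (h y hy)).2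

lemma inner_push (y v w : Coord n) :
    g.inner (φ.1.symm y) (φ.push y v) (φ.push y w) = ∑ i, ∑ j, g.coef φ i j y * v i * w j := by
  conv_lhs => rw [coord_eq_sum v, coord_eq_sum w]
  simp only [map_sum, map_smul, _root_.sum_apply, _root_.smul_apply, smul_eq_mul, Finset.mul_sum]
  rw [Finset.sum_comm]
  refine Finset.sum_congr rfl fun i _ ↦ Finset.sum_congr rfl fun j _ ↦ ?_
  change w j * (v i * g.coef φ i j y) = _
  ring

lemma det_coef_ne_zero {y : Coord n} (hy : y ∈ φ.1.target) :
    (Matrix.of fun a b ↦ g.coef φ a b y).det ≠ 0 := by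
  intro hdet
  obtain ⟨v, hv, hker⟩ := Matrix.exists_mulVec_eq_zero_iff.2 hdet
  have hpush : φ.push y (WithLp.toLp 2 v) = 0 := by
    refine g.nondegenerate _ _ fun w ↦ ?_
    rw [← φ.push_pull hy w, g.symm, inner_push]
    refine Finset.sum_eq_zero fun i _ ↦ ?_
    have hi : ∑ j, g.coef φ i j y * v j = 0 := congrFun hker i
    calc _ = φ.pull (φ.1.symm y) w i * ∑ j, g.coef φ i j y * v j := by
          rw [Finset.mul_sum]
          exact Finset.sum_congr rfl fun j _ ↦ by ring
      _ = 0 := by rw [hi, mul_zero]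
  have hzero := φ.pull_push hy (WithLp.toLp 2 v)
  rw [hpush, map_zero] at hzero
  exact hv (congrArg WithLp.ofLp hzero).symm

lemma contDiffOn_inv (i j : Fin n) : ContDiffOn ℝ ∞ (g.inv φ i j) φ.1.target :=
  contDiffOn_matrix_inv (fun a b ↦ g.contDiffOn_coef φ a b) (fun _ hy ↦ g.det_coef_ne_zero φ hy) i j

lemma sum_coef_mul_inv {y : Coord n} (hy : y ∈ φ.1.target) (i j : Fin n) :
    ∑ k, g.coef φ i k y * g.inv φ k j y = if i = j then 1 else 0 := by
  have h := congrFun₂ (Matrix.mul_nonsing_inv _ (g.det_coef_ne_zero φ hy).isUnit) i j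
  rwa [Matrix.mul_apply, Matrix.one_apply] at h

lemma sum_inv_mul_coef {y : Coord n} (hy : y ∈ φ.1.target) (i j : Fin n) :
    ∑ k, g.inv φ i k y * g.coef φ k j y = if i = j then 1 else 0 := by
  have h := congrFun₂ (Matrix.nonsing_inv_mul _ (g.det_coef_ne_zero φ hy).isUnit) i j
  rwa [Matrix.mul_apply, Matrix.one_apply] at h

lemma inv_symm (i j : Fin n) (y : Coord n) : g.inv φ i j y = g.inv φ j i y := by
  have hsymm : (Matrix.of fun a b ↦ g.coef φ a b y).transpose
      = Matrix.of fun a b ↦ g.coef φ a b y :=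
    Matrix.ext fun a b ↦ congrFun (g.coef_symm φ b a) y
  have h := Matrix.transpose_nonsing_inv (Matrix.of fun a b ↦ g.coef φ a b y)
  rw [hsymm] at h
  exact congrFun₂ h j i

lemma contDiffOn_christoffel (k i j : Fin n) :
    ContDiffOn ℝ ∞ (g.christoffel φ k i j) φ.1.target := by
  have h (a i j : Fin n) := contDiffOn_pd φ.1.open_target (g.contDiffOn_coef φ i j) a
  exact contDiffOn_const.mul (ContDiffOn.sum fun l _ ↦ (g.contDiffOn_inv φ k l).mul
    (((h i j l).add (h j i l)).sub (h l i j)))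

lemma christoffel_symm (k i j : Fin n) (y : Coord n) :
    g.christoffel φ k i j y = g.christoffel φ k j i y := by
  unfold christoffel
  rw [g.coef_symm φ i j]
  congr 1
  exact Finset.sum_congr rfl fun l _ ↦ by ring

/-- The Christoffel symbols of the first kind `Γ_{b,mj} = g_{bk} Γᵏ_{mj}`. -/
def christoffelLower (b m j : Fin n) : Coord n → ℝ := fun y ↦
  ∑ k, g.coef φ b k y * g.christoffel φ k m j y

lemma contDiffOn_christoffelLower (b m j : Fin n) :
    ContDiffOn ℝ ∞ (g.christoffelLower φ b m j) φ.1.target :=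
  ContDiffOn.sum fun k _ ↦ (g.contDiffOn_coef φ b k).mul (g.contDiffOn_christoffel φ k m j)

variable {g φ} {y : Coord n}

lemma christoffelLower_eq (hy : y ∈ φ.1.target) (b m j : Fin n) :
    g.christoffelLower φ b m j y =
      1 / 2 * (pd m (g.coef φ j b) y + pd j (g.coef φ m b) y - pd b (g.coef φ m j) y) := by
  have h : g.christoffelLower φ b m j y = 1 / 2 * ∑ l,
      (∑ k, g.coef φ b k y * g.inv φ k l y) *
      (pd m (g.coef φ j l) y + pd j (g.coef φ m l) y - pd l (g.coef φ m j) y) := by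
    simp only [christoffelLower, christoffel, Finset.mul_sum, Finset.sum_mul]
    rw [Finset.sum_comm]
    exact Finset.sum_congr rfl fun l _ ↦ Finset.sum_congr rfl fun k _ ↦ by ring
  rw [h]
  simp only [g.sum_coef_mul_inv φ hy, ite_mul, one_mul, zero_mul, Finset.sum_ite_eq,
    Finset.mem_univ, if_true]

lemma pd_coef (hy : y ∈ φ.1.target) (a b j : Fin n) :
    pd j (g.coef φ a b) y = g.christoffelLower φ a b j y + g.christoffelLower φ b a j y := by
  rw [christoffelLower_eq hy, christoffelLower_eq hy, g.coef_symm φ b a, g.coef_symm φ j a,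
    g.coef_symm φ j b]
  ring

lemma coef_transition {ψ : Chart n M} (hy : y ∈ φ.overlap ψ) (a b : Fin n) :
    g.coef φ a b y = ∑ i, ∑ j, g.coef ψ i j (φ.transition ψ y) * φ.jacobian ψ y i a
      * φ.jacobian ψ y j b := by
  have h := g.inner_push ψ (φ.transition ψ y)
    (fderiv ℝ (φ.transition ψ) y (EuclideanSpace.single a 1))
    (fderiv ℝ (φ.transition ψ) y (EuclideanSpace.single b 1))
  refine Eq.trans (Eq.trans ?_ (g.inner_congr (Chart.symm_transition hy) _ _).symm) h
  exact congrArg₂ (fun v w : Coord n ↦ g.inner (φ.1.symm y) v w)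
    (Chart.push_transition hy _).symm (Chart.push_transition hy _).symm

lemma differentiableAt_coef (hy : y ∈ φ.1.target) (i j : Fin n) :
    DifferentiableAt ℝ (g.coef φ i j) y :=
  differentiableAt_of_contDiffOn φ.1.open_target (g.contDiffOn_coef φ i j) hy

lemma differentiableAt_christoffel (hy : y ∈ φ.1.target) (k i j : Fin n) :
    DifferentiableAt ℝ (g.christoffel φ k i j) y :=
  differentiableAt_of_contDiffOn φ.1.open_target (g.contDiffOn_christoffel φ k i j) hy

lemma differentiableAt_christoffelLower (hy : y ∈ φ.1.target) (b m j : Fin n) :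
    DifferentiableAt ℝ (g.christoffelLower φ b m j) y :=
  differentiableAt_of_contDiffOn φ.1.open_target (g.contDiffOn_christoffelLower φ b m j) hy

lemma differentiableAt_pd_coef (hy : y ∈ φ.1.target) (a i j : Fin n) :
    DifferentiableAt ℝ (pd a (g.coef φ i j)) y :=
  differentiableAt_of_contDiffOn φ.1.open_target
    (contDiffOn_pd φ.1.open_target (g.contDiffOn_coef φ i j) a) hy

lemma pd_pd_coef_comm (hy : y ∈ φ.1.target) (a c i k : Fin n) :
    pd a (pd c (g.coef φ i k)) y = pd c (pd a (g.coef φ i k)) y :=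
  pd_comm ((g.contDiffOn_coef φ i k).contDiffAt (φ.1.open_target.mem_nhds hy)) a c

lemma pd_christoffelLower (hy : y ∈ φ.1.target) (i b m j : Fin n) :
    pd i (g.christoffelLower φ b m j) y =
      1 / 2 * (pd i (pd m (g.coef φ j b)) y + pd i (pd j (g.coef φ m b)) y
        - pd i (pd b (g.coef φ m j)) y) := by
  have hd (a i j : Fin n) := differentiableAt_pd_coef (g := g) hy a i j
  have heq : g.christoffelLower φ b m j =ᶠ[𝓝 y] fun y ↦
      1 / 2 * (pd m (g.coef φ j b) y + pd j (g.coef φ m b) y - pd b (g.coef φ m j) y) := by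
    filter_upwards [φ.1.open_target.mem_nhds hy] with w hw using christoffelLower_eq hw b m j
  rw [pd_congr heq, pd_const_mul _ (((hd _ _ _).fun_add (hd _ _ _)).fun_sub (hd _ _ _)),
    pd_sub ((hd _ _ _).fun_add (hd _ _ _)) (hd _ _ _), pd_add (hd _ _ _) (hd _ _ _)]

lemma pd_christoffelLower_eq_sum (hy : y ∈ φ.1.target) (i b m j : Fin n) :
    pd i (g.christoffelLower φ b m j) y =
      ∑ k, (pd i (g.coef φ b k) y * g.christoffel φ k m j y
        + g.coef φ b k y * pd i (g.christoffel φ k m j) y) := by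
  unfold christoffelLower
  rw [pd_sum _ fun k ↦
    (differentiableAt_coef hy b k).fun_mul (differentiableAt_christoffel hy k m j)]
  exact Finset.sum_congr rfl fun k _ ↦
    pd_mul (differentiableAt_coef hy b k) (differentiableAt_christoffel hy k m j) i

end PseudoRiemannianMetric

/-! ### Conformal vector fields and the Levi-Civita connection -/

section ConformalFactor

section Pointwise

open Matrix

variable {ι : Type*} [Fintype ι]

/- `G` stands for `g_{ab}`, `Γ j` for the matrix `(Γᵏ_{mj})_{k,m}`, `x` for the components of `X`
and `Y` for `∂_{[m} X_{k]}`; `dG j`, `dΓ j`, `dA`, `dY` and `dx` are their `j`-th derivatives. -/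
lemma curvature_identity {G A Y dA dY : Matrix ι ι ℝ} {Γ dG : ι → Matrix ι ι ℝ}
    {dΓ : ι → ι → Matrix ι ι ℝ} {x dx : ι → ℝ} (j : ι) (hG : Gᵀ = G) (hY : Yᵀ = -Y)
    (hdG : ∀ i, dG i = G * Γ i + (G * Γ i)ᵀ)
    (hA : G * A = Y - ∑ i, x i • (G * Γ i))
    (hdA : dG j * A + G * dA
      = dY - ∑ i, (dx i • (G * Γ i) + x i • (dG j * Γ i + G * dΓ j i))) :
    Aᵀ * (G * Γ j) + ∑ i, x i • (dG i * Γ j + G * dΓ i j) + G * Γ j * A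
        + ∑ i, dx i • (G * Γ i) + G * dA
      = dY - (Γ j)ᵀ * Y - Y * Γ j
        - ∑ i, x i • (G * (dΓ j i - dΓ i j + Γ j * Γ i - Γ i * Γ j)) := by
  classical
  have transpose_A_mul : Aᵀ * (G * Γ j) = -(Y * Γ j) - ∑ i, x i • ((Γ i)ᵀ * (G * Γ j)) := by
    have h : Aᵀ * G = -Y - ∑ i, x i • ((Γ i)ᵀ * G) := by
      simpa [transpose_mul, hG, hY, transpose_sum] using congrArg transpose hA
    rw [← Matrix.mul_assoc, h, Matrix.sub_mul, Matrix.neg_mul, Finset.sum_mul]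
    simp only [Matrix.smul_mul, Matrix.mul_assoc]
  have G_mul_dA : G * dA = dY - ∑ i, (dx i • (G * Γ i) + x i • (dG j * Γ i + G * dΓ j i))
      - G * Γ j * A - ((Γ j)ᵀ * Y - ∑ i, x i • ((Γ j)ᵀ * (G * Γ i))) := by
    have h : (Γ j)ᵀ * G * A = (Γ j)ᵀ * Y - ∑ i, x i • ((Γ j)ᵀ * (G * Γ i)) := by
      rw [Matrix.mul_assoc, hA, Matrix.mul_sub, Finset.mul_sum]
      simp only [Matrix.mul_smul]
    rw [← h, ← hdA, hdG j, transpose_mul, hG]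
    noncomm_ring
  have coefficient_of_x : ∑ i, x i • ((G * Γ i + (Γ i)ᵀ * G) * Γ j + G * dΓ i j)
      - ∑ i, x i • ((Γ i)ᵀ * (G * Γ j))
      - ∑ i, x i • ((G * Γ j + (Γ j)ᵀ * G) * Γ i + G * dΓ j i)
      + ∑ i, x i • ((Γ j)ᵀ * (G * Γ i))
      + ∑ i, x i • (G * (dΓ j i - dΓ i j + Γ j * Γ i - Γ i * Γ j)) = 0 := by
    simp only [← Finset.sum_sub_distrib, ← Finset.sum_add_distrib, ← smul_sub, ← smul_add]
    refine Finset.sum_eq_zero fun i _ ↦ ?_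
    convert smul_zero (x i)
    noncomm_ring
  rw [transpose_A_mul, G_mul_dA, ← sub_eq_zero, Finset.sum_add_distrib]
  simp only [hdG, transpose_mul, hG]
  rw [← coefficient_of_x]
  abel

/- `G`, `D` and `DD` stand for `g` and its first and second derivatives, `x`, `E` and `EE` for the
components of `X` and theirs, `L` and `dL` for the conformal factor and its derivative. The Lie
derivative of the Christoffel symbols of the first kind is the combination of three copies of the
derivative `h` of the conformal Killing equation that expresses `Γ_{b,mj}` by `∂g`. -/
lemma conformal_variation [DecidableEq ι] {G : ι → ι → ℝ} {D : ι → ι → ι → ℝ}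
    {DD : ι → ι → ι → ι → ℝ} {x : ι → ℝ} {E : ι → ι → ℝ} {EE : ι → ι → ι → ℝ} {L : ℝ} {dL : ι → ℝ}
    (hG : ∀ i k, G i k = G k i) (hEE : ∀ a m k, EE a m k = EE m a k)
    (hDD : ∀ a c i k, DD a c i k = DD c a i k)
    (h : ∀ a i k, ∑ c, (E a c * D c i k + x c * DD a c i k + D a c k * E i c + G c k * EE a i c
      + D a i c * E k c + G i c * EE a k c) = dL a * G i k + L * D a i k) (j b m : ι) :
    ∑ k, (E b k - if k = b then 1 / 2 * L else 0) * (1 / 2 * (D m j k + D j m k - D k m j))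
      + ∑ i, x i * (1 / 2 * (DD i m j b + DD i j m b - DD i b m j))
      + ∑ k, 1 / 2 * (D k j b + D j k b - D b k j) * (E m k - if k = m then 1 / 2 * L else 0)
      + ∑ i, E j i * (1 / 2 * (D m i b + D i m b - D b m i))
      + ∑ k, G b k * (EE j m k - if k = m then 1 / 2 * dL j else 0)
      = 1 / 2 * (G b j * dL m - G m j * dL b) := by
  have three_copies : ∑ c, (E b c * (1 / 2 * (D m j c + D j m c - D c m j))
      + x c * (1 / 2 * (DD c m j b + DD c j m b - DD c b m j))
      + 1 / 2 * (D c j b + D j c b - D b c j) * E m c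
      + E j c * (1 / 2 * (D m c b + D c m b - D b m c)) + G b c * EE j m c)
      = 1 / 2 * ((dL m * G j b + L * D m j b) + (dL j * G m b + L * D j m b)
        - (dL b * G m j + L * D b m j)) := by
    rw [← h m j b, ← h j m b, ← h b m j, ← Finset.sum_add_distrib, ← Finset.sum_sub_distrib,
      Finset.mul_sum]
    refine Finset.sum_congr rfl fun c _ ↦ ?_
    rw [hEE m j c, hEE b m c, hEE b j c, hG c b, hG c j, hDD m c j b, hDD j c m b, hDD b c m j]
    ring
  simp only [Finset.sum_add_distrib] at three_copies
  simp only [sub_mul, mul_sub (_ : ℝ) (E _ _), mul_sub (_ : ℝ) (EE _ _ _), ite_mul, mul_ite,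
    zero_mul, mul_zero, Finset.sum_sub_distrib, Finset.sum_ite_eq', Finset.mem_univ, if_true]
  rw [hG j b] at three_copies
  rw [hG b m]
  linear_combination three_copies

end Pointwise

/-- The matrix `∂ₘ Xᵏ - ½ lam δᵏₘ` of the infinitesimal action on the `ξᵏ` of the lift of a
conformal vector field with `L_X g = lam g`. -/
def confMatrix (φ : Chart n M) (X : VField n M) (lam : M → ℝ) (k m : Fin n) : Coord n → ℝ := fun y ↦
  pd m (vcomp X φ k) y - if k = m then 1 / 2 * lam (φ.1.symm y) else 0

lemma differentiableAt_scalar {φ : Chart n M} {lam : M → ℝ} {y : Coord n}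
    (hlam : ContMDiff (𝓡 n) 𝓘(ℝ, ℝ) ∞ lam) (hy : y ∈ φ.1.target) :
    DifferentiableAt ℝ (fun y ↦ lam (φ.1.symm y)) y :=
  differentiableAt_of_contDiffOn φ.1.open_target (φ.contDiffOn_scalar hlam) hy

variable [IsManifold (𝓡 n) ∞ M]

section Smoothness

variable {φ : Chart n M} {X : VField n M} {lam : M → ℝ} {y : Coord n}

lemma differentiableAt_vcomp (hX : IsSmooth X) (hy : y ∈ φ.1.target) (i : Fin n) :
    DifferentiableAt ℝ (vcomp X φ i) y :=
  differentiableAt_of_contDiffOn φ.1.open_target (contDiffOn_vcomp hX φ i) hy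

lemma differentiableAt_pd_vcomp (hX : IsSmooth X) (hy : y ∈ φ.1.target) (a i : Fin n) :
    DifferentiableAt ℝ (pd a (vcomp X φ i)) y :=
  differentiableAt_of_contDiffOn φ.1.open_target
    (contDiffOn_pd φ.1.open_target (contDiffOn_vcomp hX φ i) a) hy

lemma pd_pd_vcomp_comm (hX : IsSmooth X) (hy : y ∈ φ.1.target) (a c k : Fin n) :
    pd a (pd c (vcomp X φ k)) y = pd c (pd a (vcomp X φ k)) y :=
  pd_comm ((contDiffOn_vcomp hX φ k).contDiffAt (φ.1.open_target.mem_nhds hy)) a c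

lemma contDiffOn_confMatrix (hX : IsSmooth X) (hlam : ContMDiff (𝓡 n) 𝓘(ℝ, ℝ) ∞ lam)
    (k m : Fin n) : ContDiffOn ℝ ∞ (confMatrix φ X lam k m) φ.1.target := by
  refine (contDiffOn_pd φ.1.open_target (contDiffOn_vcomp hX φ k) m).sub ?_
  split_ifs
  · exact contDiffOn_const.mul (φ.contDiffOn_scalar hlam)
  · exact contDiffOn_const

lemma differentiableAt_confMatrix (hX : IsSmooth X) (hlam : ContMDiff (𝓡 n) 𝓘(ℝ, ℝ) ∞ lam)
    (hy : y ∈ φ.1.target) (k m : Fin n) : DifferentiableAt ℝ (confMatrix φ X lam k m) y :=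
  differentiableAt_of_contDiffOn φ.1.open_target (contDiffOn_confMatrix hX hlam k m) hy

lemma pd_confMatrix (hX : IsSmooth X) (hlam : ContMDiff (𝓡 n) 𝓘(ℝ, ℝ) ∞ lam)
    (hy : y ∈ φ.1.target) (j k m : Fin n) :
    pd j (confMatrix φ X lam k m) y = pd j (pd m (vcomp X φ k)) y
      - if k = m then 1 / 2 * pd j (fun y ↦ lam (φ.1.symm y)) y else 0 := by
  unfold confMatrix
  split_ifs
  · rw [pd_sub (differentiableAt_pd_vcomp hX hy m k)
      ((differentiableAt_const _).fun_mul (differentiableAt_scalar hlam hy)),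
      pd_const_mul _ (differentiableAt_scalar hlam hy)]
  · simp only [sub_zero]

end Smoothness

namespace PseudoRiemannianMetric

variable {g : PseudoRiemannianMetric n M} {φ : Chart n M} {X : VField n M} {lam : M → ℝ}
  {y : Coord n}

/-- The vector field `X` is smooth and conformal with the smooth factor `lam`: `L_X g = lam g`. -/
structure IsConformalFactor (g : PseudoRiemannianMetric n M) (X : VField n M) (lam : M → ℝ) :
    Prop where
  smooth : IsSmooth X
  smooth_factor : ContMDiff (𝓡 n) 𝓘(ℝ, ℝ) ∞ lam
  lieCoef_eq : ∀ (φ : Chart n M) (i j : Fin n), ∀ y ∈ φ.1.target,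
    g.lieCoef φ X i j y = lam (φ.1.symm y) * g.coef φ i j y

lemma mem_conf_iff : X ∈ g.conf ↔ ∃ lam, g.IsConformalFactor X lam :=
  ⟨fun ⟨hX, lam, hlam, h⟩ ↦ ⟨lam, hX, hlam, h⟩,
    fun ⟨lam, h⟩ ↦ ⟨h.smooth, lam, h.smooth_factor, h.lieCoef_eq⟩⟩

lemma rot_antisymm (g : PseudoRiemannianMetric n M) (φ : Chart n M) (X : VField n M)
    (y : Coord n) (i j : Fin n) : g.rot φ X j i y = -g.rot φ X i j y := by
  rw [rot, rot]
  ring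

lemma pd_lower (hX : IsSmooth X) (hy : y ∈ φ.1.target) (a m : Fin n) :
    pd m (g.lower φ X a) y =
      ∑ k, (pd m (g.coef φ a k) y * vcomp X φ k y + g.coef φ a k y * pd m (vcomp X φ k) y) := by
  unfold lower
  rw [pd_sum _ fun k ↦ (differentiableAt_coef hy a k).fun_mul (differentiableAt_vcomp hX hy k)]
  exact Finset.sum_congr rfl fun k _ ↦
    pd_mul (differentiableAt_coef hy a k) (differentiableAt_vcomp hX hy k) m

lemma contDiffOn_rot (hX : IsSmooth X) (i j : Fin n) :
    ContDiffOn ℝ ∞ (g.rot φ X i j) φ.1.target := by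
  have h (i j : Fin n) : ContDiffOn ℝ ∞ (pd i (g.lower φ X j)) φ.1.target :=
    contDiffOn_pd φ.1.open_target (ContDiffOn.sum fun k _ ↦
      (g.contDiffOn_coef φ j k).mul (contDiffOn_vcomp hX φ k)) i
  exact contDiffOn_const.mul ((h j i).sub (h i j))

lemma differentiableAt_rot (hX : IsSmooth X) (hy : y ∈ φ.1.target) (i j : Fin n) :
    DifferentiableAt ℝ (g.rot φ X i j) y :=
  differentiableAt_of_contDiffOn φ.1.open_target (contDiffOn_rot hX i j) hy

lemma riemann_eq (g : PseudoRiemannianMetric n M) (φ : Chart n M) (y : Coord n)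
    (c a i j : Fin n) :
    g.riemann φ c a i j y =
      pd i (g.christoffel φ c a j) y - pd j (g.christoffel φ c a i) y
      + ∑ k, g.christoffel φ c k i y * g.christoffel φ k a j y
      - ∑ k, g.christoffel φ c k j y * g.christoffel φ k a i y := by
  rw [riemann, Finset.sum_sub_distrib, add_sub_assoc]
  simp only [g.christoffel_symm φ c]

lemma nablaRot_eq (g : PseudoRiemannianMetric n M) (φ : Chart n M) (X : VField n M) (y : Coord n)
    (j b m : Fin n) :
    g.nablaRot φ X j b m y = pd j (g.rot φ X b m) y
      - ∑ a, g.christoffel φ a b j y * g.rot φ X a m y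
      - ∑ a, g.rot φ X b a y * g.christoffel φ a m j y := by
  simp only [nablaRot, Finset.sum_add_distrib, sub_sub, g.christoffel_symm φ _ j,
    mul_comm (g.rot φ X b _ y)]

/-- The coefficients of the Lie derivative of `g_{bk} Γᵏ_{mj} ξᵇ ξᵐ dxʲ + g_{bk} ξᵇ dξᵏ`, when the
`ξᵏ` transform by `confMatrix`. -/
def lieChristoffel (g : PseudoRiemannianMetric n M) (φ : Chart n M) (X : VField n M) (lam : M → ℝ)
    (j b m : Fin n) : Coord n → ℝ := fun y ↦
  ∑ k, confMatrix φ X lam k b y * g.christoffelLower φ k m j y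
    + ∑ i, vcomp X φ i y * pd i (g.christoffelLower φ b m j) y
    + ∑ k, g.christoffelLower φ b k j y * confMatrix φ X lam k m y
    + ∑ i, pd j (vcomp X φ i) y * g.christoffelLower φ b m i y
    + ∑ k, g.coef φ b k y * pd j (confMatrix φ X lam k m) y

namespace IsConformalFactor

lemma differentiableAt_confMatrix (h : g.IsConformalFactor X lam) (hy : y ∈ φ.1.target)
    (k m : Fin n) : DifferentiableAt ℝ (confMatrix φ X lam k m) y :=
  Supercotangent.differentiableAt_confMatrix h.smooth h.smooth_factor hy k m

lemma pd_conformal_killing (h : g.IsConformalFactor X lam) (hy : y ∈ φ.1.target)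
    (a i k : Fin n) :
    ∑ c, (pd a (vcomp X φ c) y * pd c (g.coef φ i k) y
      + vcomp X φ c y * pd a (pd c (g.coef φ i k)) y
      + pd a (g.coef φ c k) y * pd i (vcomp X φ c) y
      + g.coef φ c k y * pd a (pd i (vcomp X φ c)) y
      + pd a (g.coef φ i c) y * pd k (vcomp X φ c) y
      + g.coef φ i c y * pd a (pd k (vcomp X φ c)) y)
      = pd a (fun y ↦ lam (φ.1.symm y)) y * g.coef φ i k y
        + lam (φ.1.symm y) * pd a (g.coef φ i k) y := by
  have hg (i j : Fin n) := differentiableAt_coef (g := g) hy i j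
  have hdg (a i j : Fin n) := differentiableAt_pd_coef (g := g) hy a i j
  have hX (i : Fin n) := differentiableAt_vcomp h.smooth hy i
  have hdX (a i : Fin n) := differentiableAt_pd_vcomp h.smooth hy a i
  have killing : g.lieCoef φ X i k =ᶠ[𝓝 y] fun w ↦ lam (φ.1.symm w) * g.coef φ i k w := by
    filter_upwards [φ.1.open_target.mem_nhds hy] with w hw using h.lieCoef_eq φ i k w hw
  rw [← pd_mul (differentiableAt_scalar h.smooth_factor hy) (hg i k), ← pd_congr killing]
  unfold lieCoef
  rw [pd_sum _ fun c ↦ (((hX c).fun_mul (hdg c i k)).fun_add ((hg c k).fun_mul (hdX i c))).fun_add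
    ((hg i c).fun_mul (hdX k c))]
  refine Finset.sum_congr rfl fun c _ ↦ ?_
  rw [pd_add (((hX c).fun_mul (hdg c i k)).fun_add ((hg c k).fun_mul (hdX i c)))
    ((hg i c).fun_mul (hdX k c)), pd_add ((hX c).fun_mul (hdg c i k)) ((hg c k).fun_mul (hdX i c)),
    pd_mul (hX c) (hdg c i k), pd_mul (hg c k) (hdX i c), pd_mul (hg i c) (hdX k c)]
  ring

lemma lieChristoffel_eq (h : g.IsConformalFactor X lam) (hy : y ∈ φ.1.target) (j b m : Fin n) :
    g.lieChristoffel φ X lam j b m y =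
      1 / 2 * (g.coef φ b j y * pd m (fun y ↦ lam (φ.1.symm y)) y
        - g.coef φ m j y * pd b (fun y ↦ lam (φ.1.symm y)) y) := by
  have variation := conformal_variation (G := fun i k ↦ g.coef φ i k y)
    (D := fun a i k ↦ pd a (g.coef φ i k) y) (DD := fun a c i k ↦ pd a (pd c (g.coef φ i k)) y)
    (x := fun i ↦ vcomp X φ i y) (E := fun a i ↦ pd a (vcomp X φ i) y)
    (EE := fun a c i ↦ pd a (pd c (vcomp X φ i)) y) (L := lam (φ.1.symm y))
    (dL := fun a ↦ pd a (fun y ↦ lam (φ.1.symm y)) y)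
    (fun i k ↦ congrFun (g.coef_symm φ i k) y) (fun a m k ↦ pd_pd_vcomp_comm h.smooth hy a m k)
    (fun a c i k ↦ pd_pd_coef_comm hy a c i k) (fun a i k ↦ h.pd_conformal_killing hy a i k) j b m
  rw [← variation]
  simp only [lieChristoffel, christoffelLower_eq hy, pd_christoffelLower hy,
    pd_confMatrix h.smooth h.smooth_factor hy, confMatrix]

lemma sum_coef_mul_confMatrix (h : g.IsConformalFactor X lam) (hy : y ∈ φ.1.target)
    (a m : Fin n) :
    ∑ k, g.coef φ a k y * confMatrix φ X lam k m y =
      g.rot φ X a m y - ∑ i, vcomp X φ i y * g.christoffelLower φ a m i y := by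
  have split_trace : ∑ k, g.coef φ a k y * confMatrix φ X lam k m y =
      ∑ k, g.coef φ a k y * pd m (vcomp X φ k) y
        - g.coef φ a m y * (1 / 2 * lam (φ.1.symm y)) := by
    simp only [confMatrix, mul_sub, mul_ite, mul_zero, Finset.sum_sub_distrib, Finset.sum_ite_eq',
      Finset.mem_univ, if_true]
  have split_symmetric : ∑ k, g.coef φ a k y * pd m (vcomp X φ k) y =
      g.rot φ X a m y - ∑ i, vcomp X φ i y * g.christoffelLower φ a m i y
        + 1 / 2 * g.lieCoef φ X a m y := by
    simp only [christoffelLower_eq hy]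
    rw [rot, pd_lower h.smooth hy, pd_lower h.smooth hy, lieCoef, ← Finset.sum_sub_distrib,
      Finset.mul_sum, Finset.mul_sum, ← Finset.sum_sub_distrib, ← Finset.sum_add_distrib]
    refine Finset.sum_congr rfl fun k _ ↦ ?_
    rw [g.coef_symm φ k a, g.coef_symm φ k m, g.coef_symm φ m a]
    ring
  rw [split_trace, split_symmetric, h.lieCoef_eq φ a m y hy]
  ring

lemma pd_sum_coef_mul_confMatrix (h : g.IsConformalFactor X lam) (hy : y ∈ φ.1.target)
    (j a m : Fin n) :
    ∑ k, (pd j (g.coef φ a k) y * confMatrix φ X lam k m y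
        + g.coef φ a k y * pd j (confMatrix φ X lam k m) y) =
      pd j (g.rot φ X a m) y - ∑ i, (pd j (vcomp X φ i) y * g.christoffelLower φ a m i y
        + vcomp X φ i y * pd j (g.christoffelLower φ a m i) y) := by
  have hg (k : Fin n) := differentiableAt_coef (g := g) hy a k
  have hA (k : Fin n) := h.differentiableAt_confMatrix hy k m
  have hX (i : Fin n) := differentiableAt_vcomp h.smooth hy i
  have hΓ (i : Fin n) := differentiableAt_christoffelLower (g := g) hy a m i
  have heq : (fun w ↦ ∑ k, g.coef φ a k w * confMatrix φ X lam k m w) =ᶠ[𝓝 y] fun w ↦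
      g.rot φ X a m w - ∑ i, vcomp X φ i w * g.christoffelLower φ a m i w := by
    filter_upwards [φ.1.open_target.mem_nhds hy] with w hw using h.sum_coef_mul_confMatrix hw a m
  simp only [← pd_mul (hg _) (hA _), ← pd_mul (hX _) (hΓ _)]
  rw [← pd_sum _ fun k ↦ (hg k).fun_mul (hA k), ← pd_sum _ fun i ↦ (hX i).fun_mul (hΓ i),
    ← pd_sub (differentiableAt_rot h.smooth hy a m)
      (DifferentiableAt.fun_sum fun i _ ↦ (hX i).fun_mul (hΓ i)), pd_congr heq]

lemma lieChristoffel_eq_curvature (h : g.IsConformalFactor X lam) (hy : y ∈ φ.1.target)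
    (j b m : Fin n) :
    g.lieChristoffel φ X lam j b m y = g.nablaRot φ X j b m y
      - ∑ i, vcomp X φ i y * ∑ k, g.coef φ b k y * g.riemann φ k m j i y := by
  have identity := curvature_identity (ι := Fin n)
    (G := Matrix.of fun a b ↦ g.coef φ a b y)
    (A := Matrix.of fun a b ↦ confMatrix φ X lam a b y)
    (Y := Matrix.of fun a b ↦ g.rot φ X a b y)
    (dA := Matrix.of fun a b ↦ pd j (confMatrix φ X lam a b) y)
    (dY := Matrix.of fun a b ↦ pd j (g.rot φ X a b) y)
    (Γ := fun j ↦ Matrix.of fun k m ↦ g.christoffel φ k m j y)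
    (dG := fun j ↦ Matrix.of fun a b ↦ pd j (g.coef φ a b) y)
    (dΓ := fun i j ↦ Matrix.of fun k m ↦ pd i (g.christoffel φ k m j) y)
    (x := fun i ↦ vcomp X φ i y) (dx := fun i ↦ pd j (vcomp X φ i) y) j
    (Matrix.ext fun a b ↦ congrFun (g.coef_symm φ b a) y)
    (Matrix.ext fun a b ↦ g.rot_antisymm φ X y a b)
    (fun i ↦ Matrix.ext fun a b ↦ pd_coef hy a b i)
    (Matrix.ext fun a b ↦ by
      simpa [Matrix.mul_apply, Matrix.sum_apply, christoffelLower] using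
        h.sum_coef_mul_confMatrix hy a b)
    (Matrix.ext fun a b ↦ by
      have hd := h.pd_sum_coef_mul_confMatrix hy j a b
      simp only [pd_christoffelLower_eq_sum hy, christoffelLower] at hd
      simpa [Matrix.mul_apply, Matrix.sum_apply, Finset.sum_add_distrib, mul_add] using hd)
  have entry := congrFun₂ identity b m
  simp only [Matrix.add_apply, Matrix.sub_apply, Matrix.mul_apply, Matrix.sum_apply,
    Matrix.smul_apply, Matrix.transpose_apply, Matrix.of_apply, smul_eq_mul] at entry
  simp only [lieChristoffel, pd_christoffelLower_eq_sum hy, christoffelLower,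
    Finset.sum_add_distrib, nablaRot_eq, riemann_eq]
  simpa only [Finset.sum_add_distrib] using entry

end IsConformalFactor

end PseudoRiemannianMetric

end ConformalFactor

/-! ### Lie derivatives of `α` and `β` along lifts -/

section LinearQuadratic

/-- The linear element `∑ uₘ ξᵐ` of the Grassmann algebra. -/
def linear (u : Fin n → ℝ) : Grassmann n := ∑ m, real (u m) * xi m

/-- The quadratic element `∑ f_{bm} ξᵇ ξᵐ` of the Grassmann algebra. -/
def quadratic (f : Fin n → Fin n → ℝ) : Grassmann n := ∑ b, ∑ m, real (f b m) * (xi b * xi m)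

lemma linear_add (u v : Fin n → ℝ) : linear (fun m ↦ u m + v m) = linear u + linear v := by
  simp only [linear, real_add, add_mul, Finset.sum_add_distrib]

lemma linear_sub (u v : Fin n → ℝ) : linear (fun m ↦ u m - v m) = linear u - linear v := by
  simp only [linear, real_sub, sub_mul, Finset.sum_sub_distrib]

lemma linear_zero : linear (fun _ ↦ 0 : Fin n → ℝ) = 0 := by
  simp [linear, real_zero]

lemma linear_mul (a : ℝ) (u : Fin n → ℝ) : linear (fun m ↦ a * u m) = real a * linear u := by
  simp only [linear, real_mul, Finset.mul_sum, mul_assoc]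

lemma linear_sum {ι : Type*} (s : Finset ι) (u : ι → Fin n → ℝ) :
    linear (fun m ↦ ∑ k ∈ s, u k m) = ∑ k ∈ s, linear (u k) := by
  simp only [linear, real_sum, Finset.sum_mul]
  exact Finset.sum_comm

lemma sum_real_mul_linear {ι : Type*} (s : Finset ι) (a : ι → ℝ) (A : ι → Fin n → ℝ) :
    ∑ k ∈ s, real (a k) * linear (A k) = linear (fun m ↦ ∑ k ∈ s, a k * A k m) := by
  simp only [linear_sum, linear_mul]

lemma leftDeriv_linear (j : Fin n) (u : Fin n → ℝ) : leftDeriv j (linear u) = real (u j) := by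
  simp [linear, leftDeriv_real_mul, leftDeriv_xi]

lemma linear_mem_parity (u : Fin n → ℝ) : linear u ∈ parity n 1 := by
  refine Submodule.sum_mem _ fun m _ ↦ ?_
  rw [real_mul_eq_smul]
  exact Submodule.smul_mem _ _ (xi_mem_parity m)

lemma linear_mul_linear_mem_parity (u v : Fin n → ℝ) : linear u * linear v ∈ parity n 0 := by
  have h := mul_mem_parity (linear_mem_parity u) (linear_mem_parity v)
  rwa [CharTwo.add_self_eq_zero] at h

lemma linear_anticomm (u v : Fin n → ℝ) : linear u * linear v = -(linear v * linear u) := by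
  rw [odd_mul (linear_mem_parity u), grade_odd (linear_mem_parity v), neg_mul]

lemma quadratic_add (f f' : Fin n → Fin n → ℝ) :
    quadratic (fun b m ↦ f b m + f' b m) = quadratic f + quadratic f' := by
  simp only [quadratic, real_add, add_mul, Finset.sum_add_distrib]

lemma quadratic_sum {ι : Type*} (s : Finset ι) (f : ι → Fin n → Fin n → ℝ) :
    quadratic (fun b m ↦ ∑ i ∈ s, f i b m) = ∑ i ∈ s, quadratic (f i) := by
  simp only [quadratic, real_sum, Finset.sum_mul]
  rw [Finset.sum_comm (s := s)]
  exact Finset.sum_congr rfl fun b _ ↦ Finset.sum_comm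

lemma quadratic_mul (r : ℝ) (f : Fin n → Fin n → ℝ) :
    quadratic (fun b m ↦ r * f b m) = real r * quadratic f := by
  simp only [quadratic, real_mul, Finset.mul_sum, mul_assoc]

lemma linear_mul_linear (u v : Fin n → ℝ) :
    linear u * linear v = quadratic (fun b m ↦ u b * v m) := by
  rw [linear, linear, quadratic, Finset.sum_mul_sum]
  refine Finset.sum_congr rfl fun b _ ↦ Finset.sum_congr rfl fun m _ ↦ ?_
  rw [real_mul, mul_assoc, ← mul_assoc (xi b), real_comm]
  simp only [mul_assoc]

lemma quadratic_half_antisymm (u v : Fin n → ℝ) :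
    quadratic (fun b m ↦ 1 / 2 * (u b * v m - u m * v b)) = linear u * linear v := by
  have h : quadratic (fun b m ↦ 1 / 2 * (u b * v m - u m * v b))
      + real (1 / 2) * (linear v * linear u) = real (1 / 2) * (linear u * linear v) := by
    simp only [linear_mul_linear, ← quadratic_mul, ← quadratic_add]
    congr
    funext b m
    ring
  rw [eq_sub_of_add_eq h, linear_anticomm v u, mul_neg, sub_neg_eq_add, ← add_mul, ← real_add,
    add_halves, real_one, one_mul]

lemma quadratic_eq_sum_mul (f : Fin n → Fin n → ℝ) :
    quadratic f = ∑ b, xi b * linear (f b) := by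
  simp only [quadratic, linear, Finset.mul_sum, ← mul_assoc, real_comm]

lemma quadratic_eq_sum_linear_mul (f : Fin n → Fin n → ℝ) :
    quadratic f = ∑ m, linear (fun b ↦ f b m) * xi m := by
  simp only [quadratic, linear, Finset.sum_mul, mul_assoc]
  exact Finset.sum_comm

lemma sum_real_mul_linear_mul_xi (A f : Fin n → Fin n → ℝ) :
    ∑ b, ∑ m, real (f b m) * (linear (A b) * xi m + xi b * linear (A m)) =
      quadratic (fun b m ↦ ∑ k, A k b * f k m + ∑ k, f b k * A k m) := by
  simp only [quadratic_add, mul_add, Finset.sum_add_distrib]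
  congr 1
  · rw [Finset.sum_comm, quadratic_eq_sum_linear_mul]
    simp only [mul_comm (A _ _), ← sum_real_mul_linear, Finset.sum_mul, mul_assoc]
  · rw [quadratic_eq_sum_mul]
    simp only [← sum_real_mul_linear, Finset.mul_sum, ← mul_assoc, real_comm]

end LinearQuadratic

section BaseFunctions

variable {h : Coord n → ℝ} {u : Fin n → Coord n → ℝ} {f : Fin n → Fin n → Coord n → ℝ}
  {F G : SFun n} {z : Coord n × Coord n}

lemma differentiableAt_real_fst (hh : DifferentiableAt ℝ h z.1) :
    DifferentiableAt ℝ (fun z : Coord n × Coord n ↦ (real (h z.1) : Grassmann n)) z :=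
  differentiableAt_real (hh.comp z differentiableAt_fst)

lemma differentiableAt_real_snd (i : Fin n) (z : Coord n × Coord n) :
    DifferentiableAt ℝ (fun z : Coord n × Coord n ↦ (real (z.2 i) : Grassmann n)) z :=
  differentiableAt_real
    ((EuclideanSpace.proj (𝕜 := ℝ) i).differentiableAt.comp z differentiableAt_snd)

lemma differentiableAt_linear (hu : ∀ m, DifferentiableAt ℝ (u m) z.1) :
    DifferentiableAt ℝ (fun z : Coord n × Coord n ↦ linear fun m ↦ u m z.1) z :=
  DifferentiableAt.fun_sum fun m _ ↦
    differentiableAt_grassmann_mul (differentiableAt_real_fst (hu m)) (differentiableAt_const _)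

lemma differentiableAt_quadratic (hf : ∀ b m, DifferentiableAt ℝ (f b m) z.1) :
    DifferentiableAt ℝ (fun z : Coord n × Coord n ↦ quadratic fun b m ↦ f b m z.1) z :=
  DifferentiableAt.fun_sum fun b _ ↦ DifferentiableAt.fun_sum fun m _ ↦
    differentiableAt_grassmann_mul (differentiableAt_real_fst (hf b m)) (differentiableAt_const _)

lemma dX_congr (h : F =ᶠ[𝓝 z] G) (i : Fin n) : dX i F z = dX i G z :=
  partialDeriv_congr h (.inl i)

lemma dP_congr (h : F =ᶠ[𝓝 z] G) (i : Fin n) : dP i F z = dP i G z :=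
  partialDeriv_congr h (.inr (.inl i))

lemma fderiv_real_fst (hh : DifferentiableAt ℝ h z.1) (v : Coord n × Coord n) :
    fderiv ℝ (fun z : Coord n × Coord n ↦ (real (h z.1) : Grassmann n)) z v
      = real (fderiv ℝ h z.1 v.1) := by
  have hcomp : HasFDerivAt (fun z : Coord n × Coord n ↦ h z.1) _ z :=
    hh.hasFDerivAt.comp z hasFDerivAt_fst
  rw [fderiv_real hcomp.differentiableAt, hcomp.fderiv]
  rfl

lemma fderiv_linear (hu : ∀ m, DifferentiableAt ℝ (u m) z.1) (v : Coord n × Coord n) :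
    fderiv ℝ (fun z : Coord n × Coord n ↦ linear fun m ↦ u m z.1) z v
      = linear fun m ↦ fderiv ℝ (u m) z.1 v.1 := by
  unfold linear
  rw [fderiv_fun_sum fun m _ ↦ differentiableAt_grassmann_mul (differentiableAt_real_fst (hu m))
    (differentiableAt_const _), _root_.sum_apply]
  refine Finset.sum_congr rfl fun m _ ↦ ?_
  rw [fderiv_grassmann_mul (differentiableAt_real_fst (hu m)) (differentiableAt_const _),
    fderiv_real_fst (hu m)]
  simp

lemma dX_real (hh : DifferentiableAt ℝ h z.1) (i : Fin n) :
    dX i (fun z ↦ real (h z.1)) z = real (pd i h z.1) :=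
  fderiv_real_fst hh _

lemma dP_real (hh : DifferentiableAt ℝ h z.1) (i : Fin n) :
    dP i (fun z ↦ real (h z.1)) z = 0 := by
  rw [dP, fderiv_real_fst hh, map_zero, real_zero]

lemma dX_linear (hu : ∀ m, DifferentiableAt ℝ (u m) z.1) (j : Fin n) :
    dX j (fun z ↦ linear fun m ↦ u m z.1) z = linear fun m ↦ pd j (u m) z.1 :=
  fderiv_linear hu _

lemma dP_linear (hu : ∀ m, DifferentiableAt ℝ (u m) z.1) (j : Fin n) :
    dP j (fun z ↦ linear fun m ↦ u m z.1) z = 0 := by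
  rw [dP, fderiv_linear hu]
  simp only [map_zero, linear_zero]

end BaseFunctions

namespace LocalField

variable {V : LocalField n} {z : Coord n × Coord n} {x : Fin n → ℝ}

lemma apply_const (a : Grassmann n) :
    V.apply (fun _ ↦ a) z = ∑ i, V.xi i z * leftDeriv i a := by
  simp [apply, dX, dP, dXi_apply]

lemma apply_xi (i : Fin n) : V.apply (fun _ ↦ Supercotangent.xi i) z = V.xi i z := by
  simp [apply_const, leftDeriv_xi]

lemma apply_real_snd (i : Fin n) : V.apply (fun z ↦ real (z.2 i)) z = V.p i z := by
  have hproj : HasFDerivAt (fun z : Coord n × Coord n ↦ z.2 i) _ z :=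
    (EuclideanSpace.proj (𝕜 := ℝ) i).hasFDerivAt.comp z hasFDerivAt_snd
  have hX (j : Fin n) : dX j (fun z ↦ (real (z.2 i) : Grassmann n)) z = 0 := by
    rw [dX, fderiv_real hproj.differentiableAt, hproj.fderiv]
    simp [real_zero]
  have hP (j : Fin n) : dP j (fun z ↦ (real (z.2 i) : Grassmann n)) z = if i = j then 1 else 0 := by
    rw [dP, fderiv_real hproj.differentiableAt, hproj.fderiv]
    by_cases h : i = j <;> simp [h, real_zero, real_one]
  simp [apply, hX, hP, dXi_apply, leftDeriv_real]

lemma apply_real (hx : ∀ i, V.x i z = real (x i)) {h : Coord n → ℝ}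
    (hh : DifferentiableAt ℝ h z.1) :
    V.apply (fun z ↦ real (h z.1)) z = real (∑ i, x i * pd i h z.1) := by
  simp only [apply, dX_real hh, dP_real hh, dXi_apply, leftDeriv_real, hx, mul_zero, add_zero,
    real_sum, real_mul]

lemma IsEven.apply_linear (hV : V.IsEven) (hx : ∀ i, V.x i z = real (x i))
    {u : Fin n → Coord n → ℝ} (hu : ∀ m, DifferentiableAt ℝ (u m) z.1) :
    V.apply (fun z ↦ linear fun m ↦ u m z.1) z =
      linear (fun m ↦ ∑ i, x i * pd i (u m) z.1) + ∑ m, real (u m z.1) * V.xi m z := by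
  have hd (m : Fin n) := differentiableAt_real_fst (hu m)
  unfold linear
  rw [apply_sum _ fun m _ ↦ differentiableAt_grassmann_mul (hd m) (differentiableAt_const _),
    ← Finset.sum_add_distrib]
  refine Finset.sum_congr rfl fun m _ ↦ ?_
  rw [hV.apply_mul (hd m) (differentiableAt_const _), apply_real hx (hu m), apply_xi]

lemma IsEven.apply_quadratic (hV : V.IsEven) (hx : ∀ i, V.x i z = real (x i))
    {A : Fin n → Fin n → ℝ} (hxi : ∀ k, V.xi k z = linear (A k))
    {f : Fin n → Fin n → Coord n → ℝ} (hf : ∀ b m, DifferentiableAt ℝ (f b m) z.1) :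
    V.apply (fun z ↦ quadratic fun b m ↦ f b m z.1) z =
      quadratic (fun b m ↦ ∑ i, x i * pd i (f b m) z.1)
        + quadratic (fun b m ↦ ∑ k, A k b * f k m z.1 + ∑ k, f b k z.1 * A k m) := by
  have hd (b m : Fin n) := differentiableAt_real_fst (hf b m)
  have hdm (b m : Fin n) := differentiableAt_grassmann_mul (hd b m)
    (differentiableAt_const (Supercotangent.xi b * Supercotangent.xi m))
  have leibniz (b m : Fin n) :
      V.apply (fun z ↦ real (f b m z.1) * (Supercotangent.xi b * Supercotangent.xi m)) z =
        real (∑ i, x i * pd i (f b m) z.1) * (Supercotangent.xi b * Supercotangent.xi m)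
        + real (f b m z.1) * (linear (A b) * Supercotangent.xi m
          + Supercotangent.xi b * linear (A m)) := by
    rw [hV.apply_mul (hd b m) (differentiableAt_const _), apply_real hx (hf b m),
      hV.apply_mul (differentiableAt_const _) (differentiableAt_const _), apply_xi, apply_xi, hxi,
      hxi]
  rw [← sum_real_mul_linear_mul_xi A fun b m ↦ f b m z.1]
  unfold quadratic
  rw [apply_sum _ fun b _ ↦ DifferentiableAt.fun_sum fun m _ ↦ hdm b m, ← Finset.sum_add_distrib]
  refine Finset.sum_congr rfl fun b _ ↦ ?_
  rw [apply_sum _ fun m _ ↦ hdm b m, ← Finset.sum_add_distrib]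
  exact Finset.sum_congr rfl fun m _ ↦ leibniz b m

end LocalField

section LieDerivatives

/-- The vector field `V` projects onto `X` near the point `z` of the domain of the chart `φ`. -/
def LocalField.ProjectsTo (V : LocalField n) (X : VField n M) (φ : Chart n M)
    (z : Coord n × Coord n) : Prop :=
  ∀ i, V.x i =ᶠ[𝓝 z] fun z ↦ real (vcomp X φ i z.1)

variable {φ : Chart n M} {X : VField n M} {V : LocalField n} {z : Coord n × Coord n}

namespace LocalField.ProjectsTo

lemma x_eq (hx : V.ProjectsTo X φ z) (i : Fin n) : V.x i z = real (vcomp X φ i z.1) :=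
  (hx i).eq_of_nhds

lemma dXi_x (hx : V.ProjectsTo X φ z) (j i : Fin n) : dXi j (V.x i) z = 0 := by
  rw [dXi_apply, hx.x_eq, leftDeriv_real]

variable [IsManifold (𝓡 n) ∞ M]

lemma dX_x (hx : V.ProjectsTo X φ z) (hX : IsSmooth X) (hz : z.1 ∈ φ.1.target) (j i : Fin n) :
    dX j (V.x i) z = real (pd j (vcomp X φ i) z.1) := by
  rw [dX_congr (hx i), dX_real (differentiableAt_vcomp hX hz i)]

lemma dP_x (hx : V.ProjectsTo X φ z) (hX : IsSmooth X) (hz : z.1 ∈ φ.1.target) (j i : Fin n) :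
    dP j (V.x i) z = 0 := by
  rw [dP_congr (hx i), dP_real (differentiableAt_vcomp hX hz i)]

end LocalField.ProjectsTo

variable [IsManifold (𝓡 n) ∞ M]

namespace PseudoRiemannianMetric

variable {g : PseudoRiemannianMetric n M} {lam : M → ℝ} {hbar : ℝ}

lemma alpha_x_eq (g : PseudoRiemannianMetric n M) (φ : Chart n M) (hbar : ℝ) (l : Fin n) :
    (g.alpha φ hbar).x l = fun z ↦ real (z.2 l)
      + planck hbar • quadratic fun b m ↦ g.christoffelLower φ b m l z.1 := by
  funext z
  simp only [alpha, christoffelLower, quadratic, real_sum, Finset.sum_mul]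
  congr 2
  refine Finset.sum_congr rfl fun b _ ↦ ?_
  rw [Finset.sum_comm]
  refine Finset.sum_congr rfl fun m _ ↦ Finset.sum_congr rfl fun k _ ↦ ?_
  rw [real_mul, mul_assoc, ← mul_assoc (xi b), real_comm]
  simp only [mul_assoc]

lemma alpha_xi_eq (g : PseudoRiemannianMetric n M) (φ : Chart n M) (hbar : ℝ) (j : Fin n) :
    (g.alpha φ hbar).xi j = fun z ↦ planck hbar • linear fun i ↦ g.coef φ i j z.1 := rfl

lemma beta_x_eq (g : PseudoRiemannianMetric n M) (φ : Chart n M) (j : Fin n) :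
    (g.beta φ).x j = fun z ↦ linear fun i ↦ g.coef φ i j z.1 := rfl

lemma lieDeriv_beta_x (hX : IsSmooth X) (hV : V.IsEven) (hz : z.1 ∈ φ.1.target)
    (hx : V.ProjectsTo X φ z) (j : Fin n) :
    (V.lieDeriv (g.beta φ)).x j z =
      linear (fun m ↦ ∑ k, (vcomp X φ k z.1 * pd k (g.coef φ m j) z.1
        + g.coef φ m k z.1 * pd j (vcomp X φ k) z.1))
      + ∑ k, real (g.coef φ k j z.1) * V.xi k z := by
  simp only [LocalField.lieDeriv, beta_x_eq, hx.dX_x hX hz, real_comm]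
  simp only [beta, zero_mul, add_zero]
  rw [hV.apply_linear hx.x_eq fun m ↦ differentiableAt_coef hz m j, sum_real_mul_linear,
    add_right_comm, ← linear_add]
  simp only [Finset.sum_add_distrib, mul_comm (pd j _ _)]

lemma lieDeriv_beta_p (hX : IsSmooth X) (hz : z.1 ∈ φ.1.target) (hx : V.ProjectsTo X φ z)
    (j : Fin n) : (V.lieDeriv (g.beta φ)).p j z = 0 := by
  simp only [LocalField.lieDeriv, hx.dP_x hX hz]
  simp [beta, LocalField.apply_const]

lemma lieDeriv_beta_xi (hx : V.ProjectsTo X φ z) (j : Fin n) :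
    (V.lieDeriv (g.beta φ)).xi j z = 0 := by
  simp only [LocalField.lieDeriv, hx.dXi_x]
  simp [beta, LocalField.apply_const]

lemma lieDeriv_alpha_xi (hV : V.IsEven) (hz : z.1 ∈ φ.1.target) (hx : V.ProjectsTo X φ z)
    (j : Fin n) :
    (V.lieDeriv (g.alpha φ hbar)).xi j z = planck hbar •
      (linear (fun m ↦ ∑ k, vcomp X φ k z.1 * pd k (g.coef φ m j) z.1)
        + ∑ k, real (g.coef φ k j z.1) * V.xi k z
        + ∑ k, linear (fun b ↦ g.coef φ b k z.1) * leftDeriv j (V.xi k z)) := by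
  have hcoef (m : Fin n) := differentiableAt_coef (g := g) hz m j
  simp only [LocalField.lieDeriv, hx.dXi_x]
  simp only [dXi_apply, alpha_xi_eq]
  simp only [alpha, zero_mul, mul_zero, neg_zero, sub_zero, zero_add]
  rw [V.apply_const_smul _ (differentiableAt_linear hcoef), hV.apply_linear hx.x_eq hcoef]
  simp only [smul_mul_assoc, ← Finset.smul_sum, ← smul_add]

lemma lieDeriv_alpha_p (hX : IsSmooth X) (hz : z.1 ∈ φ.1.target) (hx : V.ProjectsTo X φ z)
    {A : Fin n → Fin n → Coord n → ℝ} (hA : ∀ k m, DifferentiableAt ℝ (A k m) z.1)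
    (hxi : ∀ k, V.xi k =ᶠ[𝓝 z] fun z ↦ linear fun m ↦ A k m z.1) (j : Fin n) :
    (V.lieDeriv (g.alpha φ hbar)).p j z = 0 := by
  have hdP (k : Fin n) : dP j (V.xi k) z = 0 := by rw [dP_congr (hxi k), dP_linear (hA k)]
  simp only [LocalField.lieDeriv, hx.dP_x hX hz, hdP]
  simp [alpha, LocalField.apply_const]

lemma apply_alpha_x (hV : V.IsEven) (hz : z.1 ∈ φ.1.target) (hx : V.ProjectsTo X φ z)
    {A : Fin n → Fin n → ℝ} (hxi : ∀ k, V.xi k z = linear (A k)) (l : Fin n) :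
    V.apply ((g.alpha φ hbar).x l) z = V.p l z + planck hbar •
      (quadratic (fun b m ↦ ∑ i, vcomp X φ i z.1 * pd i (g.christoffelLower φ b m l) z.1)
        + quadratic (fun b m ↦ ∑ k, A k b * g.christoffelLower φ k m l z.1
          + ∑ k, g.christoffelLower φ b k l z.1 * A k m)) := by
  have hΓ (b m : Fin n) := differentiableAt_christoffelLower (g := g) hz b m l
  have hquad := differentiableAt_quadratic hΓ
  rw [alpha_x_eq, LocalField.apply_add (differentiableAt_real_snd l z)
    (hquad.fun_const_smul (planck hbar)), LocalField.apply_real_snd,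
    LocalField.apply_const_smul _ hquad, hV.apply_quadratic hx.x_eq hxi hΓ]

lemma lieDeriv_alpha_x (hX : IsSmooth X) (hlam : ContMDiff (𝓡 n) 𝓘(ℝ, ℝ) ∞ lam)
    (hV : V.IsEven) (hz : z.1 ∈ φ.1.target) (hx : V.ProjectsTo X φ z)
    (hxi : ∀ k, V.xi k =ᶠ[𝓝 z] fun z ↦ linear fun m ↦ confMatrix φ X lam k m z.1) (l : Fin n) :
    (V.lieDeriv (g.alpha φ hbar)).x l z = V.p l z
      + ∑ i, real (z.2 i * pd l (vcomp X φ i) z.1)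
      + planck hbar • quadratic fun b m ↦ g.lieChristoffel φ X lam l b m z.1 := by
  have even_part : ∑ i, (g.alpha φ hbar).x i z * dX l (V.x i) z =
      ∑ i, real (z.2 i * pd l (vcomp X φ i) z.1) + planck hbar • quadratic
        (fun b m ↦ ∑ i, pd l (vcomp X φ i) z.1 * g.christoffelLower φ b m i z.1) := by
    rw [quadratic_sum, Finset.smul_sum, ← Finset.sum_add_distrib]
    refine Finset.sum_congr rfl fun i _ ↦ ?_
    rw [hx.dX_x hX hz, alpha_x_eq, add_mul, ← real_mul, smul_mul_assoc, real_comm, quadratic_mul]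
  have odd_part : ∑ k, (g.alpha φ hbar).xi k z * dX l (V.xi k) z = planck hbar • quadratic
      (fun b m ↦ ∑ k, g.coef φ b k z.1 * pd l (confMatrix φ X lam k m) z.1) := by
    have hdX (k : Fin n) : dX l (V.xi k) z = linear fun m ↦ pd l (confMatrix φ X lam k m) z.1 := by
      rw [dX_congr (hxi k), dX_linear fun m ↦ differentiableAt_confMatrix hX hlam hz k m]
    simp only [hdX, alpha_xi_eq, smul_mul_assoc, linear_mul_linear, quadratic_sum, Finset.smul_sum]
  have split : (V.lieDeriv (g.alpha φ hbar)).x l z = V.apply ((g.alpha φ hbar).x l) z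
      + (∑ i, (g.alpha φ hbar).x i z * dX l (V.x i) z
        + ∑ k, (g.alpha φ hbar).xi k z * dX l (V.xi k) z) := by
    rw [← Finset.sum_add_distrib]
    simp only [LocalField.lieDeriv, alpha, zero_mul, add_zero]
  rw [split, apply_alpha_x hV hz hx fun k ↦ (hxi k).eq_of_nhds, even_part, odd_part]
  simp only [lieChristoffel, quadratic_add, smul_add]
  abel

/-- The conformal lift of `X` in natural coordinates, in terms of the conformal factor. -/
def confLift (g : PseudoRiemannianMetric n M) (φ : Chart n M) (X : VField n M) (lam : M → ℝ)
    (hbar : ℝ) : LocalField n where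
  x i := fun z ↦ real (vcomp X φ i z.1)
  p j := fun z ↦ -∑ i, real (z.2 i * pd j (vcomp X φ i) z.1) - planck hbar •
    (linear (fun b ↦ g.coef φ j b z.1) * linear (fun m ↦ pd m (fun y ↦ lam (φ.1.symm y)) z.1))
  xi k := fun z ↦ linear (fun m ↦ confMatrix φ X lam k m z.1)

lemma sum_inv_mul_sum_coef_mul {y : Coord n} (hy : y ∈ φ.1.target) (v : Fin n → ℝ) (k : Fin n) :
    ∑ a, g.inv φ k a y * ∑ l, g.coef φ a l y * v l = v k := by
  simp only [Finset.mul_sum, ← mul_assoc]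
  rw [Finset.sum_comm]
  simp only [← Finset.sum_mul, g.sum_inv_mul_coef φ hy, ite_mul, one_mul, zero_mul,
    Finset.sum_ite_eq, Finset.mem_univ, if_true]

lemma sum_riemann_mul_xiLower (i : Fin n) (z : Coord n × Coord n) :
    ∑ k, ∑ l, ∑ j, real (g.riemann φ k l i j z.1) * g.xiLower φ k z.1 * xi l
        * real (vcomp X φ j z.1)
      = quadratic (fun b m ↦ ∑ j, vcomp X φ j z.1 *
        ∑ k, g.coef φ b k z.1 * g.riemann φ k m i j z.1) := by
  have inner (k l : Fin n) : ∑ j, real (g.riemann φ k l i j z.1) * g.xiLower φ k z.1 * xi l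
      * real (vcomp X φ j z.1) = linear (fun b ↦ ∑ j, vcomp X φ j z.1 *
        (g.coef φ b k z.1 * g.riemann φ k l i j z.1)) * xi l := by
    have hlower : g.xiLower φ k z.1 = linear fun b ↦ g.coef φ b k z.1 := by
      simp only [xiLower, linear, g.coef_symm φ k]
    rw [linear_sum, Finset.sum_mul]
    refine Finset.sum_congr rfl fun j _ ↦ ?_
    simp only [mul_comm (g.coef φ _ k z.1)]
    rw [hlower, linear_mul, linear_mul, real_comm]
    simp only [mul_assoc]
  rw [Finset.sum_comm, quadratic_eq_sum_linear_mul]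
  refine Finset.sum_congr rfl fun m _ ↦ ?_
  simp only [inner, ← Finset.sum_mul, ← linear_sum, Finset.mul_sum]
  congr 2
  exact funext fun b ↦ Finset.sum_comm

lemma sum_christoffel_mul_sub_sum_nablaX (i : Fin n) (y p : Coord n) :
    ∑ j, ∑ k, vcomp X φ j y * g.christoffel φ k j i y * p k - ∑ j, p j * g.nablaX φ X i j y
      = -∑ j, p j * pd i (vcomp X φ j) y := by
  have torsion_free (k : Fin n) : ∑ j, vcomp X φ j y * g.christoffel φ k j i y * p k
      = p k * ∑ j, g.christoffel φ k i j y * vcomp X φ j y := by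
    rw [Finset.mul_sum]
    exact Finset.sum_congr rfl fun j _ ↦ by rw [g.christoffel_symm φ k i j]; ring
  rw [Finset.sum_comm]
  simp only [torsion_free, nablaX, mul_add, Finset.sum_add_distrib]
  ring

namespace IsConformalFactor

variable {y : Coord n}

lemma confMatrix_skew (h : g.IsConformalFactor X lam) (hy : y ∈ φ.1.target) (m j : Fin n) :
    ∑ k, vcomp X φ k y * pd k (g.coef φ m j) y + ∑ k, g.coef φ k j y * confMatrix φ X lam k m y
      + ∑ k, confMatrix φ X lam k j y * g.coef φ m k y = 0 := by
  have killing := h.lieCoef_eq φ m j y hy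
  simp only [lieCoef, Finset.sum_add_distrib] at killing
  simp only [mul_comm _ (g.coef φ m _ y), confMatrix, mul_sub, mul_ite, mul_zero,
    Finset.sum_sub_distrib, Finset.sum_ite_eq', Finset.mem_univ, if_true]
  linear_combination killing

lemma sum_coef_mul_confMatrix_add (h : g.IsConformalFactor X lam) (hy : y ∈ φ.1.target)
    (m j : Fin n) :
    ∑ k, (vcomp X φ k y * pd k (g.coef φ m j) y + g.coef φ m k y * pd j (vcomp X φ k) y)
      + ∑ k, g.coef φ k j y * confMatrix φ X lam k m y
      = 1 / 2 * lam (φ.1.symm y) * g.coef φ m j y := by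
  have killing := h.lieCoef_eq φ m j y hy
  simp only [lieCoef, Finset.sum_add_distrib] at killing
  simp only [confMatrix, mul_sub, mul_ite, mul_zero, Finset.sum_sub_distrib, Finset.sum_ite_eq',
    Finset.mem_univ, if_true, Finset.sum_add_distrib]
  linear_combination killing

lemma confMatrix_eq (h : g.IsConformalFactor X lam) (hy : y ∈ φ.1.target) (k j : Fin n) :
    confMatrix φ X lam k j y = ∑ i, g.inv φ i k y * g.rot φ X i j y
      - ∑ i, vcomp X φ i y * g.christoffel φ k i j y := by
  have raise (i : Fin n) : ∑ a, g.inv φ k a y * g.christoffelLower φ a j i y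
      = g.christoffel φ k i j y := by
    rw [g.christoffel_symm φ k i j]
    exact sum_inv_mul_sum_coef_mul hy (fun l ↦ g.christoffel φ l j i y) k
  rw [← sum_inv_mul_sum_coef_mul (g := g) hy (fun l ↦ confMatrix φ X lam l j y) k]
  simp only [h.sum_coef_mul_confMatrix hy, mul_sub, Finset.sum_sub_distrib, g.inv_symm φ k,
    Finset.mul_sum, mul_left_comm (g.inv φ _ k y)]
  rw [Finset.sum_comm]
  simp only [← Finset.mul_sum, g.inv_symm φ _ k, raise]

lemma quadratic_lieChristoffel (h : g.IsConformalFactor X lam) (hy : y ∈ φ.1.target) (l : Fin n) :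
    quadratic (fun b m ↦ g.lieChristoffel φ X lam l b m y) =
      linear (fun b ↦ g.coef φ l b y) * linear (fun m ↦ pd m (fun y ↦ lam (φ.1.symm y)) y) := by
  rw [← quadratic_half_antisymm]
  simp only [h.lieChristoffel_eq hy, g.coef_symm φ l]

lemma lieDeriv_alpha_x_eq_zero_iff (h : g.IsConformalFactor X lam) (hV : V.IsEven)
    (hz : z.1 ∈ φ.1.target) (hx : V.ProjectsTo X φ z)
    (hxi : ∀ k, V.xi k =ᶠ[𝓝 z] (g.confLift φ X lam hbar).xi k) (l : Fin n) :
    (V.lieDeriv (g.alpha φ hbar)).x l z = 0 ↔ V.p l z = (g.confLift φ X lam hbar).p l z := by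
  rw [lieDeriv_alpha_x h.smooth h.smooth_factor hV hz hx hxi, h.quadratic_lieChristoffel hz,
    add_assoc, add_eq_zero_iff_eq_neg, neg_add, ← sub_eq_add_neg]
  rfl

lemma lieDeriv_alpha_xi_eq_zero (h : g.IsConformalFactor X lam) (hV : V.IsEven)
    (hz : z.1 ∈ φ.1.target) (hx : V.ProjectsTo X φ z)
    (hxi : ∀ k, V.xi k z = (g.confLift φ X lam hbar).xi k z) (j : Fin n) :
    (V.lieDeriv (g.alpha φ hbar)).xi j z = 0 := by
  rw [lieDeriv_alpha_xi hV hz hx]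
  simp only [hxi, confLift, leftDeriv_linear, real_comm, sum_real_mul_linear, ← linear_add,
    h.confMatrix_skew hz, linear_zero, smul_zero]

lemma lieDeriv_beta_x_eq (h : g.IsConformalFactor X lam) (hV : V.IsEven)
    (hz : z.1 ∈ φ.1.target) (hx : V.ProjectsTo X φ z)
    (hxi : ∀ k, V.xi k z = (g.confLift φ X lam hbar).xi k z) (j : Fin n) :
    (V.lieDeriv (g.beta φ)).x j z = real (1 / 2 * lam (φ.1.symm z.1)) * (g.beta φ).x j z := by
  rw [lieDeriv_beta_x h.smooth hV hz hx]
  simp only [hxi, confLift, sum_real_mul_linear, ← linear_add, h.sum_coef_mul_confMatrix_add hz,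
    linear_mul, beta_x_eq]

lemma confLift_xi (h : g.IsConformalFactor X lam) (hz : z.1 ∈ φ.1.target) (k : Fin n) :
    (g.confLift φ X lam hbar).xi k z = (g.explicitLift φ X hbar).xi k z := by
  simp only [confLift, h.confMatrix_eq hz, explicitLift, linear_sub, linear_sum]
  rfl

lemma confLift_p (h : g.IsConformalFactor X lam) (hz : z.1 ∈ φ.1.target) (i : Fin n) :
    (g.confLift φ X lam hbar).p i z = (g.explicitLift φ X hbar).p i z := by
  have momentum := congrArg (real (n := n))
    (sum_christoffel_mul_sub_sum_nablaX (g := g) (φ := φ) (X := X) i z.1 z.2)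
  simp only [real_sub, real_neg, real_sum] at momentum
  have rotation : ∑ k, ∑ l, real (g.nablaRot φ X i k l z.1) * xi k * xi l
      = quadratic (fun b m ↦ g.nablaRot φ X i b m z.1) := by
    simp only [quadratic, mul_assoc]
  have spin := h.quadratic_lieChristoffel hz i
  simp only [confLift, explicitLift, momentum, rotation, sum_riemann_mul_xiLower, ← spin]
  rw [sub_eq_add_neg, ← smul_neg]
  congr 2
  rw [eq_sub_iff_add_eq, neg_add_eq_iff_eq_add, ← quadratic_add]
  simp only [h.lieChristoffel_eq_curvature hz, sub_add_cancel]

end IsConformalFactor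

end PseudoRiemannianMetric

end LieDerivatives

section ConformalLift

namespace PseudoRiemannianMetric

lemma planck_ne_zero {hbar : ℝ} (hh : hbar ≠ 0) : planck hbar ≠ 0 := by
  simp [planck, hh]

variable [IsManifold (𝓡 n) ∞ M]
variable {g : PseudoRiemannianMetric n M} {φ : Chart n M} {X : VField n M} {V : LocalField n}
  {y : Coord n} {z : Coord n × Coord n} {hbar : ℝ} {lam : M → ℝ}

lemma eq_of_sum_coef_mul_eq (hy : y ∈ φ.1.target) {u v : Fin n → Grassmann n}
    (h : ∀ j, ∑ k, real (g.coef φ k j y) * u k = ∑ k, real (g.coef φ k j y) * v k) : u = v := by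
  have raise (w : Fin n → Grassmann n) (l : Fin n) :
      ∑ j, real (g.inv φ l j y) * ∑ k, real (g.coef φ k j y) * w k = w l := by
    have hinv (k : Fin n) : (∑ j, real (g.inv φ l j y) * real (g.coef φ k j y)) * w k
        = if l = k then w k else 0 := by
      simp only [← real_mul, ← real_sum, g.coef_symm φ k, g.sum_inv_mul_coef φ hy]
      split_ifs <;> simp [real_one, real_zero]
    simp only [Finset.mul_sum, ← mul_assoc]
    rw [Finset.sum_comm]
    simp only [← Finset.sum_mul, hinv, Finset.sum_ite_eq, Finset.mem_univ, if_true]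
  funext l
  rw [← raise u, ← raise v]
  simp only [h]

lemma sum_coef_mul_xi_of_lieDeriv_beta (hX : IsSmooth X) (hV : V.IsEven)
    (hz : z.1 ∈ φ.1.target) (hx : V.ProjectsTo X φ z) {f : ℂ} {j : Fin n}
    (hβ : (V.lieDeriv (g.beta φ)).x j z = f • (g.beta φ).x j z) :
    ∑ k, real (g.coef φ k j z.1) * V.xi k z = ∑ m, (f * g.coef φ m j z.1
      - ((∑ k, (vcomp X φ k z.1 * pd k (g.coef φ m j) z.1
        + g.coef φ m k z.1 * pd j (vcomp X φ k) z.1) : ℝ) : ℂ)) • xi m := by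
  rw [lieDeriv_beta_x hX hV hz hx] at hβ
  rw [eq_sub_of_add_eq' hβ]
  simp only [beta, linear, Finset.smul_sum, smul_real_mul, sub_smul, Finset.sum_sub_distrib]
  simp only [real_mul_eq_smul]

lemma sum_linear_mul_leftDeriv_xi (g : PseudoRiemannianMetric n M) (φ : Chart n M)
    (V : LocalField n) (z : Coord n × Coord n) (j : Fin n) :
    ∑ k, linear (fun b ↦ g.coef φ b k z.1) * leftDeriv j (V.xi k z)
      = ∑ b, xi b * leftDeriv j (∑ k, real (g.coef φ k b z.1) * V.xi k z) := by
  simp only [linear, map_sum, leftDeriv_real_mul, Finset.sum_mul, Finset.mul_sum]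
  rw [Finset.sum_comm]
  refine Finset.sum_congr rfl fun b _ ↦ Finset.sum_congr rfl fun k _ ↦ ?_
  rw [← mul_assoc, real_comm, g.coef_symm φ b k]

lemma lieCoef_of_lieDeriv (hh : hbar ≠ 0) (hX : IsSmooth X) (hV : V.IsEven)
    (hz : z.1 ∈ φ.1.target) (hx : V.ProjectsTo X φ z) {f : ℂ}
    (hβ : ∀ j, (V.lieDeriv (g.beta φ)).x j z = f • (g.beta φ).x j z) {j : Fin n}
    (hα : (V.lieDeriv (g.alpha φ hbar)).xi j z = 0) (m : Fin n) :
    (g.lieCoef φ X m j z.1 : ℂ) = 2 * f * g.coef φ m j z.1 := by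
  rw [lieDeriv_alpha_xi hV hz hx] at hα
  have hsum := (smul_eq_zero.1 hα).resolve_left (planck_ne_zero hh)
  simp only [sum_linear_mul_leftDeriv_xi,
    fun j ↦ sum_coef_mul_xi_of_lieDeriv_beta hX hV hz hx (hβ j)] at hsum
  simp only [linear, map_sum, map_smul, leftDeriv_xi, smul_ite, smul_zero, Finset.sum_ite_eq,
    Finset.mem_univ, if_true, mul_smul_comm, mul_one, real_mul_eq_smul, ← Finset.sum_add_distrib,
    ← add_smul] at hsum
  have hm := sum_smul_xi_injective (b := fun _ ↦ 0) (hsum.trans (by simp)) m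
  simp only [lieCoef, Finset.sum_add_distrib, g.coef_symm φ j] at hm ⊢
  push_cast at hm ⊢
  linear_combination -hm

variable (g φ hbar X) in
/-- In the chart `φ`, the vector field `V` is a lift of `X` that preserves `α` and multiplies `β`
by `f`. -/
structure IsLocalConformalLift (f : M → ℂ) (V : LocalField n) : Prop where
  isEven : V.IsEven
  smoothAt : ∀ z ∈ φ.domain, V.SmoothAt z
  x_eq : ∀ i, ∀ z ∈ φ.domain, V.x i z = real (vcomp X φ i z.1)
  lieDeriv_alpha : ∀ s, ∀ z ∈ φ.domain, (V.lieDeriv (g.alpha φ hbar)).coeff s z = 0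
  lieDeriv_beta : ∀ s, ∀ z ∈ φ.domain,
    (V.lieDeriv (g.beta φ)).coeff s z = f (φ.1.symm z.1) • (g.beta φ).coeff s z

namespace IsLocalConformalLift

variable {f : M → ℂ}

lemma projectsTo (h : g.IsLocalConformalLift φ X hbar f V) (hz : z ∈ φ.domain) :
    V.ProjectsTo X φ z :=
  fun i ↦ eventually_of_mem (φ.isOpen_domain.mem_nhds hz) (h.x_eq i)

lemma lieCoef_eq (h : g.IsLocalConformalLift φ X hbar f V) (hh : hbar ≠ 0) (hX : IsSmooth X)
    (hy : y ∈ φ.1.target) (m j : Fin n) :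
    (g.lieCoef φ X m j y : ℂ) = 2 * f (φ.1.symm y) * g.coef φ m j y := by
  have hz : ((y, 0) : Coord n × Coord n) ∈ φ.domain := ⟨hy, trivial⟩
  exact lieCoef_of_lieDeriv hh hX h.isEven hy (h.projectsTo hz)
    (fun j ↦ h.lieDeriv_beta (.inl j) _ hz) (h.lieDeriv_alpha (.inr (.inr j)) _ hz) m

lemma xi_eq (h : g.IsLocalConformalLift φ X hbar f V) (hh : hbar ≠ 0)
    (hl : g.IsConformalFactor X lam) (hz : z ∈ φ.domain) :
    (fun k ↦ V.xi k z) = fun k ↦ (g.confLift φ X lam hbar).xi k z := by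
  refine eq_of_sum_coef_mul_eq (g := g) hz.1 fun j ↦ ?_
  rw [sum_coef_mul_xi_of_lieDeriv_beta hl.smooth h.isEven hz.1 (h.projectsTo hz)
    (h.lieDeriv_beta (.inl j) z hz)]
  simp only [confLift, sum_real_mul_linear]
  simp only [linear, real_mul_eq_smul]
  refine Finset.sum_congr rfl fun m _ ↦ congrArg (· • xi m) ?_
  have factor := h.lieCoef_eq hh hl.smooth hz.1 m j
  have rotation := congrArg ((↑) : ℝ → ℂ) (hl.sum_coef_mul_confMatrix_add hz.1 m j)
  rw [hl.lieCoef_eq φ _ _ _ hz.1] at factor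
  push_cast at factor rotation ⊢
  linear_combination -rotation - factor / 2

lemma coeff_eq (h : g.IsLocalConformalLift φ X hbar f V) (hh : hbar ≠ 0)
    (hl : g.IsConformalFactor X lam) (hz : z ∈ φ.domain) (s : Index n) :
    V.coeff s z = (g.confLift φ X lam hbar).coeff s z := by
  rcases s with i | i | i
  · exact h.x_eq i z hz
  · refine (hl.lieDeriv_alpha_x_eq_zero_iff h.isEven hz.1 (h.projectsTo hz)
      (fun k ↦ ?_) i).1 (h.lieDeriv_alpha (.inl i) z hz)
    exact eventually_of_mem (φ.isOpen_domain.mem_nhds hz) fun w hw ↦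
      congrFun (h.xi_eq hh hl hw) k
  · exact congrFun (h.xi_eq hh hl hz) i

end IsLocalConformalLift

end PseudoRiemannianMetric

open PseudoRiemannianMetric

namespace SuperVectorField

lemma isEven (V : SuperVectorField n M) (φ : Chart n M) : (V.comp φ).IsEven
  | .inl i, z => V.even_x φ i z
  | .inr (.inl i), z => V.even_p φ i z
  | .inr (.inr i), z => V.odd_xi φ i z

lemma smoothAt (V : SuperVectorField n M) (φ : Chart n M) {z : Coord n × Coord n}
    (hz : z ∈ φ.domain) : (V.comp φ).SmoothAt z
  | .inl i => (V.smooth_x φ i).contDiffAt (φ.isOpen_domain.mem_nhds hz)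
  | .inr (.inl i) => (V.smooth_p φ i).contDiffAt (φ.isOpen_domain.mem_nhds hz)
  | .inr (.inr i) => (V.smooth_xi φ i).contDiffAt (φ.isOpen_domain.mem_nhds hz)

lemma coeff_of_notMem (V : SuperVectorField n M) (φ : Chart n M) {z : Coord n × Coord n}
    (hz : z ∉ φ.domain) (s : Index n) : (V.comp φ).coeff s z = 0 := by
  rcases s with i | i | i
  · exact V.off_x φ i z hz
  · exact V.off_p φ i z hz
  · exact V.off_xi φ i z hz

lemma eq_of_coeff_eq {V W : SuperVectorField n M}
    (h : ∀ φ : Chart n M, ∀ z ∈ φ.domain, ∀ s, (V.comp φ).coeff s z = (W.comp φ).coeff s z) :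
    V = W := by
  have hcoeff (φ : Chart n M) (s : Index n) : (V.comp φ).coeff s = (W.comp φ).coeff s := by
    funext z
    by_cases hz : z ∈ φ.domain
    · exact h φ z hz s
    · rw [V.coeff_of_notMem φ hz, W.coeff_of_notMem φ hz]
  exact SuperVectorField.ext (funext fun φ ↦ LocalField.ext (funext fun i ↦ hcoeff φ (.inl i))
    (funext fun i ↦ hcoeff φ (.inr (.inl i))) (funext fun i ↦ hcoeff φ (.inr (.inr i))))

end SuperVectorField

variable [IsManifold (𝓡 n) ∞ M] {g : PseudoRiemannianMetric n M} {φ : Chart n M}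
  {X : VField n M} {V W : SuperVectorField n M} {hbar : ℝ}

namespace PseudoRiemannianMetric

lemma isConformalLift_iff : g.IsConformalLift hbar X V ↔
    ∃ f : M → ℂ, ContMDiff (𝓡 n) 𝓘(ℝ, ℂ) ∞ f ∧
      ∀ φ, g.IsLocalConformalLift φ X hbar f (V.comp φ) := by
  constructor
  · rintro ⟨hx, hα, f, hf, hβ⟩
    refine ⟨f, hf, fun φ ↦ ⟨V.isEven φ, fun z ↦ V.smoothAt φ, hx φ, ?_, ?_⟩⟩
    · rintro (i | i | i) z hz
      exacts [(hα φ i z hz).1, (hα φ i z hz).2.1, (hα φ i z hz).2.2]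
    · rintro (i | i | i) z hz
      exacts [(hβ φ i z hz).1, (hβ φ i z hz).2.1, (hβ φ i z hz).2.2]
  · rintro ⟨f, hf, h⟩
    exact ⟨fun φ ↦ (h φ).x_eq,
      fun φ j z hz ↦ ⟨(h φ).lieDeriv_alpha (.inl j) z hz,
        (h φ).lieDeriv_alpha (.inr (.inl j)) z hz, (h φ).lieDeriv_alpha (.inr (.inr j)) z hz⟩,
      f, hf, fun φ j z hz ↦ ⟨(h φ).lieDeriv_beta (.inl j) z hz,
        (h φ).lieDeriv_beta (.inr (.inl j)) z hz, (h φ).lieDeriv_beta (.inr (.inr j)) z hz⟩⟩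

lemma mem_conf_of_isLocalConformalLift {U : Chart n M → LocalField n} {f : M → ℂ}
    (hh : hbar ≠ 0) (hX : IsSmooth X) (hf : ContMDiff (𝓡 n) 𝓘(ℝ, ℂ) ∞ f)
    (h : ∀ φ, g.IsLocalConformalLift φ X hbar f (U φ)) : X ∈ g.conf := by
  refine ⟨hX, fun q ↦ 2 * (f q).re,
    contMDiff_const.mul (Complex.reCLM.contDiff.contMDiff.comp hf), fun φ i j y hy ↦ ?_⟩
  simpa using congrArg Complex.re ((h φ).lieCoef_eq hh hX hy i j)

namespace IsConformalLift

lemma mem_conf (h : g.IsConformalLift hbar X V) (hh : hbar ≠ 0) (hX : IsSmooth X) : X ∈ g.conf := by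
  obtain ⟨f, hf, hV⟩ := isConformalLift_iff.1 h
  exact mem_conf_of_isLocalConformalLift hh hX hf hV

lemma isExplicitLift (h : g.IsConformalLift hbar X V) (hh : hbar ≠ 0) (hX : X ∈ g.conf) :
    g.IsExplicitLift hbar X V := by
  obtain ⟨lam, hl⟩ := mem_conf_iff.1 hX
  obtain ⟨f, -, hV⟩ := isConformalLift_iff.1 h
  exact fun φ i z hz ↦ ⟨(hV φ).x_eq i z hz,
    ((hV φ).coeff_eq hh hl hz (.inr (.inl i))).trans (hl.confLift_p hz.1 i),
    ((hV φ).coeff_eq hh hl hz (.inr (.inr i))).trans (hl.confLift_xi hz.1 i)⟩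

lemma unique (hV : g.IsConformalLift hbar X V) (hW : g.IsConformalLift hbar X W) (hh : hbar ≠ 0)
    (hX : X ∈ g.conf) : V = W := by
  obtain ⟨lam, hl⟩ := mem_conf_iff.1 hX
  obtain ⟨f, -, hV⟩ := isConformalLift_iff.1 hV
  obtain ⟨f', -, hW⟩ := isConformalLift_iff.1 hW
  exact SuperVectorField.eq_of_coeff_eq fun φ z hz s ↦
    ((hV φ).coeff_eq hh hl hz s).trans ((hW φ).coeff_eq hh hl hz s).symm

end IsConformalLift

end PseudoRiemannianMetric

end ConformalLift

/-! ### Existence of the conformal lift -/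

section TransformationLaw

lemma iota_eq_sum (v : Fin n → ℂ) : iota v = ∑ j, v j • (xi j : Grassmann n) := by
  conv_lhs => rw [pi_eq_sum_univ' v]
  simp only [map_sum, map_smul]
  rfl

lemma contDiffOn_real_fst {u : Coord n → ℝ} {s : Set (Coord n)} (hu : ContDiffOn ℝ ∞ u s) :
    ContDiffOn ℝ ∞ (fun z : Coord n × Coord n ↦ (real (u z.1) : Grassmann n)) (s ×ˢ Set.univ) :=
  contDiffOn_real (hu.comp contDiffOn_fst fun _ hz ↦ hz.1)

lemma contDiffOn_linear {u : Fin n → Coord n → ℝ} {s : Set (Coord n)}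
    (hu : ∀ m, ContDiffOn ℝ ∞ (u m) s) :
    ContDiffOn ℝ ∞ (fun z : Coord n × Coord n ↦ linear fun m ↦ u m z.1) (s ×ˢ Set.univ) :=
  ContDiffOn.sum fun m _ ↦ contDiffOn_grassmann_mul (contDiffOn_real_fst (hu m)) contDiffOn_const

lemma contDiffOn_quadratic {u : Fin n → Fin n → Coord n → ℝ} {s : Set (Coord n)}
    (hu : ∀ b m, ContDiffOn ℝ ∞ (u b m) s) :
    ContDiffOn ℝ ∞ (fun z : Coord n × Coord n ↦ quadratic fun b m ↦ u b m z.1)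
      (s ×ˢ Set.univ) :=
  ContDiffOn.sum fun b _ ↦ ContDiffOn.sum fun m _ ↦
    contDiffOn_grassmann_mul (contDiffOn_real_fst (hu b m)) contDiffOn_const

namespace Chart

/-- The substitution `ξ'ⁱ = ∑ⱼ (∂x'ⁱ/∂xʲ) ξʲ` at the point of coordinates `y`. -/
def xiPullback (φ ψ : Chart n M) (y : Coord n) : Grassmann n →ₐ[ℂ] Grassmann n :=
  ExteriorAlgebra.map (Matrix.vecMulLinear ((φ.jacobian ψ y).map ((↑) : ℝ → ℂ)))

/-- The substitution `x' = (ψ ∘ φ⁻¹)(x)`, `p'ᵢ = ∑ⱼ pⱼ ∂xʲ/∂x'ⁱ`. -/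
def cotangentTransition (φ ψ : Chart n M) (z : Coord n × Coord n) : Coord n × Coord n :=
  (φ.transition ψ z.1,
    WithLp.toLp 2 (Matrix.vecMul z.2.ofLp (ψ.jacobian φ (φ.transition ψ z.1))))

variable {φ ψ : Chart n M} {y : Coord n} {z : Coord n × Coord n}

lemma pullback_apply (F : SFun n) :
    φ.pullback ψ F z = φ.xiPullback ψ z.1 (F (φ.cotangentTransition ψ z)) := rfl

lemma cotangentTransition_fst : (φ.cotangentTransition ψ z).1 = φ.transition ψ z.1 := rfl

lemma cotangentTransition_mem_domain (hz : z.1 ∈ φ.overlap ψ) :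
    φ.cotangentTransition ψ z ∈ ψ.domain :=
  ⟨transition_mem_target hz, trivial⟩

lemma xiPullback_real (r : ℝ) : φ.xiPullback ψ y (real r) = real r :=
  AlgHom.commutes _ _

lemma xiPullback_xi (i : Fin n) :
    φ.xiPullback ψ y (xi i) = linear (fun j ↦ φ.jacobian ψ y i j) := by
  have himage : φ.xiPullback ψ y (xi i) = iota (Matrix.vecMul (Pi.single i 1)
      ((φ.jacobian ψ y).map ((↑) : ℝ → ℂ))) := ExteriorAlgebra.map_apply_ι _ _
  rw [himage, iota_eq_sum]
  refine Finset.sum_congr rfl fun j _ ↦ ?_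
  rw [real_mul_eq_smul, Matrix.single_one_vecMul]
  rfl

lemma xiPullback_linear (u : Fin n → ℝ) :
    φ.xiPullback ψ y (linear u) = linear (fun j ↦ ∑ i, u i * φ.jacobian ψ y i j) := by
  rw [← sum_real_mul_linear Finset.univ u fun i j ↦ φ.jacobian ψ y i j]
  simp only [linear, map_sum, map_mul, xiPullback_real, xiPullback_xi]

lemma pullback_coordX (i : Fin n) :
    φ.pullback ψ (coordX i) = fun z ↦ real (φ.transition ψ z.1 i) :=
  funext fun _ ↦ xiPullback_real _

lemma pullback_coordP (i : Fin n) :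
    φ.pullback ψ (coordP i) = fun z ↦ ∑ j, real (z.2 j) *
      real (ψ.jacobian φ (φ.transition ψ z.1) j i) := by
  funext z
  simp only [← real_mul, ← real_sum]
  exact xiPullback_real _

lemma pullback_coordXi (i : Fin n) :
    φ.pullback ψ (coordXi i) = fun z ↦ linear fun j ↦ φ.jacobian ψ z.1 i j :=
  funext fun _ ↦ xiPullback_xi i

lemma differentiableAt_jacobian (hy : y ∈ φ.overlap ψ) (i j : Fin n) :
    DifferentiableAt ℝ (fun w ↦ φ.jacobian ψ w i j) y :=
  differentiableAt_of_contDiffOn (φ.isOpen_overlap ψ) (φ.contDiffOn_jacobian ψ i j) hy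

lemma differentiableAt_jacobian_transition (hy : y ∈ φ.overlap ψ) (i j : Fin n) :
    DifferentiableAt ℝ (fun w ↦ ψ.jacobian φ (φ.transition ψ w) i j) y :=
  (differentiableAt_jacobian (transition_mem_overlap hy) i j).comp y
    (differentiableAt_of_contDiffOn (φ.isOpen_overlap ψ) (φ.contDiffOn_transition ψ) hy)

lemma sum_jacobian_mul_sum_jacobian_mul (hy : y ∈ φ.overlap ψ) (w : Fin n → ℝ) (i : Fin n) :
    ∑ j, ψ.jacobian φ (φ.transition ψ y) j i * ∑ a, φ.jacobian ψ y a j * w a = w i := by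
  simp only [Finset.mul_sum, ← mul_assoc]
  rw [Finset.sum_comm]
  simp only [← Finset.sum_mul, mul_comm (ψ.jacobian φ _ _ _), jacobian_mul_jacobian' hy, ite_mul,
    one_mul, zero_mul, Finset.sum_ite_eq', Finset.mem_univ, if_true]

lemma xiPullback_linear_pd {lam : M → ℝ} (hlam : ContMDiff (𝓡 n) 𝓘(ℝ, ℝ) ∞ lam)
    (hy : y ∈ φ.overlap ψ) :
    φ.xiPullback ψ y (linear fun m ↦ pd m (fun w ↦ lam (ψ.1.symm w)) (φ.transition ψ y))
      = linear fun m ↦ pd m (fun w ↦ lam (φ.1.symm w)) y := by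
  rw [xiPullback_linear]
  congr
  funext m
  exact pd_comp_transition hy (differentiableAt_scalar hlam (transition_mem_target hy))
    (fun w hw ↦ by rw [symm_transition hw]) m

end Chart

open Chart

lemma LocalField.IsEven.apply_pullback_coordP {φ ψ : Chart n M} {z : Coord n × Coord n}
    {V : LocalField n} {x : Fin n → ℝ} (hV : V.IsEven) (hx : ∀ i, V.x i z = real (x i))
    (hz : z.1 ∈ φ.overlap ψ) (i : Fin n) :
    V.apply (φ.pullback ψ (coordP i)) z =
      ∑ j, V.p j z * real (ψ.jacobian φ (φ.transition ψ z.1) j i)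
      + ∑ j, real (z.2 j) *
        real (∑ k, x k * pd k (fun w ↦ ψ.jacobian φ (φ.transition ψ w) j i) z.1) := by
  have hJ (j : Fin n) := differentiableAt_jacobian_transition hz j i
  rw [pullback_coordP, apply_sum _ fun j _ ↦
    differentiableAt_grassmann_mul (differentiableAt_real_snd j z)
      (differentiableAt_real_fst (hJ j)), ← Finset.sum_add_distrib]
  refine Finset.sum_congr rfl fun j _ ↦ ?_
  rw [hV.apply_mul (differentiableAt_real_snd j z) (differentiableAt_real_fst (hJ j)),
    apply_real_snd, apply_real hx (hJ j)]

section Transition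

variable [IsManifold (𝓡 n) ∞ M] {φ ψ : Chart n M} {y : Coord n} {z : Coord n × Coord n}
  {X : VField n M} {lam : M → ℝ}

lemma pd_vcomp_transition (hX : IsSmooth X) (hy : y ∈ φ.overlap ψ) (i m : Fin n) :
    ∑ a, pd a (vcomp X ψ i) (φ.transition ψ y) * φ.jacobian ψ y a m =
      ∑ j, vcomp X φ j y * pd j (fun w ↦ φ.jacobian ψ w i m) y
        + ∑ j, φ.jacobian ψ y i j * pd m (vcomp X φ j) y := by
  have hJ (j : Fin n) := differentiableAt_jacobian hy i j
  have hv (j : Fin n) := differentiableAt_vcomp hX (mem_overlap.1 hy).1 j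
  rw [pd_comp_transition (f := vcomp X ψ i) hy (differentiableAt_vcomp hX
    (transition_mem_target hy) i) (fun w hw ↦ vcomp_transition X hw i) m,
    pd_sum _ fun j ↦ (hJ j).fun_mul (hv j), ← Finset.sum_add_distrib]
  refine Finset.sum_congr rfl fun j _ ↦ ?_
  rw [pd_mul (hJ j) (hv j), pd_jacobian_comm hy, mul_comm (vcomp X φ j y)]

lemma sum_pd_vcomp_mul_jacobian (hX : IsSmooth X) (hy : y ∈ φ.overlap ψ) (i m : Fin n) :
    ∑ j, pd j (vcomp X φ m) y * ψ.jacobian φ (φ.transition ψ y) j i =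
      ∑ j, vcomp X φ j y * pd j (fun w ↦ ψ.jacobian φ (φ.transition ψ w) m i) y
        + ∑ a, ψ.jacobian φ (φ.transition ψ y) m a *
          pd i (vcomp X ψ a) (φ.transition ψ y) := by
  have hy' := transition_mem_overlap hy
  have reverse := pd_vcomp_transition hX hy' m i
  rw [transition_transition hy] at reverse
  rw [reverse]
  congr 1
  have chain (k : Fin n) := pd_comp_transition (f := fun w ↦ ψ.jacobian φ w m i) hy
    (differentiableAt_jacobian hy' m i) (fun w _ ↦ rfl) k
  simp only [← chain, vcomp_transition X hy, Finset.sum_mul, Finset.mul_sum]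
  rw [Finset.sum_comm]
  exact Finset.sum_congr rfl fun k _ ↦ Finset.sum_congr rfl fun a _ ↦ by ring

lemma sum_vecMul_mul_pd_vcomp (hX : IsSmooth X) (hz : z.1 ∈ φ.overlap ψ) (i : Fin n) :
    ∑ a, (φ.cotangentTransition ψ z).2 a * pd i (vcomp X ψ a) (φ.transition ψ z.1) =
      ∑ j, (∑ m, z.2 m * pd j (vcomp X φ m) z.1) * ψ.jacobian φ (φ.transition ψ z.1) j i
      - ∑ j, z.2 j * ∑ k, vcomp X φ k z.1 *
        pd k (fun w ↦ ψ.jacobian φ (φ.transition ψ w) j i) z.1 := by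
  have derivative (m : Fin n) := eq_sub_of_add_eq' (sum_pd_vcomp_mul_jacobian hX hz i m).symm
  simp only [cotangentTransition, Matrix.vecMul, dotProduct, Finset.sum_mul, mul_assoc]
  rw [Finset.sum_comm]
  simp only [← Finset.mul_sum, derivative, mul_sub, Finset.sum_sub_distrib]
  congr 1
  simp only [Finset.mul_sum]
  exact Finset.sum_comm

lemma confMatrix_transition (hX : IsSmooth X) (hy : y ∈ φ.overlap ψ) (i m : Fin n) :
    ∑ a, confMatrix ψ X lam i a (φ.transition ψ y) * φ.jacobian ψ y a m =
      ∑ j, vcomp X φ j y * pd j (fun w ↦ φ.jacobian ψ w i m) y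
        + ∑ j, φ.jacobian ψ y i j * confMatrix φ X lam j m y := by
  simp only [confMatrix, sub_mul, mul_sub, Finset.sum_sub_distrib, pd_vcomp_transition hX hy,
    ite_mul, zero_mul, mul_ite, mul_zero, Finset.sum_ite_eq, Finset.sum_ite_eq', Finset.mem_univ,
    if_true, symm_transition hy]
  ring

lemma xiPullback_linear_coef (g : PseudoRiemannianMetric n M) (hy : y ∈ φ.overlap ψ) (i : Fin n) :
    φ.xiPullback ψ y (linear fun b ↦ g.coef ψ i b (φ.transition ψ y)) =
      ∑ j, real (ψ.jacobian φ (φ.transition ψ y) j i) * linear fun m ↦ g.coef φ j m y := by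
  rw [xiPullback_linear, sum_real_mul_linear]
  congr
  funext m
  rw [← sum_jacobian_mul_sum_jacobian_mul hy
    (fun a ↦ ∑ b, g.coef ψ a b (φ.transition ψ y) * φ.jacobian ψ y b m) i]
  refine Finset.sum_congr rfl fun j _ ↦ congrArg _ ?_
  simp only [PseudoRiemannianMetric.coef_transition hy, Finset.mul_sum]
  exact Finset.sum_congr rfl fun a _ ↦ Finset.sum_congr rfl fun b _ ↦ by ring

end Transition

end TransformationLaw

section Lift

open Chart

/-- The natural coordinates, as superfunctions. -/
def coord : Index n → SFun n := Sum.elim coordX (Sum.elim coordP coordXi)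

/-- The vector field that agrees with `V` on `s` and is `0` elsewhere. -/
def LocalField.restrict (V : LocalField n) (s : Set (Coord n × Coord n)) : LocalField n :=
  ofCoeff fun t ↦ s.indicator (V.coeff t)

section Restrict

variable {V : LocalField n} {s : Set (Coord n × Coord n)} {z : Coord n × Coord n}

lemma LocalField.coeff_restrict (hz : z ∈ s) (t : Index n) :
    (V.restrict s).coeff t z = V.coeff t z := by
  rw [restrict, coeff_ofCoeff, Set.indicator_of_mem hz]

lemma LocalField.coeff_restrict_of_notMem (hz : z ∉ s) (t : Index n) :
    (V.restrict s).coeff t z = 0 := by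
  rw [restrict, coeff_ofCoeff, Set.indicator_of_notMem hz]

lemma LocalField.IsEven.restrict (hV : V.IsEven) (s : Set (Coord n × Coord n)) :
    (V.restrict s).IsEven := by
  intro t z
  by_cases hz : z ∈ s
  · rw [coeff_restrict hz]
    exact hV t z
  · rw [coeff_restrict_of_notMem hz]
    exact zero_mem _

lemma LocalField.contDiffOn_restrict (hV : ∀ z ∈ s, V.SmoothAt z) (t : Index n) :
    ContDiffOn ℝ ∞ ((V.restrict s).coeff t) s :=
  ContDiffOn.congr (fun z hz ↦ (hV z hz t).contDiffWithinAt) fun _ hz ↦ coeff_restrict hz t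

lemma LocalField.apply_congr_coeff {W : LocalField n} (h : ∀ t, V.coeff t z = W.coeff t z)
    (F : SFun n) : V.apply F z = W.apply F z := by
  simp only [apply_eq_sum, h]

end Restrict

/-- The vector field on the supercotangent bundle glued from vector fields in natural coordinates;
their values off the domains of the charts are discarded. -/
def SuperVectorField.ofLocal (U : Chart n M → LocalField n) (even : ∀ φ, (U φ).IsEven)
    (smooth : ∀ φ, ∀ z ∈ φ.domain, (U φ).SmoothAt z)
    (transform : ∀ (φ ψ : Chart n M) (z : Coord n × Coord n) (s : Index n), z.1 ∈ φ.overlap ψ →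
      (U φ).apply (φ.pullback ψ (coord s)) z = φ.pullback ψ ((U ψ).coeff s) z) :
    SuperVectorField n M :=
  have hsmooth φ := LocalField.contDiffOn_restrict (smooth φ)
  have heven φ := (even φ).restrict φ.domain
  have hoff (φ : Chart n M) (s : Index n) : ∀ z ∉ φ.domain,
      ((U φ).restrict φ.domain).coeff s z = 0 :=
    fun _ hz ↦ LocalField.coeff_restrict_of_notMem hz s
  have htransform (φ ψ : Chart n M) (s : Index n) (z : Coord n × Coord n) (hz : z ∈ φ.domain)
      (hψ : φ.1.symm z.1 ∈ ψ.1.source) :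
      ((U φ).restrict φ.domain).apply (φ.pullback ψ (coord s)) z
        = φ.pullback ψ (((U ψ).restrict ψ.domain).coeff s) z := by
    have hy := mem_overlap.2 ⟨hz.1, hψ⟩
    rw [LocalField.apply_congr_coeff fun t ↦ LocalField.coeff_restrict hz t, transform φ ψ z s hy,
      pullback_apply, pullback_apply,
      LocalField.coeff_restrict (cotangentTransition_mem_domain hy)]
  { comp := fun φ ↦ (U φ).restrict φ.domain
    smooth_x := fun φ i ↦ hsmooth φ (.inl i)
    smooth_p := fun φ i ↦ hsmooth φ (.inr (.inl i))
    smooth_xi := fun φ i ↦ hsmooth φ (.inr (.inr i))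
    even_x := fun φ i ↦ heven φ (.inl i)
    even_p := fun φ i ↦ heven φ (.inr (.inl i))
    odd_xi := fun φ i ↦ heven φ (.inr (.inr i))
    transform_x := fun φ ψ i ↦ htransform φ ψ (.inl i)
    transform_p := fun φ ψ i ↦ htransform φ ψ (.inr (.inl i))
    transform_xi := fun φ ψ i ↦ htransform φ ψ (.inr (.inr i))
    off_x := fun φ i ↦ hoff φ (.inl i)
    off_p := fun φ i ↦ hoff φ (.inr (.inl i))
    off_xi := fun φ i ↦ hoff φ (.inr (.inr i)) }

lemma contMDiff_ofReal {f : M → ℝ} (hf : ContMDiff (𝓡 n) 𝓘(ℝ, ℝ) ∞ f) :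
    ContMDiff (𝓡 n) 𝓘(ℝ, ℂ) ∞ fun q ↦ (f q : ℂ) :=
  Complex.ofRealCLM.contDiff.contMDiff.comp hf

namespace PseudoRiemannianMetric

variable [IsManifold (𝓡 n) ∞ M] {g : PseudoRiemannianMetric n M} {φ ψ : Chart n M}
  {X : VField n M} {lam : M → ℝ} {z : Coord n × Coord n} {hbar : ℝ} {V : LocalField n}

lemma isEven_confLift : (g.confLift φ X lam hbar).IsEven := by
  rintro (i | i | i) z
  · exact real_mem_parity _
  · exact sub_mem (neg_mem (sum_mem fun _ _ ↦ real_mem_parity _))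
      (Submodule.smul_mem _ _ (linear_mul_linear_mem_parity _ _))
  · exact linear_mem_parity _

namespace IsConformalFactor

lemma contDiffOn_confLift (h : g.IsConformalFactor X lam) (s : Index n) :
    ContDiffOn ℝ ∞ ((g.confLift φ X lam hbar).coeff s) φ.domain := by
  rcases s with i | j | k
  · exact contDiffOn_real_fst (contDiffOn_vcomp h.smooth φ i)
  · refine ContDiffOn.sub (ContDiffOn.neg (ContDiffOn.sum fun i _ ↦ contDiffOn_real
      (ContDiffOn.mul ?_ ?_))) (ContDiffOn.const_smul _ (contDiffOn_grassmann_mul ?_ ?_))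
    · exact ((EuclideanSpace.proj (𝕜 := ℝ) i).contDiff.comp contDiff_snd).contDiffOn
    · exact (contDiffOn_pd φ.1.open_target (contDiffOn_vcomp h.smooth φ i) j).comp contDiffOn_fst
        fun _ hz ↦ hz.1
    · exact contDiffOn_linear fun b ↦ g.contDiffOn_coef φ j b
    · exact contDiffOn_linear fun m ↦ contDiffOn_pd φ.1.open_target
        (φ.contDiffOn_scalar h.smooth_factor) m
  · exact contDiffOn_linear fun m ↦ contDiffOn_confMatrix h.smooth h.smooth_factor k m

lemma smoothAt_confLift (h : g.IsConformalFactor X lam) (hz : z ∈ φ.domain) :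
    (g.confLift φ X lam hbar).SmoothAt z :=
  fun s ↦ (h.contDiffOn_confLift s).contDiffAt (φ.isOpen_domain.mem_nhds hz)

end IsConformalFactor

lemma confLift_transform_x (hz : z.1 ∈ φ.overlap ψ) (i : Fin n) :
    (g.confLift φ X lam hbar).apply (φ.pullback ψ (coordX i)) z
      = φ.pullback ψ ((g.confLift ψ X lam hbar).x i) z := by
  have hd := differentiableAt_of_contDiffOn (φ.isOpen_overlap ψ)
    (φ.contDiffOn_transition_apply ψ i) hz
  rw [pullback_coordX, LocalField.apply_real (fun _ ↦ rfl) (h := fun w ↦ φ.transition ψ w i) hd,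
    pullback_apply]
  refine Eq.trans ?_ (xiPullback_real _).symm
  congr 1
  rw [cotangentTransition, vcomp_transition X hz]
  exact Finset.sum_congr rfl fun j _ ↦ by rw [jacobian_eq_pd hz, mul_comm]

lemma confLift_transform_xi (hX : IsSmooth X) (hz : z.1 ∈ φ.overlap ψ) (i : Fin n) :
    (g.confLift φ X lam hbar).apply (φ.pullback ψ (coordXi i)) z
      = φ.pullback ψ ((g.confLift ψ X lam hbar).xi i) z := by
  rw [pullback_coordXi, isEven_confLift.apply_linear (fun _ ↦ rfl)
    (u := fun m w ↦ φ.jacobian ψ w i m) (differentiableAt_jacobian hz i), pullback_apply]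
  refine Eq.trans ?_ (xiPullback_linear _).symm
  simp only [cotangentTransition, confMatrix_transition hX hz, linear_add]
  congr 1
  exact sum_real_mul_linear _ _ _

lemma confLift_transform_p (h : g.IsConformalFactor X lam) (hz : z.1 ∈ φ.overlap ψ) (i : Fin n) :
    (g.confLift φ X lam hbar).apply (φ.pullback ψ (coordP i)) z
      = φ.pullback ψ ((g.confLift ψ X lam hbar).p i) z := by
  have hp (j : Fin n) : (g.confLift φ X lam hbar).p j z *
      real (ψ.jacobian φ (φ.transition ψ z.1) j i) =
      -real ((∑ m, z.2 m * pd j (vcomp X φ m) z.1) * ψ.jacobian φ (φ.transition ψ z.1) j i)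
      - planck hbar • (real (ψ.jacobian φ (φ.transition ψ z.1) j i) *
        linear (fun m ↦ g.coef φ j m z.1) *
        linear (fun m ↦ pd m (fun y ↦ lam (φ.1.symm y)) z.1)) := by
    rw [real_comm, confLift, mul_sub, mul_neg, mul_smul_comm, mul_comm (∑ m, _) (_ : ℝ), real_mul,
      real_sum, mul_assoc]
  rw [isEven_confLift.apply_pullback_coordP (fun _ ↦ rfl) hz, pullback_apply]
  simp only [hp]
  simp only [confLift, map_sub, map_neg, map_sum, map_smul, map_mul, xiPullback_real]
  rw [← real_sum, cotangentTransition_fst, sum_vecMul_mul_pd_vcomp h.smooth hz]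
  simp only [xiPullback_linear_pd h.smooth_factor hz,
    xiPullback_linear_coef g hz, Finset.sum_sub_distrib, Finset.sum_neg_distrib, ← real_mul,
    ← real_sum, real_sub, ← Finset.sum_mul, ← Finset.smul_sum]
  abel

lemma IsConformalFactor.isLocalConformalLift (h : g.IsConformalFactor X lam) (hV : V.IsEven)
    (hVeq : ∀ s, ∀ z ∈ φ.domain, V.coeff s z = (g.confLift φ X lam hbar).coeff s z) :
    g.IsLocalConformalLift φ X hbar (fun q ↦ ((1 / 2 * lam q : ℝ) : ℂ)) V := by
  have hev (s : Index n) {z : Coord n × Coord n} (hz : z ∈ φ.domain) :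
      V.coeff s =ᶠ[𝓝 z] (g.confLift φ X lam hbar).coeff s :=
    eventually_of_mem (φ.isOpen_domain.mem_nhds hz) (hVeq s)
  have hx {z : Coord n × Coord n} (hz : z ∈ φ.domain) : V.ProjectsTo X φ z :=
    fun i ↦ hev (.inl i) hz
  refine ⟨hV, fun z hz s ↦ (h.smoothAt_confLift hz s).congr_of_eventuallyEq (hev s hz),
    fun i ↦ hVeq (.inl i), ?_, ?_⟩
  · rintro (j | j | j) z hz
    · exact (h.lieDeriv_alpha_x_eq_zero_iff hV hz.1 (hx hz) (fun k ↦ hev (.inr (.inr k)) hz) j).2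
        (hVeq (.inr (.inl j)) z hz)
    · exact lieDeriv_alpha_p h.smooth hz.1 (hx hz) (h.differentiableAt_confMatrix hz.1)
        (fun k ↦ hev (.inr (.inr k)) hz) j
    · exact h.lieDeriv_alpha_xi_eq_zero hV hz.1 (hx hz) (fun k ↦ hVeq (.inr (.inr k)) z hz) j
  · rintro (j | j | j) z hz
    · exact h.lieDeriv_beta_x_eq hV hz.1 (hx hz) (fun k ↦ hVeq (.inr (.inr k)) z hz) j
    · exact (lieDeriv_beta_p h.smooth hz.1 (hx hz) j).trans (smul_zero _).symm
    · exact (lieDeriv_beta_xi (hx hz) j).trans (smul_zero _).symm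

/-- The lift of a conformal vector field. -/
def IsConformalFactor.lift (h : g.IsConformalFactor X lam) (hbar : ℝ) : SuperVectorField n M :=
  .ofLocal (fun φ ↦ g.confLift φ X lam hbar) (fun _ ↦ isEven_confLift)
    (fun _ _ ↦ h.smoothAt_confLift)
    fun _ _ _ s hz ↦ match s with
      | .inl i => confLift_transform_x hz i
      | .inr (.inl i) => confLift_transform_p h hz i
      | .inr (.inr i) => confLift_transform_xi h.smooth hz i

lemma IsConformalFactor.isConformalLift (h : g.IsConformalFactor X lam) (hbar : ℝ) :
    g.IsConformalLift hbar X (h.lift hbar) :=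
  isConformalLift_iff.2 ⟨_, contMDiff_ofReal (contMDiff_const.mul h.smooth_factor), fun φ ↦
    h.isLocalConformalLift (isEven_confLift.restrict φ.domain) fun s _ hz ↦
      LocalField.coeff_restrict hz s⟩

end PseudoRiemannianMetric

end Lift

/-! ### The Lie algebra of conformal vector fields -/

section LieAlgebra

/-- The derivative `X(f)` of a function on `M` along a vector field. -/
def dirDeriv (X : VField n M) (f : M → ℝ) (q : M) : ℝ := mfderiv (𝓡 n) 𝓘(ℝ, ℝ) f q (X q)

section DirDeriv

variable {X : VField n M} {f : M → ℝ}

lemma dirDeriv_const (X : VField n M) (c : ℝ) (q : M) : dirDeriv X (fun _ ↦ c) q = 0 := by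
  rw [dirDeriv, mfderiv_const]
  rfl

lemma dirDeriv_symm (X : VField n M) {φ : Chart n M} {y : Coord n}
    (hf : ContMDiff (𝓡 n) 𝓘(ℝ, ℝ) ∞ f) (hy : y ∈ φ.1.target) :
    dirDeriv X f (φ.1.symm y) = ∑ k, vcomp X φ k y * pd k (fun y ↦ f (φ.1.symm y)) y := by
  have hcomp := mfderiv_comp y (hf.mdifferentiableAt (by simp))
    (φ.mdifferentiable.mdifferentiableAt_symm hy)
  rw [mfderiv_eq_fderiv] at hcomp
  have hX := congrArg (fun L : Coord n →L[ℝ] ℝ ↦ L (vlocal X φ y)) hcomp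
  refine Eq.trans ?_ (hX.symm.trans (fderiv_apply_eq_sum _ y (vlocal X φ y)))
  exact congrArg (mfderiv (𝓡 n) 𝓘(ℝ, ℝ) f (φ.1.symm y)) (φ.push_pull hy _).symm

variable [IsManifold (𝓡 n) ∞ M]

lemma contMDiff_dirDeriv (hX : IsSmooth X) (hf : ContMDiff (𝓡 n) 𝓘(ℝ, ℝ) ∞ f) :
    ContMDiff (𝓡 n) 𝓘(ℝ, ℝ) ∞ (dirDeriv X f) :=
  (contMDiff_snd_tangentBundle_modelSpace ℝ 𝓘(ℝ, ℝ)).comp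
    ((hf.contMDiff_tangentMap (m := ∞) (by simp)).comp hX)

end DirDeriv

namespace LocalField

variable {φ : Chart n M} {X Y : VField n M} {V W : LocalField n}
  {a : LocalForm n} {f f' : M → ℝ} {z : Coord n × Coord n}

lemma IsEven.lieDeriv_of_eq_smul {b : LocalForm n} (hV : V.IsEven)
    (hx : ∀ i, V.x i z = real (vcomp X φ i z.1)) (hf : ContMDiff (𝓡 n) 𝓘(ℝ, ℝ) ∞ f)
    (ha : ∀ s, DifferentiableAt ℝ (a.coeff s) z) (hz : z ∈ φ.domain)
    (h : ∀ s, ∀ w ∈ φ.domain, b.coeff s w = (f (φ.1.symm w.1) : ℂ) • a.coeff s w)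
    (s : Index n) :
    (V.lieDeriv b).coeff s z = (dirDeriv X f (φ.1.symm z.1) : ℂ) • a.coeff s z
      + (f (φ.1.symm z.1) : ℂ) • (V.lieDeriv a).coeff s z := by
  have hfφ := differentiableAt_scalar hf hz.1
  have hb (s : Index n) :
      b.coeff s =ᶠ[𝓝 z] fun w ↦ real (f (φ.1.symm w.1)) * a.coeff s w :=
    eventually_of_mem (φ.isOpen_domain.mem_nhds hz) fun w hw ↦
      (h s w hw).trans (real_mul_eq_smul _ _).symm
  rw [hV.lieDeriv_of_eventuallyEq_mul (differentiableAt_real_fst hfφ) ha hb, apply_real hx hfφ,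
    dirDeriv_symm X hf hz.1, real_mul_eq_smul, real_mul_eq_smul]

lemma lieDeriv_bracket_of_eq_smul (hV : V.IsEven) (hW : W.IsEven) (hVz : V.SmoothAt z)
    (hWz : W.SmoothAt z) (hVx : ∀ i, V.x i z = real (vcomp X φ i z.1))
    (hWx : ∀ i, W.x i z = real (vcomp Y φ i z.1)) (hf : ContMDiff (𝓡 n) 𝓘(ℝ, ℝ) ∞ f)
    (hf' : ContMDiff (𝓡 n) 𝓘(ℝ, ℝ) ∞ f') (ha : ∀ s, ContDiffAt ℝ ∞ (a.coeff s) z)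
    (hz : z ∈ φ.domain)
    (hVa : ∀ s, ∀ w ∈ φ.domain,
      (V.lieDeriv a).coeff s w = (f (φ.1.symm w.1) : ℂ) • a.coeff s w)
    (hWa : ∀ s, ∀ w ∈ φ.domain,
      (W.lieDeriv a).coeff s w = (f' (φ.1.symm w.1) : ℂ) • a.coeff s w) (s : Index n) :
    (⁅V, W⁆.lieDeriv a).coeff s z
      = ((dirDeriv X f' (φ.1.symm z.1) - dirDeriv Y f (φ.1.symm z.1) : ℝ) : ℂ) • a.coeff s z := by
  have had (s : Index n) : DifferentiableAt ℝ (a.coeff s) z := (ha s).differentiableAt (by simp)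
  rw [lieDeriv_bracket hV hW hVz hWz ha, hV.lieDeriv_of_eq_smul hVx hf' had hz hWa,
    hW.lieDeriv_of_eq_smul hWx hf had hz hVa, hVa s z hz, hWa s z hz]
  push_cast
  module

lemma ProjectsTo.bracket [IsManifold (𝓡 n) ∞ M] (hV : V.ProjectsTo X φ z)
    (hW : W.ProjectsTo Y φ z) (hX : IsSmooth X) (hY : IsSmooth Y) (hz : z.1 ∈ φ.1.target)
    (i : Fin n) :
    ⁅V, W⁆.x i z = real (vcomp (VectorField.mlieBracket (𝓡 n) X Y) φ i z.1) := by
  rw [vcomp_mlieBracket hX hY φ i hz, Finset.sum_sub_distrib, real_sub,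
    ← apply_real hV.x_eq (differentiableAt_vcomp hY hz i),
    ← apply_real hW.x_eq (differentiableAt_vcomp hX hz i), ← apply_of_eventuallyEq (hV i),
    ← apply_of_eventuallyEq (hW i)]
  rfl

end LocalField

namespace PseudoRiemannianMetric

variable [IsManifold (𝓡 n) ∞ M] {g : PseudoRiemannianMetric n M} {φ : Chart n M}
  {X Y : VField n M} {hbar : ℝ} {V W : LocalField n}

lemma contDiffOn_alpha (g : PseudoRiemannianMetric n M) (φ : Chart n M) (hbar : ℝ) (s : Index n) :
    ContDiffOn ℝ ∞ ((g.alpha φ hbar).coeff s) φ.domain := by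
  rcases s with l | _ | j
  · have hp : ContDiffOn ℝ ∞ (fun z : Coord n × Coord n ↦ z.2 l) φ.domain :=
      ((EuclideanSpace.proj (𝕜 := ℝ) l).contDiff.comp contDiff_snd).contDiffOn
    have hΓ := contDiffOn_quadratic fun b m ↦ g.contDiffOn_christoffelLower φ b m l
    refine ContDiffOn.congr ((contDiffOn_real hp).add (hΓ.const_smul (planck hbar))) ?_
    exact fun _ _ ↦ congrFun (alpha_x_eq ..) _
  · exact contDiffOn_const
  · exact (contDiffOn_linear fun i ↦ g.contDiffOn_coef φ i j).const_smul _

lemma contDiffOn_beta (g : PseudoRiemannianMetric n M) (φ : Chart n M) (s : Index n) :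
    ContDiffOn ℝ ∞ ((g.beta φ).coeff s) φ.domain := by
  rcases s with j | _ | _
  · exact contDiffOn_linear fun i ↦ g.contDiffOn_coef φ i j
  · exact contDiffOn_const
  · exact contDiffOn_const

namespace IsLocalConformalLift

section

variable {f f' : M → ℂ}

lemma add (hV : g.IsLocalConformalLift φ X hbar f V) (hW : g.IsLocalConformalLift φ Y hbar f' W) :
    g.IsLocalConformalLift φ (X + Y) hbar (f + f') (V + W) where
  isEven := hV.isEven.add hW.isEven
  smoothAt z hz := (hV.smoothAt z hz).add (hW.smoothAt z hz)
  x_eq i z hz := by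
    rw [vcomp_add, real_add, ← hV.x_eq i z hz, ← hW.x_eq i z hz]
    rfl
  lieDeriv_alpha s z hz := by
    rw [hV.isEven.lieDeriv_add hW.isEven (hV.smoothAt z hz) (hW.smoothAt z hz),
      hV.lieDeriv_alpha s z hz, hW.lieDeriv_alpha s z hz, add_zero]
  lieDeriv_beta s z hz := by
    rw [hV.isEven.lieDeriv_add hW.isEven (hV.smoothAt z hz) (hW.smoothAt z hz),
      hV.lieDeriv_beta s z hz, hW.lieDeriv_beta s z hz, Pi.add_apply, add_smul]

lemma smul (hV : g.IsLocalConformalLift φ X hbar f V) (a : ℝ) :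
    g.IsLocalConformalLift φ (a • X) hbar (a • f) ((a : ℂ) • V) where
  isEven := hV.isEven.smul a
  smoothAt z hz := (hV.smoothAt z hz).smul a
  x_eq i z hz := by
    rw [vcomp_smul, real_mul, real_mul_eq_smul, ← hV.x_eq i z hz]
    rfl
  lieDeriv_alpha s z hz := by
    rw [hV.isEven.lieDeriv_smul _ (hV.smoothAt z hz), hV.lieDeriv_alpha s z hz, smul_zero]
  lieDeriv_beta s z hz := by
    rw [hV.isEven.lieDeriv_smul _ (hV.smoothAt z hz), hV.lieDeriv_beta s z hz, Pi.smul_apply,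
      smul_assoc, Complex.coe_smul]

end

lemma bracket {f f' : M → ℝ} (hV : g.IsLocalConformalLift φ X hbar (fun q ↦ (f q : ℂ)) V)
    (hW : g.IsLocalConformalLift φ Y hbar (fun q ↦ (f' q : ℂ)) W) (hX : IsSmooth X)
    (hY : IsSmooth Y) (hf : ContMDiff (𝓡 n) 𝓘(ℝ, ℝ) ∞ f) (hf' : ContMDiff (𝓡 n) 𝓘(ℝ, ℝ) ∞ f') :
    g.IsLocalConformalLift φ (VectorField.mlieBracket (𝓡 n) X Y) hbar
      (fun q ↦ ((dirDeriv X f' q - dirDeriv Y f q : ℝ) : ℂ)) ⁅V, W⁆ where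
  isEven := hV.isEven.bracket hW.isEven
  smoothAt z hz := (hV.smoothAt z hz).bracket (hW.smoothAt z hz)
  x_eq i z hz := (hV.projectsTo hz).bracket (hW.projectsTo hz) hX hY hz.1 i
  lieDeriv_alpha s z hz := by
    have h := LocalField.lieDeriv_bracket_of_eq_smul (f := fun _ ↦ 0) (f' := fun _ ↦ 0) hV.isEven
      hW.isEven (hV.smoothAt z hz) (hW.smoothAt z hz) (hV.projectsTo hz).x_eq
      (hW.projectsTo hz).x_eq contMDiff_const contMDiff_const
      (fun s ↦ (g.contDiffOn_alpha φ hbar s).contDiffAt (φ.isOpen_domain.mem_nhds hz)) hz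
      (fun s w hw ↦ by simp [hV.lieDeriv_alpha s w hw])
      (fun s w hw ↦ by simp [hW.lieDeriv_alpha s w hw]) s
    simpa [dirDeriv_const] using h
  lieDeriv_beta s z hz :=
    LocalField.lieDeriv_bracket_of_eq_smul hV.isEven hW.isEven (hV.smoothAt z hz)
      (hW.smoothAt z hz) (hV.projectsTo hz).x_eq (hW.projectsTo hz).x_eq hf hf'
      (fun s ↦ (g.contDiffOn_beta φ s).contDiffAt (φ.isOpen_domain.mem_nhds hz)) hz
      hV.lieDeriv_beta hW.lieDeriv_beta s

end IsLocalConformalLift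

lemma IsConformalLift.exists_real_factor {V : SuperVectorField n M}
    (h : g.IsConformalLift hbar X V) (hh : hbar ≠ 0) (hX : X ∈ g.conf) :
    ∃ f : M → ℝ, ContMDiff (𝓡 n) 𝓘(ℝ, ℝ) ∞ f ∧
      ∀ φ, g.IsLocalConformalLift φ X hbar (fun q ↦ (f q : ℂ)) (V.comp φ) := by
  obtain ⟨lam, hl⟩ := mem_conf_iff.1 hX
  obtain ⟨f, -, hV⟩ := isConformalLift_iff.1 h
  exact ⟨fun q ↦ 1 / 2 * lam q, contMDiff_const.mul hl.smooth_factor, fun φ ↦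
    hl.isLocalConformalLift (V.isEven φ) fun s z hz ↦ (hV φ).coeff_eq hh hl hz s⟩

lemma exists_isConformalLift (hX : X ∈ g.conf) (hbar : ℝ) : ∃ V, g.IsConformalLift hbar X V := by
  obtain ⟨lam, hl⟩ := mem_conf_iff.1 hX
  exact ⟨_, hl.isConformalLift hbar⟩

/- Each closure property is read off the lifts for `hbar = 1`, since having a local lift with a
smooth factor makes a vector field conformal. -/

lemma exists_isLocalConformalLift (hX : X ∈ g.conf) :
    ∃ f : M → ℝ, ContMDiff (𝓡 n) 𝓘(ℝ, ℝ) ∞ f ∧ ∃ U : Chart n M → LocalField n,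
      ∀ φ, g.IsLocalConformalLift φ X 1 (fun q ↦ (f q : ℂ)) (U φ) := by
  obtain ⟨V, hV⟩ := exists_isConformalLift hX 1
  obtain ⟨f, hf, hVf⟩ := hV.exists_real_factor one_ne_zero hX
  exact ⟨f, hf, V.comp, hVf⟩

lemma add_mem_conf (hX : X ∈ g.conf) (hY : Y ∈ g.conf) : X + Y ∈ g.conf := by
  obtain ⟨f, hf, U, hU⟩ := exists_isLocalConformalLift hX
  obtain ⟨f', hf', U', hU'⟩ := exists_isLocalConformalLift hY
  exact mem_conf_of_isLocalConformalLift one_ne_zero (hX.1.add hY.1)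
    ((contMDiff_ofReal hf).add (contMDiff_ofReal hf')) fun φ ↦ (hU φ).add (hU' φ)

lemma smul_mem_conf (hX : X ∈ g.conf) (a : ℝ) : a • X ∈ g.conf := by
  obtain ⟨f, hf, U, hU⟩ := exists_isLocalConformalLift hX
  exact mem_conf_of_isLocalConformalLift one_ne_zero (hX.1.smul a)
    ((contDiff_const_smul a).contMDiff.comp (contMDiff_ofReal hf)) fun φ ↦ (hU φ).smul a

lemma mlieBracket_mem_conf (hX : X ∈ g.conf) (hY : Y ∈ g.conf) :
    VectorField.mlieBracket (𝓡 n) X Y ∈ g.conf := by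
  obtain ⟨f, hf, U, hU⟩ := exists_isLocalConformalLift hX
  obtain ⟨f', hf', U', hU'⟩ := exists_isLocalConformalLift hY
  exact mem_conf_of_isLocalConformalLift one_ne_zero (hX.1.mlieBracket hY.1)
    (contMDiff_ofReal ((contMDiff_dirDeriv hX.1 hf').sub (contMDiff_dirDeriv hY.1 hf)))
    fun φ ↦ (hU φ).bracket (hU' φ) hX.1 hY.1 hf hf'

namespace IsConformalLift

variable {z : Coord n × Coord n} {V W U : SuperVectorField n M}

lemma apply_eq {f : M → ℂ} {V' : LocalField n} (h : g.IsConformalLift hbar X V) (hh : hbar ≠ 0)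
    (hX : X ∈ g.conf) (hV' : g.IsLocalConformalLift φ X hbar f V') (hz : z ∈ φ.domain)
    (F : SFun n) : (V.comp φ).apply F z = V'.apply F z := by
  obtain ⟨lam, hl⟩ := mem_conf_iff.1 hX
  obtain ⟨f', -, hV⟩ := isConformalLift_iff.1 h
  exact LocalField.apply_congr_coeff
    (fun s ↦ ((hV φ).coeff_eq hh hl hz s).trans (hV'.coeff_eq hh hl hz s).symm) F

lemma add_apply (hU : g.IsConformalLift hbar (X + Y) U) (hV : g.IsConformalLift hbar X V)
    (hW : g.IsConformalLift hbar Y W) (hh : hbar ≠ 0) (hX : X ∈ g.conf) (hY : Y ∈ g.conf)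
    (hz : z ∈ φ.domain) (F : SFun n) :
    (U.comp φ).apply F z = (V.comp φ).apply F z + (W.comp φ).apply F z := by
  obtain ⟨f, -, hVf⟩ := hV.exists_real_factor hh hX
  obtain ⟨f', -, hWf⟩ := hW.exists_real_factor hh hY
  rw [hU.apply_eq hh (add_mem_conf hX hY) ((hVf φ).add (hWf φ)) hz, LocalField.add_apply]

lemma smul_apply {a : ℝ} (hU : g.IsConformalLift hbar (a • X) U)
    (hV : g.IsConformalLift hbar X V) (hh : hbar ≠ 0) (hX : X ∈ g.conf) (hz : z ∈ φ.domain)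
    (F : SFun n) : (U.comp φ).apply F z = a • (V.comp φ).apply F z := by
  obtain ⟨f, -, hVf⟩ := hV.exists_real_factor hh hX
  rw [hU.apply_eq hh (smul_mem_conf hX a) ((hVf φ).smul a) hz, LocalField.smul_apply,
    real_smul_eq, real_mul_eq_smul]

lemma mlieBracket_apply (hU : g.IsConformalLift hbar (VectorField.mlieBracket (𝓡 n) X Y) U)
    (hV : g.IsConformalLift hbar X V) (hW : g.IsConformalLift hbar Y W) (hh : hbar ≠ 0)
    (hX : X ∈ g.conf) (hY : Y ∈ g.conf) (hz : z ∈ φ.domain) {F : SFun n}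
    (hF : ContDiffOn ℝ ∞ F φ.domain) :
    (U.comp φ).apply F z
      = (V.comp φ).apply ((W.comp φ).apply F) z - (W.comp φ).apply ((V.comp φ).apply F) z := by
  obtain ⟨f, hf, hVf⟩ := hV.exists_real_factor hh hX
  obtain ⟨f', hf', hWf⟩ := hW.exists_real_factor hh hY
  rw [hU.apply_eq hh (mlieBracket_mem_conf hX hY)
      ((hVf φ).bracket (hWf φ) hX.1 hY.1 hf hf') hz]
  exact LocalField.bracket_apply (V.isEven φ) (W.isEven φ) (V.smoothAt φ hz) (W.smoothAt φ hz)
    (hF.contDiffAt (φ.isOpen_domain.mem_nhds hz))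

end IsConformalLift

variable (g) in
lemma zero_mem_conf : (0 : VField n M) ∈ g.conf := by
  have hv (φ : Chart n M) (k : Fin n) : vcomp (0 : VField n M) φ k = fun _ ↦ 0 := by
    funext y
    simp only [vcomp_eq, Pi.zero_apply, map_zero]
  refine ⟨Bundle.contMDiff_zeroSection ℝ (TangentSpace (𝓡 n) : M → Type _), fun _ ↦ 0,
    contMDiff_const, fun φ i j y _ ↦ ?_⟩
  simp [lieCoef, hv, pd_const]

variable (g) in
lemma exists_lift (hbar : ℝ) : ∃ L : VField n M → SuperVectorField n M,
    ∀ X ∈ g.conf, g.IsConformalLift hbar X (L X) := by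
  obtain ⟨V, -⟩ := exists_isConformalLift g.zero_mem_conf hbar
  have : Nonempty (SuperVectorField n M) := ⟨V⟩
  exact ⟨fun X ↦ Classical.epsilon (g.IsConformalLift hbar X),
    fun _ hX ↦ Classical.epsilon_spec (exists_isConformalLift hX hbar)⟩

end PseudoRiemannianMetric

end LieAlgebra

end Supercotangent

end

theorem theorem3p5 {n : ℕ} {M : Type*} [TopologicalSpace M]
    [ChartedSpace (EuclideanSpace ℝ (Fin n)) M] [IsManifold (𝓡 n) ∞ M]
    (g : Supercotangent.PseudoRiemannianMetric n M) (hbar : ℝ) (hbar_ne : hbar ≠ 0) :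
    -- a smooth vector field has a lift preserving `α` and the direction of `β` iff it is conformal
    (∀ X : Supercotangent.VField n M, Supercotangent.IsSmooth X →
      ((∃ V, g.IsConformalLift hbar X V) ↔ X ∈ g.conf)) ∧
    -- the lift is unique and given by the explicit formula
    (∀ X ∈ g.conf, (∃! V, g.IsConformalLift hbar X V) ∧
      ∀ V, g.IsConformalLift hbar X V → g.IsExplicitLift hbar X V) ∧
    -- `conf(M,g)` is a Lie algebra, and the lift is a morphism of Lie algebras
    (∃ L : Supercotangent.VField n M → Supercotangent.SuperVectorField n M,
      (∀ X ∈ g.conf, g.IsConformalLift hbar X (L X)) ∧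
      ∀ X ∈ g.conf, ∀ Y ∈ g.conf, ∀ a : ℝ,
        X + Y ∈ g.conf ∧ a • X ∈ g.conf ∧ VectorField.mlieBracket (𝓡 n) X Y ∈ g.conf ∧
        ∀ (φ : Supercotangent.Chart n M) (F : Supercotangent.SFun n),
          ContDiffOn ℝ ∞ F φ.domain → ∀ z ∈ φ.domain,
          ((L (X + Y)).comp φ).apply F z
            = ((L X).comp φ).apply F z + ((L Y).comp φ).apply F z ∧
          ((L (a • X)).comp φ).apply F z = a • ((L X).comp φ).apply F z ∧
          ((L (VectorField.mlieBracket (𝓡 n) X Y)).comp φ).apply F z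
            = ((L X).comp φ).apply (((L Y).comp φ).apply F) z
              - ((L Y).comp φ).apply (((L X).comp φ).apply F) z) := by
  obtain ⟨L, hL⟩ := g.exists_lift hbar
  refine ⟨fun X hX ↦ ⟨fun ⟨V, hV⟩ ↦ hV.mem_conf hbar_ne hX, fun h ↦ ⟨L X, hL X h⟩⟩,
    fun X hX ↦ ⟨⟨L X, hL X hX, fun V hV ↦ hV.unique (hL X hX) hbar_ne hX⟩,
      fun V hV ↦ hV.isExplicitLift hbar_ne hX⟩, L, hL, fun X hX Y hY a ↦ ?_⟩
  have hadd := Supercotangent.PseudoRiemannianMetric.add_mem_conf hX hY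
  have hsmul := Supercotangent.PseudoRiemannianMetric.smul_mem_conf hX a
  have hbracket := Supercotangent.PseudoRiemannianMetric.mlieBracket_mem_conf hX hY
  exact ⟨hadd, hsmul, hbracket, fun φ F hF z hz ↦
    ⟨(hL _ hadd).add_apply (hL X hX) (hL Y hY) hbar_ne hX hY hz F,
      (hL _ hsmul).smul_apply (hL X hX) hbar_ne hX hz F,
      (hL _ hbracket).mlieBracket_apply (hL X hX) (hL Y hY) hbar_ne hX hY hz hF⟩⟩
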